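/- **Conventions.** All manifolds, metrics, maps, functions and vector fields are $C^\infty$. A Riemannian manifold $(M,g)$ is a *Ricci soliton* if there are a vector field $E$ on $M$ and a constant $A\in\mathbb R$ with $-2\,\mathrm{Ricci}(g)=\mathcal L_Eg+2Ag$. Let $\phi:(M^3,g)\to(N^2,h)$ be a submersive semi-conformal map with dilation $\lambda:M\to(0,\infty)$; that is, $d\phi_x$ is onto and $h(d\phi_x X,d\phi_x Y)=\lambda(x)^2g(X,Y)$ for all $x \in M$ and all $X,Y\in\mathcal H_x=(\ker d\phi_x)^\perp$. Vectors in $\ker d\phi$ are called vertical, vectors in $\mathcal H$ horizontal; $\mathcal V,\mathcal H$ also denote the orthogonal projections. For a unit vertical vector field $U$ put $\theta=g(U,\cdot)$, $\Omega=d\theta$, $\mu=\mathcal H(\nabla_UU)$ (the mean curvature vector field of the fibres), $\mu^\flat=g(\mu,\cdot)$, $I(X,Y)=\mathcal V[X,Y]$ for horizontal fields $X,Y$, $|I|^2=\sum_{a,b=1}^2|I(e_a,e_b)|^2$ for an orthonormal basis $(e_1,e_2)$ of $\mathcal H$, and $d^{\mathcal V}\ln\lambda=U(\ln\lambda)\,\theta$.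 Let $K^N$ denote the Gauss curvature of $(N,h)$ composed with $\phi$, $\Delta=\mathrm{Tr}_g\nabla d$ the Laplacian of $(M,g)$, $d^*\Omega=-\sum_i(\nabla_{e_i}\Omega)(e_i,\cdot)$ for an orthonormal frame $(e_i)$ of $(M,g)$, $\alpha\odot\beta=\tfrac12(\alpha\otimes\beta+\beta\otimes\alpha)$ and $\alpha^2=\alpha\otimes\alpha$. For a function $f$, a horizontal vector field $X$ and $A\in\mathbb R$ consider the equation $$ \begin{aligned} 0={}&\{\lambda^2K^N+\Delta\ln\lambda+\mu(\ln\lambda)-f\,U(\ln\lambda)\}(g-\theta^2)-\tfrac14|I|^2g+\tfrac12\mathcal L_Xg+Ag\\ &-(\mu^\flat+d^{\mathcal V}\ln\lambda)^2-(d^{\mathcal V}\ln\lambda)^2+\{df+f\mu^\flat+2\,d(U(\ln\lambda))+d^*\Omega\}\odot\theta . \end{aligned}\tag{$*$} $$ **Proposition.** 1. Suppose that $U$ is a unit vertical vector field on $M$. Then $(M,g)$ is a Ricci soliton if and only if there are a function $f:M\to\mathbb R$, a horizontal vector field $X$ on $M$ and a constant $A\in\mathbb R$ such that $(*)$ holds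 on $M$. 2. In general (when a unit vertical vector field may exist only locally), $(M,g)$ is a Ricci soliton if and only if there are a vertical vector field $V$ and a horizontal vector field $X$ on $M$ and a constant $A\in\mathbb R$ such that, for every open $W\subseteq M$ and every unit vertical vector field $U$ on $W$, equation $(*)$ holds on $W$ with $f=g(V,U)$, i.e. $V=fU$. -/

import Mathlib

open scoped Manifold ContDiff

noncomputable section

/-! ### Riemannian geometry in coordinates

The objects of this section live on (open subsets of) `EuclideanSpace ℝ (Fin n)`. A metric is a
function `G` with `G x v w` the scalar product of the vectors `v`, `w` at the point `x`; vector
fields are functions with values in `EuclideanSpace ℝ (Fin n)`. All of them depend, at a point `x`,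
only on the germs at `x` of their arguments. -/

namespace CoordGeom

/-- A field of bilinear forms (such as a Riemannian metric) on a coordinate domain. -/
abbrev CoordMetric (n : ℕ) : Type :=
  EuclideanSpace ℝ (Fin n) → EuclideanSpace ℝ (Fin n) → EuclideanSpace ℝ (Fin n) → ℝ

/-- A vector field on a coordinate domain. -/
abbrev CoordField (n : ℕ) : Type := EuclideanSpace ℝ (Fin n) → EuclideanSpace ℝ (Fin n)

/-- The `i`-th coordinate vector. -/
def basisVec {n : ℕ} (i : Fin n) : EuclideanSpace ℝ (Fin n) := EuclideanSpace.single i 1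

/-- The Gram matrix `g_ij`. -/
def gram {n : ℕ} (G : CoordMetric n) (x : EuclideanSpace ℝ (Fin n)) : Matrix (Fin n) (Fin n) ℝ :=
  Matrix.of fun i j => G x (basisVec i) (basisVec j)

/-- The metric trace `g^{ij} B_ij` of a bilinear form `B` at the point `x`; it equals
`∑ B(e_i, e_i)` for any orthonormal basis `(e_i)`. -/
def metricTrace {n : ℕ} (G : CoordMetric n) (x : EuclideanSpace ℝ (Fin n))
    (B : EuclideanSpace ℝ (Fin n) → EuclideanSpace ℝ (Fin n) → ℝ) : ℝ :=
  ∑ i, ∑ j, (gram G x)⁻¹ i j * B (basisVec i) (basisVec j)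

/-- The Christoffel symbols of the first kind,
`(∂_v G(w, z) + ∂_w G(v, z) - ∂_z G(v, w)) / 2`. -/
def christoffelFirst {n : ℕ} (G : CoordMetric n) (x v w z : EuclideanSpace ℝ (Fin n)) : ℝ :=
  (1 / 2) * (fderiv ℝ (fun y => G y w z) x v + fderiv ℝ (fun y => G y v z) x w
    - fderiv ℝ (fun y => G y v w) x z)

/-- The Christoffel symbols of the Levi-Civita connection, as a vector:
`Γ(v, w) = g^{kl} Γ_l(v, w) ∂_k`. -/
def christoffel {n : ℕ} (G : CoordMetric n) (x v w : EuclideanSpace ℝ (Fin n)) :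
    EuclideanSpace ℝ (Fin n) :=
  ∑ k, (∑ l, (gram G x)⁻¹ k l * christoffelFirst G x v w (basisVec l)) • basisVec k

/-- The Levi-Civita covariant derivative `∇_V W`. -/
def covDeriv {n : ℕ} (G : CoordMetric n) (V W : CoordField n) : CoordField n :=
  fun x => fderiv ℝ W x (V x) + christoffel G x (V x) (W x)

/-- The Riemann tensor `R(u, v)w = ∇_u ∇_v w - ∇_v ∇_u w`, where `u`, `v`, `w` are extended to
constant (hence commuting) vector fields. -/
def riemann {n : ℕ} (G : CoordMetric n) (x u v w : EuclideanSpace ℝ (Fin n)) :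
    EuclideanSpace ℝ (Fin n) :=
  covDeriv G (fun _ => u) (covDeriv G (fun _ => v) fun _ => w) x
    - covDeriv G (fun _ => v) (covDeriv G (fun _ => u) fun _ => w) x

/-- The Ricci tensor `Ric(v, w) = trace (u ↦ R(u, v)w)`. -/
def ricci {n : ℕ} (G : CoordMetric n) : CoordMetric n :=
  fun x v w => metricTrace G x fun a b => G x (riemann G x a v w) b

/-- The Gauss curvature `g(R(∂₁, ∂₂)∂₂, ∂₁) / det g` of a metric on a two-dimensional domain. -/
def gaussCurvature (G : CoordMetric 2) (x : EuclideanSpace ℝ (Fin 2)) : ℝ :=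
  G x (riemann G x (basisVec 0) (basisVec 1) (basisVec 1)) (basisVec 0) / (gram G x).det

/-- The Lie derivative `ℒ_E G`:
`(ℒ_E G)(v, w) = ∂_E (G(v, w)) + G(∂_v E, w) + G(v, ∂_w E)` for constant `v`, `w`. -/
def lieMetric {n : ℕ} (E : CoordField n) (G : CoordMetric n) : CoordMetric n :=
  fun x v w => fderiv ℝ (fun y => G y v w) x (E x)
    + G x (fderiv ℝ E x v) w + G x v (fderiv ℝ E x w)

/-- The Hessian `∇du`. -/
def hessian {n : ℕ} (G : CoordMetric n) (u : EuclideanSpace ℝ (Fin n) → ℝ) : CoordMetric n :=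
  fun x v w => fderiv ℝ (fun y => fderiv ℝ u y w) x v - fderiv ℝ u x (christoffel G x v w)

/-- The Laplacian `Δu`, the trace of the Hessian. -/
def laplacian {n : ℕ} (G : CoordMetric n) (u : EuclideanSpace ℝ (Fin n) → ℝ)
    (x : EuclideanSpace ℝ (Fin n)) : ℝ :=
  metricTrace G x (hessian G u x)

/-- The dual one-form `V^♭ = g(V, ·)`. -/
def flat {n : ℕ} (G : CoordMetric n) (V : CoordField n) (x v : EuclideanSpace ℝ (Fin n)) : ℝ :=
  G x (V x) v

/-- The exterior derivative of a one-form: `dα(v, w) = ∂_v (α(w)) - ∂_w (α(v))` for constant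
`v`, `w`. -/
def extDerivOne {n : ℕ} (α : EuclideanSpace ℝ (Fin n) → EuclideanSpace ℝ (Fin n) → ℝ) :
    CoordMetric n :=
  fun x v w => fderiv ℝ (fun y => α y w) x v - fderiv ℝ (fun y => α y v) x w

/-- The covariant derivative `(∇_a S)(b, c)` of a covariant two-tensor. -/
def covDerivTwo {n : ℕ} (G S : CoordMetric n) (x a b c : EuclideanSpace ℝ (Fin n)) : ℝ :=
  fderiv ℝ (fun y => S y b c) x a - S x (christoffel G x a b) c - S x b (christoffel G x a c)

/-- The codifferential of a two-form: `d^*S(v) = - ∑ (∇_{e_i} S)(e_i, v)`. -/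
def codiffTwo {n : ℕ} (G S : CoordMetric n) (x v : EuclideanSpace ℝ (Fin n)) : ℝ :=
  - metricTrace G x fun a b => covDerivTwo G S x a b v

/-! In the following definitions `U` is a vector field of unit length which spans the vertical
distribution. -/

/-- Orthogonal projection of a vector onto the vertical line `ℝ U`. -/
def verProj {n : ℕ} (G : CoordMetric n) (U : CoordField n) (x v : EuclideanSpace ℝ (Fin n)) :
    EuclideanSpace ℝ (Fin n) :=
  G x v (U x) • U x

/-- Orthogonal projection of a vector onto the horizontal space `U^⊥`. -/
def horProj {n : ℕ} (G : CoordMetric n) (U : CoordField n) (x v : EuclideanSpace ℝ (Fin n)) :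
    EuclideanSpace ℝ (Fin n) :=
  v - verProj G U x v

/-- The mean curvature vector field of the one-dimensional fibres, the horizontal part of
`∇_U U`. -/
def meanCurv {n : ℕ} (G : CoordMetric n) (U : CoordField n) : CoordField n :=
  fun x => horProj G U x (covDeriv G U U x)

/-- The integrability tensor of the horizontal distribution: the vertical part of `[X, Y]`, where
`X`, `Y` are the horizontal fields obtained by projecting the constant fields `v`, `w`. -/
def integrability {n : ℕ} (G : CoordMetric n) (U : CoordField n)
    (x v w : EuclideanSpace ℝ (Fin n)) : EuclideanSpace ℝ (Fin n) :=
  verProj G U x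
    (VectorField.lieBracket ℝ (fun y => horProj G U y v) (fun y => horProj G U y w) x)

/-- The squared norm `∑_{a,b} |I(e_a, e_b)|²` of the integrability tensor. -/
def integrabilityNormSq {n : ℕ} (G : CoordMetric n) (U : CoordField n)
    (x : EuclideanSpace ℝ (Fin n)) : ℝ :=
  metricTrace G x fun a b => metricTrace G x fun c d =>
    G x (integrability G U x a c) (integrability G U x b d)

/-- The symmetric tensor
```
{λ² K + Δ ln λ + μ(ln λ) - f U(ln λ)} (g - θ²) - |I|² g / 4 + ℒ_X g / 2 + A g
  - (μ^♭ + d^V ln λ)² - (d^V ln λ)² + {df + f μ^♭ + 2 d(U(ln λ)) + d^*Ω} ⊙ θ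
```
at the point `x`, evaluated on the vectors `v`, `w`, where `θ = U^♭`, `Ω = dθ`,
`d^V ln λ = U(ln λ) θ` and `α ⊙ θ = (α ⊗ θ + θ ⊗ α) / 2`; the number `K` stands for the Gauss
curvature of the codomain at the image point. -/
def solitonTensor {n : ℕ} (G : CoordMetric n) (K : ℝ) (lam : EuclideanSpace ℝ (Fin n) → ℝ)
    (U : CoordField n) (f : EuclideanSpace ℝ (Fin n) → ℝ) (X : CoordField n) (A : ℝ) :
    CoordMetric n :=
  fun x v w =>
    let θ := flat G U
    let Ω := extDerivOne θ
    let μ := meanCurv G U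
    let L : EuclideanSpace ℝ (Fin n) → ℝ := fun y => Real.log (lam y)
    let UL : EuclideanSpace ℝ (Fin n) → ℝ := fun y => fderiv ℝ L y (U y)
    let α : EuclideanSpace ℝ (Fin n) → ℝ := fun z =>
      fderiv ℝ f x z + f x * flat G μ x z + 2 * fderiv ℝ UL x z + codiffTwo G Ω x z
    (lam x ^ 2 * K + laplacian G L x + fderiv ℝ L x (μ x) - f x * UL x)
        * (G x v w - θ x v * θ x w)
      - (1 / 4) * integrabilityNormSq G U x * G x v w
      + (1 / 2) * lieMetric X G x v w
      + A * G x v w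
      - (flat G μ x v + UL x * θ x v) * (flat G μ x w + UL x * θ x w)
      - (UL x * θ x v) * (UL x * θ x w)
      + (1 / 2) * (α v * θ x w + θ x v * α w)

end CoordGeom

/-! ### Smooth manifolds -/

section Manifold

open CoordGeom

/-- A smooth Riemannian metric on an `n`-manifold `M`. -/
abbrev SmoothMetric (n : ℕ) (M : Type*) [TopologicalSpace M]
    [ChartedSpace (EuclideanSpace ℝ (Fin n)) M] [IsManifold (𝓡 n) ∞ M] :=
  Bundle.ContMDiffRiemannianMetric (𝓡 n) ∞ (EuclideanSpace ℝ (Fin n))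
    (fun p : M => TangentSpace (𝓡 n) p)

/-- A smooth map which is submersive and semi-conformal with dilation `lam`: at each point its
differential is onto and scales the scalar product of vectors orthogonal to its kernel by
`lam ^ 2`. -/
structure IsSemiConformalSubmersion {M N : Type*}
    [TopologicalSpace M] [ChartedSpace (EuclideanSpace ℝ (Fin 3)) M] [IsManifold (𝓡 3) ∞ M]
    [TopologicalSpace N] [ChartedSpace (EuclideanSpace ℝ (Fin 2)) N] [IsManifold (𝓡 2) ∞ N]
    (g : SmoothMetric 3 M) (h : SmoothMetric 2 N) (φ : M → N) (lam : M → ℝ) : Prop where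
  contMDiff : ContMDiff (𝓡 3) (𝓡 2) ∞ φ
  submersive : ∀ p : M, Function.Surjective (mfderiv (𝓡 3) (𝓡 2) φ p)
  dilation_pos : ∀ p : M, 0 < lam p
  conformal : ∀ (p : M) (v w : TangentSpace (𝓡 3) p),
    (∀ u : TangentSpace (𝓡 3) p, mfderiv (𝓡 3) (𝓡 2) φ p u = 0 → g.inner p v u = 0) →
    (∀ u : TangentSpace (𝓡 3) p, mfderiv (𝓡 3) (𝓡 2) φ p u = 0 → g.inner p w u = 0) →
    h.inner (φ p) (mfderiv (𝓡 3) (𝓡 2) φ p v) (mfderiv (𝓡 3) (𝓡 2) φ p w)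
      = lam p ^ 2 * g.inner p v w

variable {n : ℕ} {M N : Type*} [TopologicalSpace M]
  [ChartedSpace (EuclideanSpace ℝ (Fin n)) M]

/-- The vector field `V` is smooth on the set `s`. -/
def SmoothFieldOn (V : (p : M) → TangentSpace (𝓡 n) p) (s : Set M)
    [IsManifold (𝓡 n) ∞ M] : Prop :=
  ContMDiffOn (𝓡 n) (𝓡 n).tangent ∞ (fun p => (⟨p, V p⟩ : TangentBundle (𝓡 n) M)) s

/-- The coordinates of the point `p` in the preferred chart at `p`. -/
def chartPt (p : M) : EuclideanSpace ℝ (Fin n) := extChartAt (𝓡 n) p p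

/-- The inverse of the preferred chart at `p`, a local parametrisation of `M` around `p`. -/
def chartInv (p : M) : EuclideanSpace ℝ (Fin n) → M := (extChartAt (𝓡 n) p).symm

/-- The coordinate expression of a metric in the preferred chart at `p`. -/
def metricInChart [IsManifold (𝓡 n) ∞ M] (g : SmoothMetric n M) (p : M) : CoordMetric n :=
  fun x v w => g.inner (chartInv p x)
    (mfderiv 𝓘(ℝ, EuclideanSpace ℝ (Fin n)) (𝓡 n) (chartInv p) x v)
    (mfderiv 𝓘(ℝ, EuclideanSpace ℝ (Fin n)) (𝓡 n) (chartInv p) x w)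

/-- The coordinate expression of a vector field in the preferred chart at `p`. -/
def fieldInChart (V : (q : M) → TangentSpace (𝓡 n) q) (p : M) : CoordField n :=
  VectorField.mpullback 𝓘(ℝ, EuclideanSpace ℝ (Fin n)) (𝓡 n) (chartInv p) V

/-- The Gauss curvature of a Riemannian surface. -/
def surfaceCurvature {N : Type*} [TopologicalSpace N]
    [ChartedSpace (EuclideanSpace ℝ (Fin 2)) N] [IsManifold (𝓡 2) ∞ N]
    (h : SmoothMetric 2 N) (q : N) : ℝ :=
  gaussCurvature (metricInChart h q) (chartPt q)

/-- `(M, g)` is a Ricci soliton: `-2 Ricci(g) = ℒ_E g + 2 A g` for a smooth vector field `E` and a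
constant `A`. -/
def IsRicciSoliton [IsManifold (𝓡 n) ∞ M] (g : SmoothMetric n M) : Prop :=
  ∃ (E : (p : M) → TangentSpace (𝓡 n) p) (A : ℝ), SmoothFieldOn E Set.univ ∧
    ∀ (p : M) (v w : EuclideanSpace ℝ (Fin n)),
      -2 * ricci (metricInChart g p) (chartPt p) v w
        = lieMetric (fieldInChart E p) (metricInChart g p) (chartPt p) v w
          + 2 * A * metricInChart g p (chartPt p) v w

end Manifold

section SemiConformal

open CoordGeom

variable {M N : Type*}
  [TopologicalSpace M] [ChartedSpace (EuclideanSpace ℝ (Fin 3)) M]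
  [TopologicalSpace N] [ChartedSpace (EuclideanSpace ℝ (Fin 2)) N]

/-- The vector field `V` on `M` is tangent to the fibres of `φ` at the points of `s`. -/
def IsVerticalOn (φ : M → N) (V : (p : M) → TangentSpace (𝓡 3) p) (s : Set M) : Prop :=
  ∀ p ∈ s, mfderiv (𝓡 3) (𝓡 2) φ p (V p) = 0

variable [IsManifold (𝓡 3) ∞ M]

/-- The vector field `X` on `M` is orthogonal to the fibres of `φ`. -/
def IsHorizontal (g : SmoothMetric 3 M) (φ : M → N) (X : (p : M) → TangentSpace (𝓡 3) p) : Prop :=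
  ∀ (p : M) (u : TangentSpace (𝓡 3) p), mfderiv (𝓡 3) (𝓡 2) φ p u = 0 → g.inner p (X p) u = 0

/-- `U` is, on the set `s`, a smooth unit vector field tangent to the fibres of `φ`. -/
structure IsUnitVerticalOn (g : SmoothMetric 3 M) (φ : M → N)
    (U : (p : M) → TangentSpace (𝓡 3) p) (s : Set M) : Prop where
  smooth : SmoothFieldOn U s
  vertical : IsVerticalOn φ U s
  unit : ∀ p ∈ s, g.inner p (U p) (U p) = 1

/-- The soliton equation `0 = …` for the data `(U, f, X, A)` at the point `p` of `M`. -/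
def SolitonEqAt [IsManifold (𝓡 2) ∞ N] (g : SmoothMetric 3 M) (h : SmoothMetric 2 N) (φ : M → N)
    (lam : M → ℝ) (U : (p : M) → TangentSpace (𝓡 3) p) (f : M → ℝ)
    (X : (p : M) → TangentSpace (𝓡 3) p) (A : ℝ) (p : M) : Prop :=
  ∀ v w : EuclideanSpace ℝ (Fin 3),
    solitonTensor (metricInChart g p) (surfaceCurvature h (φ p)) (fun x => lam (chartInv p x))
      (fieldInChart U p) (fun x => f (chartInv p x)) (fieldInChart X p) A (chartPt p) v w = 0

end SemiConformal

end

/-! The right-hand side of (*) is the Ricci soliton tensor in disguise. For a unit vertical field U,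
a function f and a field X, it equals Ric + ½ ℒ_E g + A g with E = X + fU − μ. This is
`IsSemiConformalOn.solitonTensor_eq`. Since every vector field E splits uniquely as E = X + V − μ
with V vertical and X = E − V + μ horizontal, solving (*) for (V, X, A) and solving the soliton
equation for (E, A) are the same problem.

The identity is local and tensorial, so it is checked on a frame. Take e₂ = U and let e₀, e₁ be λ
times the horizontal lifts of an orthonormal frame of the surface; semi-conformality makes this
frame orthonormal. Lifts are related to fields on the surface and U is related to 0, which
determines the brackets up to six functions: [e₀, e₁] = a e₀ + b e₁ + i U and [e_j, U] = −σ e_j +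
m_j U, with σ = U(ln λ) and μ = m₀ e₀ + m₁ e₁ (`exists_adaptedFrame`). The Koszul formula then gives
the connection, and with it every term of (*). Expressing λ²K^N through a, b and ln λ cancels the
horizontal derivatives of ln λ in λ²K^N + Δ ln λ + μ(ln λ), and the Jacobi identity relates the
U-derivatives of a, b, i to horizontal derivatives of σ, m₀, m₁. The nine components then agree
(`solitonTensor_frame`).

To globalise, μ and the vertical part of E must exist on all of M although U may exist only locally.
Two unit vertical fields differ by a locally constant sign, and both μ and the projection g(E, U)U
are unchanged under U ↦ −U. Invariance of μ under change of charts follows from the formula μ^♭ =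
ι_U dθ, because exterior derivatives commute with pullback. -/

noncomputable section

set_option maxSynthPendingDepth 3

/-! ### The Levi-Civita connection of a metric on a coordinate domain. -/

namespace CoordGeom

/-- The coordinate space `ℝⁿ` with its Euclidean norm. -/
abbrev Euc (n : ℕ) : Type := EuclideanSpace ℝ (Fin n)

/-- Fields of continuous bilinear forms on a coordinate domain. -/
abbrev BilinField (n : ℕ) : Type := Euc n → Euc n →L[ℝ] Euc n →L[ℝ] ℝ

/-- The coordinate metric underlying a field of continuous bilinear forms. -/
def bilin {n : ℕ} (B : BilinField n) : CoordMetric n := fun x v w => B x v w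

/-- `B` is a smooth Riemannian metric on the open set `s`. -/
structure IsMetricOn {n : ℕ} (B : BilinField n) (s : Set (Euc n)) : Prop where
  isOpen : IsOpen s
  smooth : ContDiffOn ℝ ∞ B s
  symm : ∀ x ∈ s, ∀ v w, B x v w = B x w v
  pos : ∀ x ∈ s, ∀ v, v ≠ 0 → 0 < B x v v

variable {n : ℕ} {B : BilinField n} {s : Set (Euc n)} {x : Euc n}

theorem IsMetricOn.mono {t : Set (Euc n)} (hB : IsMetricOn B s) (ht : IsOpen t) (hts : t ⊆ s) :
    IsMetricOn B t :=
  ⟨ht, hB.smooth.mono hts, fun x hx => hB.symm x (hts hx), fun x hx => hB.pos x (hts hx)⟩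

theorem sum_basisVec (v : Euc n) : ∑ i, v i • basisVec i = v := by
  ext j
  simp [basisVec, Pi.single_apply]

theorem bilin_apply_eq_sum (L : Euc n →L[ℝ] Euc n →L[ℝ] ℝ) (v w : Euc n) :
    L v w = ∑ i, ∑ j, v i * w j * L (basisVec i) (basisVec j) := by
  conv_lhs => rw [← sum_basisVec v, ← sum_basisVec w]
  simp only [map_sum, map_smul, _root_.sum_apply, _root_.smul_apply,
    smul_eq_mul, Finset.mul_sum]
  rw [Finset.sum_comm]
  refine Finset.sum_congr rfl fun i _ => Finset.sum_congr rfl fun j _ => by ring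

/-- Positivity at v − w makes the pairing nondegenerate. Later identities between vectors are often
proved by pairing with an arbitrary z. -/
theorem IsMetricOn.eq_of_forall (hB : IsMetricOn B s) (hx : x ∈ s) {v w : Euc n}
    (h : ∀ z, B x v z = B x w z) : v = w := by
  by_contra hne
  have := hB.pos x hx (v - w) (sub_ne_zero.2 hne)
  simp only [map_sub, _root_.sub_apply, h, sub_self, lt_self_iff_false] at this

/-- A nonzero vector in the kernel of the Gram matrix would have length zero. -/
theorem IsMetricOn.det_gram_ne_zero (hB : IsMetricOn B s) (hx : x ∈ s) :
    (gram (bilin B) x).det ≠ 0 := by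
  intro h0
  obtain ⟨v, hv, hv0⟩ := Matrix.exists_mulVec_eq_zero_iff.2 h0
  set w : Euc n := WithLp.toLp 2 v with hw
  have hw0 : w ≠ 0 := by
    intro h
    apply hv
    ext i
    have := congrArg (fun u : Euc n => u i) h
    simpa [hw] using this
  have := hB.pos x hx w hw0
  rw [bilin_apply_eq_sum] at this
  have h2 : ∑ i, ∑ j, w i * w j * B x (basisVec i) (basisVec j)
      = ∑ i, v i * (gram (bilin B) x).mulVec v i := by
    simp only [Matrix.mulVec, dotProduct, Finset.mul_sum, gram, Matrix.of_apply, bilin, hw]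
    refine Finset.sum_congr rfl fun i _ => Finset.sum_congr rfl fun j _ => by ring
  rw [h2, hv0] at this
  simp at this

theorem IsMetricOn.gram_mul_inv (hB : IsMetricOn B s) (hx : x ∈ s) :
    gram (bilin B) x * (gram (bilin B) x)⁻¹ = 1 :=
  Matrix.mul_nonsing_inv _ (isUnit_iff_ne_zero.2 (hB.det_gram_ne_zero hx))

theorem IsMetricOn.differentiableAt (hB : IsMetricOn B s) (hx : x ∈ s) :
    DifferentiableAt ℝ B x :=
  ((hB.smooth.contDiffAt (hB.isOpen.mem_nhds hx)).differentiableAt (by simp))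

theorem fderiv_bilin_const (hB : DifferentiableAt ℝ B x) (v w z : Euc n) :
    fderiv ℝ (fun y => B y w z) x v = fderiv ℝ B x v w z := by
  have h1 : HasFDerivAt (fun y => B y w z) _ x :=
    (hB.hasFDerivAt.clm_apply (hasFDerivAt_const w x)).clm_apply (hasFDerivAt_const z x)
  rw [h1.fderiv]
  simp

theorem IsMetricOn.christoffelFirst_eq (hB : IsMetricOn B s) (hx : x ∈ s) (v w z : Euc n) :
    christoffelFirst (bilin B) x v w z
      = (1 / 2) * (fderiv ℝ B x v w z + fderiv ℝ B x w v z - fderiv ℝ B x z v w) := by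
  simp only [christoffelFirst, bilin, fderiv_bilin_const (hB.differentiableAt hx)]

/-- The field of trilinear forms `(v, w, z) ↦ (∂_v B(w, z) + ∂_w B(v, z) - ∂_z B(v, w)) / 2`. -/
def christoffelForm (B : BilinField n) (x : Euc n) :
    Euc n →L[ℝ] Euc n →L[ℝ] Euc n →L[ℝ] ℝ :=
  (1 / 2 : ℝ) • (fderiv ℝ B x + (fderiv ℝ B x).flip -
    ((ContinuousLinearMap.flipₗᵢ ℝ (Euc n) (Euc n) ℝ).toContinuousLinearEquiv :
      (Euc n →L[ℝ] Euc n →L[ℝ] ℝ) →L[ℝ] (Euc n →L[ℝ] Euc n →L[ℝ] ℝ)).comp (fderiv ℝ B x).flip)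

theorem christoffelForm_apply (v w z : Euc n) : christoffelForm B x v w z
    = (1 / 2) * (fderiv ℝ B x v w z + fderiv ℝ B x w v z - fderiv ℝ B x z v w) := by
  simp [christoffelForm]

/-- The Christoffel symbols as a field of continuous bilinear maps. -/
def christoffelMap (B : BilinField n) (x : Euc n) : Euc n →L[ℝ] Euc n →L[ℝ] Euc n :=
  (ContinuousLinearMap.compL ℝ (Euc n) (Euc n →L[ℝ] ℝ) (Euc n) (B x).inverse).comp
    (christoffelForm B x)

theorem christoffelMap_apply (v w : Euc n) :
    christoffelMap B x v w = (B x).inverse (christoffelForm B x v w) := by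
  simp [christoffelMap]

/-- Injective by nondegeneracy, between spaces of equal dimension. Indices can thus be raised with
`ContinuousLinearMap.inverse`, whose smoothness at invertible maps yields that of the Christoffel
symbols. -/
theorem IsMetricOn.isInvertible (hB : IsMetricOn B s) (hx : x ∈ s) : (B x).IsInvertible := by
  have hinj : Function.Injective (B x) := fun v w h => hB.eq_of_forall hx fun z => by rw [h]
  have hfr : Module.finrank ℝ (Euc n) = Module.finrank ℝ (Euc n →L[ℝ] ℝ) := by
    have h1 : Module.finrank ℝ (Euc n →L[ℝ] ℝ) = Module.finrank ℝ (Module.Dual ℝ (Euc n)) :=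
      (LinearMap.toContinuousLinearMap (𝕜 := ℝ) (E := Euc n) (F' := ℝ)).symm.finrank_eq
    rw [h1, Subspace.dual_finrank_eq]
  let e := LinearEquiv.ofInjectiveOfFinrankEq (B x : Euc n →ₗ[ℝ] Euc n →L[ℝ] ℝ) hinj hfr
  refine ⟨e.toContinuousLinearEquiv, ?_⟩
  ext v w
  rfl

theorem IsMetricOn.apply_christoffelMap (hB : IsMetricOn B s) (hx : x ∈ s) (v w z : Euc n) :
    B x (christoffelMap B x v w) z = christoffelForm B x v w z := by
  obtain ⟨e, he⟩ := hB.isInvertible hx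
  rw [christoffelMap_apply, ← he, ContinuousLinearMap.inverse_equiv]
  simp

/-- Paired with a basis vector, the sum over the inverse Gram matrix collapses by G G⁻¹ = 1 to the
symbol of the first kind, which characterises `christoffelMap`. -/
theorem IsMetricOn.christoffel_eq (hB : IsMetricOn B s) (hx : x ∈ s) (v w : Euc n) :
    christoffel (bilin B) x v w = christoffelMap B x v w := by
  refine hB.eq_of_forall hx fun z => ?_
  rw [hB.apply_christoffelMap hx]
  conv_lhs => rw [← sum_basisVec z]
  conv_rhs => rw [← sum_basisVec z]
  simp only [map_sum, map_smul]
  refine Finset.sum_congr rfl fun m _ => ?_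
  congr 1
  rw [hB.symm x hx]
  simp only [christoffel, map_sum, map_smul, smul_eq_mul, Finset.sum_mul]
  rw [Finset.sum_comm]
  have : ∀ l, ∑ k, (gram (bilin B) x)⁻¹ k l * christoffelFirst (bilin B) x v w (basisVec l)
      * B x (basisVec m) (basisVec k)
      = (1 : Matrix (Fin n) (Fin n) ℝ) m l * christoffelFirst (bilin B) x v w (basisVec l) := by
    intro l
    rw [← hB.gram_mul_inv hx, Matrix.mul_apply, Finset.sum_mul]
    refine Finset.sum_congr rfl fun k _ => ?_
    simp only [gram, Matrix.of_apply, bilin]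
    ring
  simp only [this, Matrix.one_apply, ite_mul, one_mul, zero_mul, Finset.sum_ite_eq,
    Finset.mem_univ, if_true]
  rw [hB.christoffelFirst_eq hx, christoffelForm_apply]

theorem IsMetricOn.smooth_fderiv (hB : IsMetricOn B s) : ContDiffOn ℝ ∞ (fderiv ℝ B) s :=
  hB.smooth.fderiv_of_isOpen hB.isOpen (by simp)

theorem IsMetricOn.smooth_christoffelMap (hB : IsMetricOn B s) :
    ContDiffOn ℝ ∞ (christoffelMap B) s := by
  have hflip : ContDiffOn ℝ ∞ (fun x => (fderiv ℝ B x).flip) s :=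
    (ContinuousLinearMap.flipₗᵢ ℝ (Euc n) (Euc n) (Euc n →L[ℝ] ℝ)).contDiff.comp_contDiffOn
      hB.smooth_fderiv
  have hform : ContDiffOn ℝ ∞ (christoffelForm B) s :=
    ((hB.smooth_fderiv.add hflip).sub (contDiffOn_const.clm_comp hflip)).const_smul (1 / 2 : ℝ)
  have hinv : ContDiffOn ℝ ∞ (fun x => (B x).inverse) s := by
    intro x hx
    obtain ⟨e, he⟩ := hB.isInvertible hx
    have h1 : ContDiffAt ℝ ∞ ContinuousLinearMap.inverse (B x) := by
      rw [← he]; exact contDiffAt_map_inverse e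
    exact h1.comp_contDiffWithinAt x (hB.smooth x hx)
  exact ((ContinuousLinearMap.compL ℝ (Euc n) (Euc n →L[ℝ] ℝ) (Euc n)).contDiff.comp_contDiffOn
    hinv).clm_comp hform

theorem IsMetricOn.fderiv_symm (hB : IsMetricOn B s) (hx : x ∈ s) (z v w : Euc n) :
    fderiv ℝ B x z v w = fderiv ℝ B x z w v := by
  rw [← fderiv_bilin_const (hB.differentiableAt hx), ← fderiv_bilin_const (hB.differentiableAt hx)]
  have : (fun y => B y v w) =ᶠ[nhds x] fun y => B y w v := by
    filter_upwards [hB.isOpen.mem_nhds hx] with y hy using hB.symm y hy v w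
  rw [this.fderiv_eq]

theorem IsMetricOn.christoffelMap_symm (hB : IsMetricOn B s) (hx : x ∈ s) (v w : Euc n) :
    christoffelMap B x v w = christoffelMap B x w v := by
  refine hB.eq_of_forall hx fun z => ?_
  rw [hB.apply_christoffelMap hx, hB.apply_christoffelMap hx, christoffelForm_apply,
    christoffelForm_apply]
  rw [hB.fderiv_symm hx z v w]; ring

/-- Metric compatibility at the level of symbols: in the sum of the two symbols of the first kind
all derivatives cancel except twice ½ ∂_z B(v, w). -/
theorem IsMetricOn.fderiv_eq_christoffelMap (hB : IsMetricOn B s) (hx : x ∈ s) (z v w : Euc n) :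
    fderiv ℝ B x z v w = B x (christoffelMap B x z v) w + B x v (christoffelMap B x z w) := by
  rw [hB.symm x hx v, hB.apply_christoffelMap hx, hB.apply_christoffelMap hx,
    christoffelForm_apply, christoffelForm_apply, hB.fderiv_symm hx z w v,
    hB.fderiv_symm hx v z w, hB.fderiv_symm hx w z v]
  ring

theorem IsMetricOn.covDeriv_eq (hB : IsMetricOn B s) (hx : x ∈ s) (V W : CoordField n) :
    covDeriv (bilin B) V W x = fderiv ℝ W x (V x) + christoffelMap B x (V x) (W x) := by
  rw [covDeriv, hB.christoffel_eq hx]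

/-- Metric compatibility of the Levi-Civita connection. -/
theorem IsMetricOn.fderiv_apply (hB : IsMetricOn B s) (hx : x ∈ s) {V W : CoordField n}
    (hV : DifferentiableAt ℝ V x) (hW : DifferentiableAt ℝ W x) (Z : CoordField n) :
    fderiv ℝ (fun y => B y (V y) (W y)) x (Z x)
      = B x (covDeriv (bilin B) Z V x) (W x) + B x (V x) (covDeriv (bilin B) Z W x) := by
  have h1 := ((hB.differentiableAt hx).hasFDerivAt.clm_apply hV.hasFDerivAt).clm_apply
    hW.hasFDerivAt
  rw [h1.fderiv, hB.covDeriv_eq hx, hB.covDeriv_eq hx]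
  simp only [_root_.add_apply, ContinuousLinearMap.comp_apply,
    ContinuousLinearMap.flip_apply, hB.fderiv_eq_christoffelMap hx, map_add]
  ring

/-- The Levi-Civita connection is torsion-free. -/
theorem IsMetricOn.lieBracket_eq (hB : IsMetricOn B s) (hx : x ∈ s) (V W : CoordField n) :
    VectorField.lieBracket ℝ V W x = covDeriv (bilin B) V W x - covDeriv (bilin B) W V x := by
  rw [hB.covDeriv_eq hx, hB.covDeriv_eq hx, hB.christoffelMap_symm hx (W x)]
  simp [VectorField.lieBracket]

theorem IsMetricOn.smooth_covDeriv (hB : IsMetricOn B s) {V W : CoordField n}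
    (hV : ContDiffOn ℝ ∞ V s) (hW : ContDiffOn ℝ ∞ W s) :
    ContDiffOn ℝ ∞ (covDeriv (bilin B) V W) s := by
  have h : ContDiffOn ℝ ∞ (fun x => fderiv ℝ W x (V x) + christoffelMap B x (V x) (W x)) s :=
    ((hW.fderiv_of_isOpen hB.isOpen (by simp)).clm_apply hV).add
      ((hB.smooth_christoffelMap.clm_apply hV).clm_apply hW)
  exact h.congr fun x hx => hB.covDeriv_eq hx V W

end CoordGeom

/-! ### Curvature, and calculus in orthonormal frames. -/

namespace CoordGeom

variable {n : ℕ} {B : BilinField n} {s : Set (Euc n)} {x : Euc n}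

theorem differentiableAt_of_smoothOn {E F : Type*} [NormedAddCommGroup E] [NormedSpace ℝ E]
    [NormedAddCommGroup F] [NormedSpace ℝ F] {f : E → F} {s : Set E} {x : E}
    (hs : IsOpen s) (hf : ContDiffOn ℝ ∞ f s) (hx : x ∈ s) : DifferentiableAt ℝ f x :=
  (hf.contDiffAt (hs.mem_nhds hx)).differentiableAt (by simp)

/-- The curvature operator in terms of the Christoffel symbols. -/
def curvatureMap (B : BilinField n) (x u v w : Euc n) : Euc n :=
  fderiv ℝ (christoffelMap B) x u v w - fderiv ℝ (christoffelMap B) x v u w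
    + christoffelMap B x u (christoffelMap B x v w)
    - christoffelMap B x v (christoffelMap B x u w)

theorem IsMetricOn.fderiv_covDeriv (hB : IsMetricOn B s) (hx : x ∈ s) {V W : CoordField n}
    (hV : ContDiffOn ℝ ∞ V s) (hW : ContDiffOn ℝ ∞ W s) (z : Euc n) :
    fderiv ℝ (covDeriv (bilin B) V W) x z
      = fderiv ℝ (fderiv ℝ W) x z (V x) + fderiv ℝ W x (fderiv ℝ V x z)
        + fderiv ℝ (christoffelMap B) x z (V x) (W x)
        + christoffelMap B x (fderiv ℝ V x z) (W x)
        + christoffelMap B x (V x) (fderiv ℝ W x z) := by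
  have heq : covDeriv (bilin B) V W =ᶠ[nhds x]
      fun y => fderiv ℝ W y (V y) + christoffelMap B y (V y) (W y) := by
    filter_upwards [hB.isOpen.mem_nhds hx] with y hy using hB.covDeriv_eq hy V W
  have dV := (differentiableAt_of_smoothOn hB.isOpen hV hx).hasFDerivAt
  have dW := (differentiableAt_of_smoothOn hB.isOpen hW hx).hasFDerivAt
  have dDW := (differentiableAt_of_smoothOn hB.isOpen
    (hW.fderiv_of_isOpen hB.isOpen (m := ∞) (by simp)) hx).hasFDerivAt
  have dΓ := (differentiableAt_of_smoothOn hB.isOpen hB.smooth_christoffelMap hx).hasFDerivAt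
  have h1 := (dDW.clm_apply dV).add ((dΓ.clm_apply dV).clm_apply dW)
  rw [heq.fderiv_eq]
  erw [h1.fderiv]
  simp only [_root_.add_apply, ContinuousLinearMap.comp_apply,
    ContinuousLinearMap.flip_apply]
  abel

/-- This form shows the curvature to be multilinear in u, v, w, which justifies evaluating it on
frames and in traces. -/
theorem IsMetricOn.riemann_eq (hB : IsMetricOn B s) (hx : x ∈ s) (u v w : Euc n) :
    riemann (bilin B) x u v w = curvatureMap B x u v w := by
  rw [riemann, hB.covDeriv_eq hx (fun _ => u) (covDeriv _ _ _),
    hB.covDeriv_eq hx (fun _ => v) (covDeriv _ _ _),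
    hB.fderiv_covDeriv hx contDiffOn_const contDiffOn_const,
    hB.fderiv_covDeriv hx contDiffOn_const contDiffOn_const, hB.covDeriv_eq hx, hB.covDeriv_eq hx,
    curvatureMap]
  simp only [fderiv_fun_const, fderiv_zero, Pi.zero_apply, _root_.zero_apply, map_zero, zero_add, add_zero]
  abel

theorem fderiv_fderiv_comm {F : Type*} [NormedAddCommGroup F] [NormedSpace ℝ F]
    {E : Type*} [NormedAddCommGroup E] [NormedSpace ℝ E] {s : Set E} {x : E} {f : E → F}
    (hs : IsOpen s) (hf : ContDiffOn ℝ ∞ f s) (hx : x ∈ s) (v w : E) :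
    fderiv ℝ (fderiv ℝ f) x v w = fderiv ℝ (fderiv ℝ f) x w v :=
  ((hf.contDiffAt (hs.mem_nhds hx)).isSymmSndFDerivAt (by simpa using ENat.LEInfty.out)) v w

/-- The curvature operator of smooth fields. -/
theorem IsMetricOn.riemann_fields (hB : IsMetricOn B s) (hx : x ∈ s) {X Y Z : CoordField n}
    (hX : ContDiffOn ℝ ∞ X s) (hY : ContDiffOn ℝ ∞ Y s) (hZ : ContDiffOn ℝ ∞ Z s) :
    riemann (bilin B) x (X x) (Y x) (Z x)
      = covDeriv (bilin B) X (covDeriv (bilin B) Y Z) x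
        - covDeriv (bilin B) Y (covDeriv (bilin B) X Z) x
        - covDeriv (bilin B) (VectorField.lieBracket ℝ X Y) Z x := by
  -- The second derivatives of Z cancel by symmetry and the first derivatives of X and Y are
  -- absorbed by the bracket term.
  rw [hB.riemann_eq hx, hB.covDeriv_eq hx, hB.covDeriv_eq hx, hB.covDeriv_eq hx,
    hB.fderiv_covDeriv hx hY hZ, hB.fderiv_covDeriv hx hX hZ, hB.covDeriv_eq hx,
    hB.covDeriv_eq hx, curvatureMap, fderiv_fderiv_comm hB.isOpen hZ hx (X x)]
  simp only [VectorField.lieBracket, map_add, map_sub, _root_.sub_apply]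
  abel

theorem covDeriv_congr {G : CoordMetric n} {V W W' : CoordField n} (h : W =ᶠ[nhds x] W') :
    covDeriv G V W x = covDeriv G V W' x := by
  rw [covDeriv, covDeriv, h.fderiv_eq, h.eq_of_nhds]

theorem IsMetricOn.covDeriv_sum_smul (hB : IsMetricOn B s) (hx : x ∈ s) {ι : Type*} [Fintype ι]
    (V : CoordField n) {c : ι → Euc n → ℝ} {F : ι → CoordField n}
    (hc : ∀ k, DifferentiableAt ℝ (c k) x) (hF : ∀ k, DifferentiableAt ℝ (F k) x) :
    covDeriv (bilin B) V (fun y => ∑ k, c k y • F k y) x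
      = ∑ k, (fderiv ℝ (c k) x (V x) • F k x + c k x • covDeriv (bilin B) V (F k) x) := by
  have h1 : HasFDerivAt (fun y => ∑ k, c k y • F k y) _ x :=
    HasFDerivAt.fun_sum fun k _ => (hc k).hasFDerivAt.smul (hF k).hasFDerivAt
  rw [hB.covDeriv_eq hx, h1.fderiv]
  simp only [_root_.sum_apply, _root_.add_apply, _root_.smul_apply,
    ContinuousLinearMap.smulRight_apply, map_sum, map_smul, ← Finset.sum_add_distrib,
    hB.covDeriv_eq hx, smul_add]
  refine Finset.sum_congr rfl fun k _ => by abel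

theorem IsMetricOn.covDeriv_left_sum (hB : IsMetricOn B s) (hx : x ∈ s) {ι : Type*} [Fintype ι]
    {V : CoordField n} (W : CoordField n) {c : ι → ℝ} {F : ι → CoordField n}
    (hV : V x = ∑ k, c k • F k x) :
    covDeriv (bilin B) V W x = ∑ k, c k • covDeriv (bilin B) (F k) W x := by
  simp only [hB.covDeriv_eq hx, hV, map_sum, map_smul, _root_.sum_apply, _root_.smul_apply,
    ← Finset.sum_add_distrib, smul_add]

/-- Bilinearity of a real-valued function of two vectors. -/
structure IsBilin (Q : Euc n → Euc n → ℝ) : Prop where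
  add_left : ∀ a b c, Q (a + b) c = Q a c + Q b c
  smul_left : ∀ (t : ℝ) a c, Q (t • a) c = t * Q a c
  add_right : ∀ a b c, Q a (b + c) = Q a b + Q a c
  smul_right : ∀ (t : ℝ) a c, Q a (t • c) = t * Q a c

theorem IsBilin.sum_sum {Q : Euc n → Euc n → ℝ} (hQ : IsBilin Q) {ι : Type*} [Fintype ι]
    (a b : ι → ℝ) (F : ι → Euc n) :
    Q (∑ i, a i • F i) (∑ j, b j • F j) = ∑ i, ∑ j, a i * b j * Q (F i) (F j) := by
  let L := LinearMap.mk₂ ℝ Q hQ.add_left hQ.smul_left hQ.add_right hQ.smul_right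
  have : ∀ v w, Q v w = L v w := fun _ _ => rfl
  simp only [this, map_sum, map_smul, LinearMap.sum_apply, LinearMap.smul_apply, smul_eq_mul,
    Finset.mul_sum]
  rw [Finset.sum_comm]
  refine Finset.sum_congr rfl fun i _ => Finset.sum_congr rfl fun j _ => by ring

theorem isBilin_clm (L : Euc n →L[ℝ] Euc n →L[ℝ] ℝ) : IsBilin fun v w => L v w := by
  constructor <;> intros <;> simp

/-- `e` is a smooth orthonormal frame for `B` on `s`. -/
structure IsOrthonormalFrame (B : BilinField n) (s : Set (Euc n)) (e : Fin n → CoordField n) :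
    Prop where
  smooth : ∀ i, ContDiffOn ℝ ∞ (e i) s
  orth : ∀ x ∈ s, ∀ i j, B x (e i x) (e j x) = if i = j then 1 else 0

variable {e : Fin n → CoordField n}

/-- The matrix whose rows are the coordinates of the frame vectors. -/
def frameMatrix (e : Fin n → CoordField n) (x : Euc n) : Matrix (Fin n) (Fin n) ℝ :=
  Matrix.of fun i k => e i x k

theorem IsOrthonormalFrame.mul_gram_mul (he : IsOrthonormalFrame B s e) (hx : x ∈ s) :
    frameMatrix e x * (gram (bilin B) x * (frameMatrix e x).transpose) = 1 := by
  ext i j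
  rw [Matrix.one_apply, ← he.orth x hx, bilin_apply_eq_sum]
  simp only [Matrix.mul_apply, frameMatrix, Matrix.of_apply, gram, bilin, Matrix.transpose_apply,
    Finset.mul_sum]
  refine Finset.sum_congr rfl fun i _ => Finset.sum_congr rfl fun j _ => by ring

/-- Orthonormality reads P G Pᵀ = 1 for the frame matrix P. A one-sided inverse of a square matrix
is two-sided, so G Pᵀ P = 1. -/
theorem IsOrthonormalFrame.gram_inv (he : IsOrthonormalFrame B s e) (hx : x ∈ s) :
    (gram (bilin B) x)⁻¹ = (frameMatrix e x).transpose * frameMatrix e x := by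
  apply Matrix.inv_eq_right_inv
  rw [← Matrix.mul_assoc]
  exact mul_eq_one_comm.1 (he.mul_gram_mul hx)

/-- Since g^{ij} = ∑_k e_k^i e_k^j, the coordinate trace becomes the sum over the frame. -/
theorem IsOrthonormalFrame.metricTrace_eq (he : IsOrthonormalFrame B s e) (hx : x ∈ s)
    {Q : Euc n → Euc n → ℝ} (hQ : IsBilin Q) :
    metricTrace (bilin B) x Q = ∑ i, Q (e i x) (e i x) := by
  have : ∀ k, Q (e k x) (e k x) = ∑ i, ∑ j, e k x i * e k x j * Q (basisVec i) (basisVec j) := by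
    intro k
    rw [← hQ.sum_sum, sum_basisVec]
  simp only [this, metricTrace, he.gram_inv hx]
  conv_rhs => rw [Finset.sum_comm]
  refine Finset.sum_congr rfl fun i _ => ?_
  conv_rhs => rw [Finset.sum_comm]
  refine Finset.sum_congr rfl fun j _ => ?_
  simp only [Matrix.mul_apply, Matrix.transpose_apply, frameMatrix, Matrix.of_apply,
    Finset.sum_mul]

theorem IsOrthonormalFrame.sum_smul (he : IsOrthonormalFrame B s e) (hx : x ∈ s) (v : Euc n) :
    ∑ i, B x v (e i x) • e i x = v := by
  have h1 := mul_eq_one_comm.1 (he.mul_gram_mul hx)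
  have h2 : ∀ i, B x v (e i x) = Matrix.vecMul v (gram (bilin B) x *
      (frameMatrix e x).transpose) i := by
    intro i
    rw [bilin_apply_eq_sum]
    simp only [Matrix.vecMul, dotProduct, Matrix.mul_apply, Finset.mul_sum, gram, bilin,
      Matrix.of_apply, Matrix.transpose_apply, frameMatrix]
    refine Finset.sum_congr rfl fun i _ => Finset.sum_congr rfl fun j _ => by ring
  have h3 := Matrix.vecMul_vecMul v.ofLp (gram (bilin B) x * (frameMatrix e x).transpose)
    (frameMatrix e x)
  rw [h1, Matrix.vecMul_one] at h3
  ext k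
  have h4 := congrFun h3 k
  rw [← h4]
  simp only [WithLp.ofLp_sum, WithLp.ofLp_smul, Finset.sum_apply, Pi.smul_apply, smul_eq_mul, h2]
  rfl

theorem IsOrthonormalFrame.apply_sum (he : IsOrthonormalFrame B s e) (hx : x ∈ s) (c : Fin n → ℝ)
    (m : Fin n) : B x (∑ k, c k • e k x) (e m x) = c m := by
  simp [map_sum, he.orth x hx]

theorem IsOrthonormalFrame.ext (he : IsOrthonormalFrame B s e) (hx : x ∈ s) {v w : Euc n}
    (h : ∀ i, B x v (e i x) = B x w (e i x)) : v = w := by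
  rw [← he.sum_smul hx v, ← he.sum_smul hx w]
  simp only [h]

/-- Reduces an identity of bilinear tensors to its frame components. -/
theorem IsOrthonormalFrame.bilin_ext (he : IsOrthonormalFrame B s e) (hx : x ∈ s)
    {Q R : Euc n → Euc n → ℝ} (hQ : IsBilin Q) (hR : IsBilin R)
    (h : ∀ i j, Q (e i x) (e j x) = R (e i x) (e j x)) (v w : Euc n) : Q v w = R v w := by
  rw [← he.sum_smul hx v, ← he.sum_smul hx w, hQ.sum_sum, hR.sum_sum]
  simp only [h]

/-- The coefficients of the Levi-Civita connection of an orthonormal frame with structure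
functions `c`. -/
def koszul (c : Fin n → Fin n → Fin n → Euc n → ℝ) (i j k : Fin n) (x : Euc n) : ℝ :=
  (1 / 2) * (c i j k x - c j k i x + c k i j x)

theorem IsOrthonormalFrame.differentiableAt (he : IsOrthonormalFrame B s e) (hs : IsOpen s)
    (hx : x ∈ s) (i : Fin n) : DifferentiableAt ℝ (e i) x :=
  differentiableAt_of_smoothOn hs (he.smooth i) hx

/-- The functions B(e_j, e_k) are constant, so metric compatibility gives zero for the sum of the
two sides. -/
theorem IsOrthonormalFrame.connection_antisymm (hB : IsMetricOn B s)
    (he : IsOrthonormalFrame B s e) (hx : x ∈ s) (V : CoordField n) (j k : Fin n) :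
    B x (covDeriv (bilin B) V (e j) x) (e k x)
      = - B x (covDeriv (bilin B) V (e k) x) (e j x) := by
  have h1 := hB.fderiv_apply hx (he.differentiableAt hB.isOpen hx j)
    (he.differentiableAt hB.isOpen hx k) V
  have h2 : (fun y => B y (e j y) (e k y)) =ᶠ[nhds x] fun _ => if j = k then 1 else 0 := by
    filter_upwards [hB.isOpen.mem_nhds hx] with y hy using he.orth y hy j k
  rw [h2.fderiv_eq, hB.symm x hx (e j x)] at h1
  simp at h1
  linarith

theorem IsOrthonormalFrame.covDeriv_eq_koszul (hB : IsMetricOn B s)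
    (he : IsOrthonormalFrame B s e) (hx : x ∈ s) {c : Fin n → Fin n → Fin n → Euc n → ℝ}
    (hc : ∀ i j, VectorField.lieBracket ℝ (e i) (e j) x = ∑ k, c i j k x • e k x) (i j : Fin n) :
    covDeriv (bilin B) (e i) (e j) x = ∑ k, koszul c i j k x • e k x := by
  refine he.ext hx fun k => ?_
  rw [he.apply_sum hx]
  -- Torsion-freeness makes c_{ijk} the difference of two connection coefficients. Substituted into
  -- the Koszul expression, three antisymmetries leave a single coefficient.
  have hc' : ∀ i j k, c i j k x = B x (covDeriv (bilin B) (e i) (e j) x) (e k x)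
      - B x (covDeriv (bilin B) (e j) (e i) x) (e k x) := by
    intro i j k
    rw [← he.apply_sum hx (fun k => c i j k x) k, ← hc, hB.lieBracket_eq hx]
    simp
  simp only [koszul, hc']
  linarith [he.connection_antisymm hB hx (e i) k j, he.connection_antisymm hB hx (e j) k i,
    he.connection_antisymm hB hx (e k) j i]

/-- The components `g(R(e_i, e_j)e_k, e_m)` of the curvature tensor in terms of the coefficients
of the connection. -/
def curvatureCoeff (e : Fin n → CoordField n) (W : Fin n → Fin n → Fin n → Euc n → ℝ) (x : Euc n)
    (i j k m : Fin n) : ℝ :=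
  fderiv ℝ (W j k m) x (e i x) - fderiv ℝ (W i k m) x (e j x)
    + ∑ l, (W j k l x * W i l m x - W i k l x * W j l m x - (W i j l x - W j i l x) * W l k m x)

theorem IsOrthonormalFrame.riemann_eq_curvatureCoeff (hB : IsMetricOn B s)
    (he : IsOrthonormalFrame B s e) (hx : x ∈ s) {W : Fin n → Fin n → Fin n → Euc n → ℝ}
    (hWs : ∀ i j k, ContDiffOn ℝ ∞ (W i j k) s)
    (hW : ∀ y ∈ s, ∀ i j, covDeriv (bilin B) (e i) (e j) y = ∑ k, W i j k y • e k y)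
    (i j k m : Fin n) :
    B x (riemann (bilin B) x (e i x) (e j x) (e k x)) (e m x) = curvatureCoeff e W x i j k m := by
  have hdW : ∀ i j k, DifferentiableAt ℝ (W i j k) x := fun i j k =>
    differentiableAt_of_smoothOn hB.isOpen (hWs i j k) hx
  -- Leibniz rule for ∇_{e_i}(∑ W_{jkl} e_l): the derivative of the coefficient, plus the quadratic
  -- terms from ∇_{e_i} e_l.
  have hcc : ∀ i j k, B x (covDeriv (bilin B) (e i) (covDeriv (bilin B) (e j) (e k)) x) (e m x)
      = fderiv ℝ (W j k m) x (e i x) + ∑ l, W j k l x * W i l m x := by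
    intro i j k
    have h1 : covDeriv (bilin B) (e j) (e k) =ᶠ[nhds x] fun y => ∑ l, W j k l y • e l y := by
      filter_upwards [hB.isOpen.mem_nhds hx] with y hy using hW y hy j k
    rw [covDeriv_congr h1, hB.covDeriv_sum_smul hx _ (fun l => hdW j k l)
      (fun l => he.differentiableAt hB.isOpen hx l), Finset.sum_add_distrib, map_add,
      _root_.add_apply, he.apply_sum hx, map_sum, _root_.sum_apply]
    congr 1
    refine Finset.sum_congr rfl fun l _ => ?_
    rw [map_smul, _root_.smul_apply, hW x hx, he.apply_sum hx, smul_eq_mul]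
  have hbr : VectorField.lieBracket ℝ (e i) (e j) x = ∑ l, (W i j l x - W j i l x) • e l x := by
    rw [hB.lieBracket_eq hx, hW x hx, hW x hx, ← Finset.sum_sub_distrib]
    simp only [sub_smul]
  have h3 : B x (covDeriv (bilin B) (VectorField.lieBracket ℝ (e i) (e j)) (e k) x) (e m x)
      = ∑ l, (W i j l x - W j i l x) * W l k m x := by
    rw [hB.covDeriv_left_sum hx (e k) hbr, map_sum, _root_.sum_apply]
    refine Finset.sum_congr rfl fun l _ => ?_
    rw [map_smul, _root_.smul_apply, hW x hx, he.apply_sum hx, smul_eq_mul]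
  rw [hB.riemann_fields hx (he.smooth i) (he.smooth j) (he.smooth k), map_sub, map_sub,
    _root_.sub_apply, _root_.sub_apply, hcc, hcc, h3, curvatureCoeff]
  simp only [Finset.sum_sub_distrib]
  ring

end CoordGeom

/-! ### Ricci tensor, Lie derivative, Laplacian, exterior derivative and codifferential in a frame.
-/

namespace CoordGeom

variable {n : ℕ} {B : BilinField n} {s : Set (Euc n)} {x : Euc n} {e : Fin n → CoordField n}

theorem IsBilin.add {Q R : Euc n → Euc n → ℝ} (hQ : IsBilin Q) (hR : IsBilin R) :
    IsBilin fun v w => Q v w + R v w := by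
  constructor <;> intros
  · rw [hQ.add_left, hR.add_left]; ring
  · rw [hQ.smul_left, hR.smul_left]; ring
  · rw [hQ.add_right, hR.add_right]; ring
  · rw [hQ.smul_right, hR.smul_right]; ring

theorem IsBilin.const_mul {Q : Euc n → Euc n → ℝ} (hQ : IsBilin Q) (c : ℝ) :
    IsBilin fun v w => c * Q v w := by
  constructor <;> intros
  · rw [hQ.add_left]; ring
  · rw [hQ.smul_left]; ring
  · rw [hQ.add_right]; ring
  · rw [hQ.smul_right]; ring

theorem IsBilin.sum {ι : Type*} [Fintype ι] {Q : ι → Euc n → Euc n → ℝ} (hQ : ∀ i, IsBilin (Q i)) :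
    IsBilin fun v w => ∑ i, Q i v w := by
  constructor <;> intros
  · simp only [(hQ _).add_left, Finset.sum_add_distrib]
  · simp only [(hQ _).smul_left, Finset.mul_sum]
  · simp only [(hQ _).add_right, Finset.sum_add_distrib]
  · simp only [(hQ _).smul_right, Finset.mul_sum]

theorem isBilin_mul {a b : Euc n → ℝ} (ha : IsLinearMap ℝ a) (hb : IsLinearMap ℝ b) :
    IsBilin fun v w => a v * b w := by
  constructor <;> intros
  · rw [ha.map_add]; ring
  · rw [ha.map_smul, smul_eq_mul]; ring
  · rw [hb.map_add]; ring
  · rw [hb.map_smul, smul_eq_mul]; ring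

theorem isLinearMap_clm (L : Euc n →L[ℝ] ℝ) : IsLinearMap ℝ fun v => L v :=
  ⟨map_add L, map_smul L⟩

theorem isBilin_curvatureMap (v w : Euc n) : IsBilin fun a b => B x (curvatureMap B x a v w) b := by
  constructor <;> intros <;>
    simp only [curvatureMap, map_add, map_sub, map_smul, _root_.add_apply, _root_.smul_apply,
      _root_.sub_apply, smul_eq_mul] <;> ring

theorem isBilin_curvatureMap_right (a b : Euc n) :
    IsBilin fun v w => B x (curvatureMap B x a v w) b := by
  constructor <;> intros <;>
    simp only [curvatureMap, map_add, map_sub, map_smul, _root_.add_apply, _root_.smul_apply,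
      _root_.sub_apply, smul_eq_mul] <;> ring

theorem IsOrthonormalFrame.ricci_eq (hB : IsMetricOn B s) (he : IsOrthonormalFrame B s e)
    (hx : x ∈ s) (v w : Euc n) :
    ricci (bilin B) x v w = ∑ i, B x (riemann (bilin B) x (e i x) v w) (e i x) := by
  rw [ricci]
  simp only [hB.riemann_eq hx]
  exact he.metricTrace_eq hx (isBilin_curvatureMap v w)

theorem IsOrthonormalFrame.isBilin_ricci (hB : IsMetricOn B s) (he : IsOrthonormalFrame B s e)
    (hx : x ∈ s) : IsBilin (ricci (bilin B) x) := by
  have : ricci (bilin B) x = fun v w => ∑ i, B x (curvatureMap B x (e i x) v w) (e i x) := by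
    ext v w
    rw [he.ricci_eq hB hx]
    simp only [hB.riemann_eq hx]
  rw [this]
  exact IsBilin.sum fun i => isBilin_curvatureMap_right _ _

theorem lieBracket_sum_smul {ι : Type*} [Fintype ι] (V : CoordField n) {c : ι → Euc n → ℝ}
    {F : ι → CoordField n} (hc : ∀ k, DifferentiableAt ℝ (c k) x)
    (hF : ∀ k, DifferentiableAt ℝ (F k) x) :
    VectorField.lieBracket ℝ V (fun y => ∑ k, c k y • F k y) x
      = ∑ k, (fderiv ℝ (c k) x (V x) • F k x + c k x • VectorField.lieBracket ℝ V (F k) x) := by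
  have h1 : HasFDerivAt (fun y => ∑ k, c k y • F k y) _ x :=
    HasFDerivAt.fun_sum fun k _ => (hc k).hasFDerivAt.smul (hF k).hasFDerivAt
  rw [VectorField.lieBracket, h1.fderiv]
  simp only [_root_.sum_apply, _root_.add_apply, _root_.smul_apply,
    ContinuousLinearMap.smulRight_apply, map_sum, map_smul,
    ← Finset.sum_sub_distrib, VectorField.lieBracket]
  refine Finset.sum_congr rfl fun k _ => by module

/-- The Jacobi identity for the structure functions of an orthonormal frame. -/
theorem IsOrthonormalFrame.jacobi (hs : IsOpen s) (he : IsOrthonormalFrame B s e) (hx : x ∈ s)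
    {c : Fin n → Fin n → Fin n → Euc n → ℝ} (hcs : ∀ i j k, ContDiffOn ℝ ∞ (c i j k) s)
    (hc : ∀ y ∈ s, ∀ i j, VectorField.lieBracket ℝ (e i) (e j) y = ∑ k, c i j k y • e k y)
    (i j k m : Fin n) :
    fderiv ℝ (c j k m) x (e i x) + ∑ l, c j k l x * c i l m x
      + (fderiv ℝ (c k i m) x (e j x) + ∑ l, c k i l x * c j l m x)
      + (fderiv ℝ (c i j m) x (e k x) + ∑ l, c i j l x * c k l m x) = 0 := by
  have hd : ∀ i j k, DifferentiableAt ℝ (c i j k) x := fun i j k =>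
    differentiableAt_of_smoothOn hs (hcs i j k) hx
  have key : ∀ i j k, B x (VectorField.lieBracket ℝ (e i) (VectorField.lieBracket ℝ (e j) (e k)) x)
      (e m x) = fderiv ℝ (c j k m) x (e i x) + ∑ l, c j k l x * c i l m x := by
    intro i j k
    have h1 : VectorField.lieBracket ℝ (e j) (e k) =ᶠ[nhds x] fun y => ∑ l, c j k l y • e l y := by
      filter_upwards [hs.mem_nhds hx] with y hy using hc y hy j k
    rw [Filter.EventuallyEq.lieBracket_vectorField_eq (Filter.EventuallyEq.refl _ _) h1,
      lieBracket_sum_smul _ (fun l => hd j k l) (fun l => he.differentiableAt hs hx l),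
      Finset.sum_add_distrib, map_add, _root_.add_apply, he.apply_sum hx, map_sum,
      _root_.sum_apply]
    congr 1
    refine Finset.sum_congr rfl fun l _ => ?_
    rw [map_smul, _root_.smul_apply, hc x hx, he.apply_sum hx, smul_eq_mul]
  have hat : ∀ i, ContDiffAt ℝ 2 (e i) x := fun i =>
    ((he.smooth i).contDiffAt (hs.mem_nhds hx)).of_le (by simpa using ENat.LEInfty.out)
  -- The Leibniz form [X, [Y, Z]] = [[X, Y], Z] + [Y, [X, Z]] becomes the cyclic sum after swapping
  -- one bracket in each term on the right.
  have hJ := VectorField.leibniz_identity_lieBracket (n := 2) (𝕜 := ℝ) (by simp)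
    (hat i) (hat j) (hat k)
  rw [VectorField.lieBracket_swap (V := VectorField.lieBracket ℝ (e i) (e j))] at hJ
  have h2 : VectorField.lieBracket ℝ (e j) (VectorField.lieBracket ℝ (e i) (e k)) x
      = - VectorField.lieBracket ℝ (e j) (VectorField.lieBracket ℝ (e k) (e i)) x := by
    have h3 : VectorField.lieBracket ℝ (e i) (e k)
        = (-1 : ℝ) • VectorField.lieBracket ℝ (e k) (e i) := by
      ext1 y
      rw [VectorField.lieBracket_swap]
      simp
    rw [h3, VectorField.lieBracket_const_smul_right]
    · simp
    · exact ((ContDiffAt.lieBracket_vectorField (m := 1) (n := 2) (hat k) (hat i) (by norm_num)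
        ).differentiableAt (by simp))
  rw [h2] at hJ
  rw [← key, ← key, ← key, hJ]
  simp only [map_add, map_neg, _root_.add_apply, _root_.neg_apply]
  ring

/-- The derivative of B along E gives Γ(E, v) and Γ(E, w). By symmetry of Γ these complete ∂_v E and
∂_w E to covariant derivatives. -/
theorem IsMetricOn.lieMetric_eq (hB : IsMetricOn B s) (hx : x ∈ s) {E : CoordField n}
    (v w : Euc n) :
    lieMetric E (bilin B) x v w = B x (covDeriv (bilin B) (fun _ => v) E x) w
      + B x v (covDeriv (bilin B) (fun _ => w) E x) := by
  simp only [lieMetric, bilin, fderiv_bilin_const (hB.differentiableAt hx)]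
  rw [hB.covDeriv_eq hx, hB.covDeriv_eq hx,
    hB.fderiv_eq_christoffelMap hx, hB.christoffelMap_symm hx (E x) v,
    hB.christoffelMap_symm hx (E x) w]
  simp only [map_add, _root_.add_apply]
  ring

theorem covDeriv_congr_left {G : CoordMetric n} {V V' W : CoordField n} (h : V x = V' x) :
    covDeriv G V W x = covDeriv G V' W x := by
  rw [covDeriv, covDeriv, h]

theorem IsMetricOn.isBilin_lieMetric (hB : IsMetricOn B s) (hx : x ∈ s) (E : CoordField n) :
    IsBilin (lieMetric E (bilin B) x) := by
  have : lieMetric E (bilin B) x = fun v w => fderiv ℝ B x (E x) v w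
      + B x (fderiv ℝ E x v) w + B x v (fderiv ℝ E x w) := by
    ext v w
    simp only [lieMetric, bilin, fderiv_bilin_const (hB.differentiableAt hx)]
  rw [this]
  constructor <;> intros <;> simp only [map_add, map_smul, _root_.add_apply, _root_.smul_apply,
    smul_eq_mul] <;> ring

theorem lieMetric_add {G : CoordMetric n} (hG : IsBilin (G x)) {E E' : CoordField n}
    (hE : DifferentiableAt ℝ E x)
    (hE' : DifferentiableAt ℝ E' x) (v w : Euc n) :
    lieMetric (fun y => E y + E' y) G x v w = lieMetric E G x v w + lieMetric E' G x v w := by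
  simp only [lieMetric, fderiv_fun_add hE hE', map_add, _root_.add_apply, hG.add_left,
    hG.add_right]
  ring

theorem IsMetricOn.hessian_eq (hB : IsMetricOn B s) (hx : x ∈ s) {u : Euc n → ℝ}
    (hu : ContDiffOn ℝ ∞ u s) (v w : Euc n) :
    hessian (bilin B) u x v w = fderiv ℝ (fderiv ℝ u) x v w
      - fderiv ℝ u x (christoffelMap B x v w) := by
  have h1 := (differentiableAt_of_smoothOn hB.isOpen
    (hu.fderiv_of_isOpen hB.isOpen (m := ∞) (by simp)) hx).hasFDerivAt.clm_apply
    (hasFDerivAt_const w x)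
  rw [hessian, hB.christoffel_eq hx, h1.fderiv]
  simp

theorem fderiv_fderiv_apply {u : Euc n → ℝ} (hs : IsOpen s) (hx : x ∈ s)
    (hu : ContDiffOn ℝ ∞ u s) {V : CoordField n} (hV : DifferentiableAt ℝ V x) (z : Euc n) :
    fderiv ℝ (fun y => fderiv ℝ u y (V y)) x z
      = fderiv ℝ (fderiv ℝ u) x z (V x) + fderiv ℝ u x (fderiv ℝ V x z) := by
  have h1 := (differentiableAt_of_smoothOn hs
    (hu.fderiv_of_isOpen hs (m := ∞) (by simp)) hx).hasFDerivAt.clm_apply hV.hasFDerivAt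
  rw [h1.fderiv]
  simp [add_comm]

/-- The commutator of two directional derivatives is the derivative along the Lie bracket. -/
theorem fderiv_lieBracket_apply {u : Euc n → ℝ} (hs : IsOpen s) (hx : x ∈ s)
    (hu : ContDiffOn ℝ ∞ u s) {V W : CoordField n} (hV : DifferentiableAt ℝ V x)
    (hW : DifferentiableAt ℝ W x) :
    fderiv ℝ u x (VectorField.lieBracket ℝ V W x)
      = fderiv ℝ (fun y => fderiv ℝ u y (W y)) x (V x)
        - fderiv ℝ (fun y => fderiv ℝ u y (V y)) x (W x) := by
  rw [fderiv_fderiv_apply hs hx hu hV, fderiv_fderiv_apply hs hx hu hW,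
    fderiv_fderiv_comm hs hu hx (W x)]
  simp [VectorField.lieBracket]

/-- The trace of the Hessian, with Hess u(e_i, e_i) = e_i(e_i u) − du(∇_{e_i} e_i). -/
theorem IsOrthonormalFrame.laplacian_eq (hB : IsMetricOn B s) (he : IsOrthonormalFrame B s e)
    (hx : x ∈ s) {u : Euc n → ℝ} (hu : ContDiffOn ℝ ∞ u s) :
    laplacian (bilin B) u x = ∑ i, (fderiv ℝ (fun y => fderiv ℝ u y (e i y)) x (e i x)
      - fderiv ℝ u x (covDeriv (bilin B) (e i) (e i) x)) := by
  have hbil : IsBilin (hessian (bilin B) u x) := by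
    have : hessian (bilin B) u x = fun v w => fderiv ℝ (fderiv ℝ u) x v w
      - fderiv ℝ u x (christoffelMap B x v w) := by
      ext v w; exact hB.hessian_eq hx hu v w
    rw [this]
    constructor <;> intros <;> simp only [map_add, map_smul, _root_.add_apply,
      _root_.smul_apply, smul_eq_mul] <;> ring
  rw [laplacian, he.metricTrace_eq hx hbil]
  refine Finset.sum_congr rfl fun i _ => ?_
  rw [hB.hessian_eq hx hu, fderiv_fderiv_apply hB.isOpen hx hu
    (he.differentiableAt hB.isOpen hx i), hB.covDeriv_eq hx, map_add]
  ring

/-- The exterior derivative of the one-form `B(U, ·)`, as a field of continuous bilinear forms. -/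
def extDerivFlat (B : BilinField n) (U : CoordField n) : BilinField n := fun x =>
  fderiv ℝ (fun y => B y (U y)) x - (fderiv ℝ (fun y => B y (U y)) x).flip

theorem extDerivFlat_apply (U : CoordField n) (v w : Euc n) : extDerivFlat B U x v w
    = fderiv ℝ (fun y => B y (U y)) x v w - fderiv ℝ (fun y => B y (U y)) x w v := by
  simp [extDerivFlat]

theorem IsMetricOn.smooth_flat (hB : IsMetricOn B s) {U : CoordField n}
    (hU : ContDiffOn ℝ ∞ U s) : ContDiffOn ℝ ∞ (fun y => B y (U y)) s :=
  hB.smooth.clm_apply hU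

theorem IsMetricOn.smooth_extDerivFlat (hB : IsMetricOn B s) {U : CoordField n}
    (hU : ContDiffOn ℝ ∞ U s) : ContDiffOn ℝ ∞ (extDerivFlat B U) s := by
  have h1 := (hB.smooth_flat hU).fderiv_of_isOpen hB.isOpen (m := ∞) (by simp)
  exact h1.sub ((ContinuousLinearMap.flipₗᵢ ℝ (Euc n) (Euc n) ℝ).contDiff.comp_contDiffOn h1)

theorem IsMetricOn.extDerivOne_flat (hB : IsMetricOn B s) (hx : x ∈ s) {U : CoordField n}
    (hU : ContDiffOn ℝ ∞ U s) (v w : Euc n) :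
    extDerivOne (flat (bilin B) U) x v w = extDerivFlat B U x v w := by
  have h1 : ∀ v, fderiv ℝ (fun y => flat (bilin B) U y v) x
      = (fderiv ℝ (fun y => B y (U y)) x).flip v := by
    intro v
    have := (differentiableAt_of_smoothOn hB.isOpen (hB.smooth_flat hU) hx).hasFDerivAt.clm_apply
      (hasFDerivAt_const v x)
    refine Eq.trans this.fderiv ?_
    ext w
    simp
  rw [extDerivOne, h1, h1, extDerivFlat_apply]
  simp

/-- Cartan's formula `dα(V, W) = V(α(W)) - W(α(V)) - α([V, W])`. -/
theorem IsMetricOn.extDerivFlat_fields (hB : IsMetricOn B s) (hx : x ∈ s) {U V W : CoordField n}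
    (hU : ContDiffOn ℝ ∞ U s) (hV : DifferentiableAt ℝ V x) (hW : DifferentiableAt ℝ W x) :
    extDerivFlat B U x (V x) (W x) = fderiv ℝ (fun y => B y (U y) (W y)) x (V x)
      - fderiv ℝ (fun y => B y (U y) (V y)) x (W x)
      - B x (U x) (VectorField.lieBracket ℝ V W x) := by
  have h0 := (differentiableAt_of_smoothOn hB.isOpen (hB.smooth_flat hU) hx).hasFDerivAt
  rw [(h0.clm_apply hV.hasFDerivAt).fderiv, (h0.clm_apply hW.hasFDerivAt).fderiv,
    extDerivFlat_apply]
  simp only [VectorField.lieBracket, map_sub, _root_.add_apply, ContinuousLinearMap.comp_apply,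
    ContinuousLinearMap.flip_apply]
  ring

theorem covDerivTwo_congr {G S S' : CoordMetric n} (h : S =ᶠ[nhds x] S') (a b c : Euc n) :
    covDerivTwo G S x a b c = covDerivTwo G S' x a b c := by
  have h1 : (fun y => S y b c) =ᶠ[nhds x] fun y => S' y b c := by
    filter_upwards [h] with y hy using by rw [hy]
  rw [covDerivTwo, covDerivTwo, h1.fderiv_eq, h.eq_of_nhds]

theorem IsMetricOn.covDerivTwo_eq (hB : IsMetricOn B s) (hx : x ∈ s) {S : BilinField n}
    (hS : DifferentiableAt ℝ S x) (a b c : Euc n) :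
    covDerivTwo (bilin B) (bilin S) x a b c = fderiv ℝ S x a b c
      - S x (christoffelMap B x a b) c - S x b (christoffelMap B x a c) := by
  rw [covDerivTwo, hB.christoffel_eq hx, hB.christoffel_eq hx]
  simp only [bilin, fderiv_bilin_const hS]

theorem IsMetricOn.covDerivTwo_fields (hB : IsMetricOn B s) (hx : x ∈ s) {S : BilinField n}
    (hS : DifferentiableAt ℝ S x) (V : CoordField n) {W Z : CoordField n}
    (hW : DifferentiableAt ℝ W x) (hZ : DifferentiableAt ℝ Z x) :
    covDerivTwo (bilin B) (bilin S) x (V x) (W x) (Z x)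
      = fderiv ℝ (fun y => S y (W y) (Z y)) x (V x)
        - S x (covDeriv (bilin B) V W x) (Z x) - S x (W x) (covDeriv (bilin B) V Z x) := by
  have h1 := (hS.hasFDerivAt.clm_apply hW.hasFDerivAt).clm_apply hZ.hasFDerivAt
  rw [h1.fderiv, hB.covDerivTwo_eq hx hS, hB.covDeriv_eq hx, hB.covDeriv_eq hx]
  simp only [map_add, _root_.add_apply, ContinuousLinearMap.comp_apply,
    ContinuousLinearMap.flip_apply]
  ring

/-- S' stands for the exterior derivative as defined pointwise, and S for the same form as a
differentiable field of continuous bilinear forms. Agreement on the open set s suffices, since only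
germs matter. -/
theorem IsOrthonormalFrame.codiffTwo_eq (hB : IsMetricOn B s) (he : IsOrthonormalFrame B s e)
    (hx : x ∈ s) {S : BilinField n} {S' : CoordMetric n} (hS : DifferentiableAt ℝ S x)
    (hS' : ∀ y ∈ s, S' y = bilin S y) (v : Euc n) :
    codiffTwo (bilin B) S' x v
      = - ∑ i, covDerivTwo (bilin B) (bilin S) x (e i x) (e i x) v := by
  have heq : S' =ᶠ[nhds x] bilin S := by
    filter_upwards [hB.isOpen.mem_nhds hx] with y hy using hS' y hy
  rw [codiffTwo]
  simp only [covDerivTwo_congr heq]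
  rw [he.metricTrace_eq hx]
  simp only [hB.covDerivTwo_eq hx hS]
  constructor <;> intros <;> simp only [map_add, map_smul, _root_.add_apply,
      _root_.smul_apply, smul_eq_mul] <;> ring

end CoordGeom

/-! ### The integrability tensor, and the Gauss curvature of a surface in a frame. -/

namespace CoordGeom

section

variable {n : ℕ} {B : BilinField n} {s : Set (Euc n)} {x : Euc n} {e : Fin n → CoordField n}

/-- The projection orthogonal to `U x`, as a continuous linear map. -/
def horProjMap (B : BilinField n) (U : CoordField n) (x : Euc n) : Euc n →L[ℝ] Euc n :=
  ContinuousLinearMap.id ℝ (Euc n) - (B x (U x)).smulRight (U x)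

theorem IsMetricOn.horProj_eq (hB : IsMetricOn B s) (hx : x ∈ s) (U : CoordField n) (v : Euc n) :
    horProj (bilin B) U x v = horProjMap B U x v := by
  simp [horProj, verProj, horProjMap, bilin, hB.symm x hx v]

theorem IsMetricOn.smooth_horProj (hB : IsMetricOn B s) {U V : CoordField n}
    (hU : ContDiffOn ℝ ∞ U s) (hV : ContDiffOn ℝ ∞ V s) :
    ContDiffOn ℝ ∞ (fun y => horProj (bilin B) U y (V y)) s :=
  hV.sub (((hB.smooth.clm_apply hV).clm_apply hU).smul hU)

theorem IsMetricOn.apply_horProj (hB : IsMetricOn B s) (hx : x ∈ s) {U : CoordField n}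
    (hU : B x (U x) (U x) = 1) (v : Euc n) : B x (U x) (horProj (bilin B) U x v) = 0 := by
  simp [horProj, verProj, bilin, hU, hB.symm x hx v]

/-- Cartan's formula for θ = B(U, ·) on horizontal fields: θ(X) and θ(Y) vanish identically, leaving
θ([X, Y]) = −dθ(X, Y). -/
theorem IsMetricOn.integrability_eq (hB : IsMetricOn B s) (hx : x ∈ s) {U : CoordField n}
    (hUs : ContDiffOn ℝ ∞ U s) (hU : ∀ y ∈ s, B y (U y) (U y) = 1) (v w : Euc n) :
    integrability (bilin B) U x v w
      = -(extDerivFlat B U x (horProjMap B U x v) (horProjMap B U x w)) • U x := by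
  have hd : ∀ v, DifferentiableAt ℝ (fun y => horProj (bilin B) U y v) x := fun v =>
    differentiableAt_of_smoothOn hB.isOpen (hB.smooth_horProj hUs contDiffOn_const) hx
  have h0 : ∀ v, (fun y => B y (U y) (horProj (bilin B) U y v)) =ᶠ[nhds x] fun _ => 0 := by
    intro v
    filter_upwards [hB.isOpen.mem_nhds hx] with y hy using hB.apply_horProj hy (hU y hy) v
  have h1 := hB.extDerivFlat_fields hx hUs (hd v) (hd w)
  rw [(h0 v).fderiv_eq, (h0 w).fderiv_eq] at h1
  rw [← hB.horProj_eq hx, ← hB.horProj_eq hx, h1, integrability, verProj, bilin,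
    hB.symm x hx _ (U x)]
  simp

theorem IsOrthonormalFrame.integrabilityNormSq_eq (hB : IsMetricOn B s)
    (he : IsOrthonormalFrame B s e) (hx : x ∈ s) {U : CoordField n}
    (hUs : ContDiffOn ℝ ∞ U s) (hU : ∀ y ∈ s, B y (U y) (U y) = 1) :
    integrabilityNormSq (bilin B) U x = ∑ i, ∑ j,
      extDerivFlat B U x (horProjMap B U x (e i x)) (horProjMap B U x (e j x)) ^ 2 := by
  set P := horProjMap B U x
  set O := extDerivFlat B U x
  have h1 : ∀ a b c d, bilin B x (integrability (bilin B) U x a c)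
      (integrability (bilin B) U x b d) = O (P a) (P c) * O (P b) (P d) := by
    intro a b c d
    rw [hB.integrability_eq hx hUs hU, hB.integrability_eq hx hUs hU, bilin]
    simp only [map_smul, _root_.smul_apply, smul_eq_mul, hU x hx]
    ring
  have h2 : ∀ a b, metricTrace (bilin B) x (fun c d => O (P a) (P c) * O (P b) (P d))
      = ∑ j, O (P a) (P (e j x)) * O (P b) (P (e j x)) := fun a b =>
    he.metricTrace_eq hx (isBilin_mul (isLinearMap_clm ((O (P a)).comp P))
      (isLinearMap_clm ((O (P b)).comp P)))
  simp only [integrabilityNormSq, h1, h2]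
  rw [he.metricTrace_eq hx]
  · simp only [sq]
  · exact IsBilin.sum fun j => isBilin_mul (isLinearMap_clm ((O.flip (P (e j x))).comp P))
      (isLinearMap_clm ((O.flip (P (e j x))).comp P))

end

section Surface

variable {B : BilinField 2} {s : Set (Euc 2)} {x : Euc 2} {e : Fin 2 → CoordField 2}

/-- Skew-symmetry in the first two arguments produces the determinant of the change of basis. -/
theorem curvatureMap_comb {n : ℕ} {B : BilinField n} {x : Euc n} (a b c d : ℝ) (p q w : Euc n) :
    curvatureMap B x (a • p + b • q) (c • p + d • q) w
      = (a * d - b * c) • curvatureMap B x p q w := by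
  simp only [curvatureMap, map_add, map_smul, _root_.add_apply, _root_.smul_apply]
  module

theorem curvatureMap_add_smul {n : ℕ} {B : BilinField n} {x : Euc n} (u v p q : Euc n) (a b : ℝ) :
    curvatureMap B x u v (a • p + b • q)
      = a • curvatureMap B x u v p + b • curvatureMap B x u v q := by
  simp only [curvatureMap, map_add, map_smul]
  module

/-- The Gauss curvature in an orthonormal frame with `[e₀, e₁] = k₀ e₀ + k₁ e₁`. -/
theorem IsOrthonormalFrame.gaussCurvature_eq (hB : IsMetricOn B s)
    (he : IsOrthonormalFrame B s e) (hx : x ∈ s) {k₀ k₁ : Euc 2 → ℝ}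
    (hk₀ : ContDiffOn ℝ ∞ k₀ s) (hk₁ : ContDiffOn ℝ ∞ k₁ s)
    (hk : ∀ y ∈ s, VectorField.lieBracket ℝ (e 0) (e 1) y = k₀ y • e 0 y + k₁ y • e 1 y) :
    gaussCurvature (bilin B) x
      = fderiv ℝ k₁ x (e 0 x) - fderiv ℝ k₀ x (e 1 x) - k₀ x ^ 2 - k₁ x ^ 2 := by
  let c : Fin 2 → Fin 2 → Fin 2 → Euc 2 → ℝ :=
    ![![![0, 0], ![k₀, k₁]], ![![-k₀, -k₁], ![0, 0]]]
  -- The Koszul coefficients of c: ∇_{e_j} e₀ = −k_j e₁ and ∇_{e_j} e₁ = k_j e₀.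
  let W : Fin 2 → Fin 2 → Fin 2 → Euc 2 → ℝ :=
    ![![![0, -k₀], ![k₀, 0]], ![![0, -k₁], ![k₁, 0]]]
  have hc : ∀ y ∈ s, ∀ i j, VectorField.lieBracket ℝ (e i) (e j) y = ∑ k, c i j k y • e k y := by
    intro y hy i j
    have h1 := hk y hy
    have h2 : VectorField.lieBracket ℝ (e 1) (e 0) y = -(k₀ y • e 0 y + k₁ y • e 1 y) := by
      rw [VectorField.lieBracket_swap, h1]
    fin_cases i <;> fin_cases j <;> simp [c, h1, h2, Fin.sum_univ_two]
    abel
  have hW : ∀ y ∈ s, ∀ i j, covDeriv (bilin B) (e i) (e j) y = ∑ k, W i j k y • e k y := by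
    intro y hy i j
    rw [he.covDeriv_eq_koszul hB hy (hc y hy)]
    refine Finset.sum_congr rfl fun k _ => ?_
    congr 1
    fin_cases i <;> fin_cases j <;> fin_cases k <;> simp [c, W, koszul] <;> ring
  have hWs : ∀ i j k, ContDiffOn ℝ ∞ (W i j k) s := by
    have h0 : ContDiffOn ℝ ∞ (0 : Euc 2 → ℝ) s := contDiffOn_const
    have h1 : ContDiffOn ℝ ∞ (-k₀) s := hk₀.neg
    have h2 : ContDiffOn ℝ ∞ (-k₁) s := hk₁.neg
    intro i j k
    fin_cases i <;> fin_cases j <;> fin_cases k <;>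
      simp [W, h0, hk₀, hk₁, h1, h2]
  have hR : ∀ k m, B x (curvatureMap B x (e 0 x) (e 1 x) (e k x)) (e m x)
      = curvatureCoeff e W x 0 1 k m := by
    intro k m
    rw [← hB.riemann_eq hx]
    exact he.riemann_eq_curvatureCoeff hB hx hWs hW 0 1 k m
  set ρ := fderiv ℝ k₁ x (e 0 x) - fderiv ℝ k₀ x (e 1 x) - k₀ x ^ 2 - k₁ x ^ 2
  have h00 : B x (curvatureMap B x (e 0 x) (e 1 x) (e 0 x)) (e 0 x) = 0 := by
    rw [hR]; simp [curvatureCoeff, W, Fin.sum_univ_two]; ring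
  have h11 : B x (curvatureMap B x (e 0 x) (e 1 x) (e 1 x)) (e 1 x) = 0 := by
    rw [hR]; simp [curvatureCoeff, W, Fin.sum_univ_two]; ring
  have h10 : B x (curvatureMap B x (e 0 x) (e 1 x) (e 1 x)) (e 0 x) = ρ := by
    rw [hR]; simp [curvatureCoeff, W, Fin.sum_univ_two, ρ]; ring
  have h01 : B x (curvatureMap B x (e 0 x) (e 1 x) (e 0 x)) (e 1 x) = -ρ := by
    rw [hR]; simp [curvatureCoeff, W, Fin.sum_univ_two, fderiv_neg, ρ]; ring
  have hdet := hB.det_gram_ne_zero hx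
  rw [gaussCurvature, div_eq_iff hdet, Matrix.det_fin_two]
  simp only [gram, Matrix.of_apply]
  rw [hB.riemann_eq hx]
  simp only [bilin]
  -- Writing the coordinate vectors in the frame multiplies both the curvature term and the Gram
  -- determinant by (pq' − qp')², so only the frame component ρ remains.
  obtain ⟨p, q, hpq⟩ : ∃ p q, basisVec 0 = p • e 0 x + q • e 1 x :=
    ⟨_, _, by rw [← Fin.sum_univ_two (f := fun i => B x (basisVec 0) (e i x) • e i x),
      he.sum_smul hx]⟩
  obtain ⟨p', q', hpq'⟩ : ∃ p q, basisVec 1 = p • e 0 x + q • e 1 x :=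
    ⟨_, _, by rw [← Fin.sum_univ_two (f := fun i => B x (basisVec 1) (e i x) • e i x),
      he.sum_smul hx]⟩
  rw [hpq, hpq', curvatureMap_comb, curvatureMap_add_smul]
  have o00 := he.orth x hx 0 0
  have o01 := he.orth x hx 0 1
  have o10 := he.orth x hx 1 0
  have o11 := he.orth x hx 1 1
  simp only [Fin.isValue, if_true, zero_ne_one, one_ne_zero, if_false] at o00 o01 o10 o11
  simp only [map_add, map_smul, _root_.add_apply, _root_.smul_apply, smul_eq_mul, h00, h01, h10,
    h11, o00, o01, o10, o11]
  ring

end Surface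

end CoordGeom

/-! ### Adapted frames in dimension three: connection, curvature and the terms of the equation. -/

namespace CoordGeom

variable {B : BilinField 3} {s : Set (Euc 3)} {x : Euc 3} {e : Fin 3 → CoordField 3}
  {a b i σ m₀ m₁ l f : Euc 3 → ℝ}

/-- An orthonormal frame whose last vector spans the fibres of a semi-conformal map of dilation
`exp l`, and whose first two vectors are `exp l` times horizontal lifts. -/
structure IsAdaptedFrame (B : BilinField 3) (s : Set (Euc 3)) (e : Fin 3 → CoordField 3)
    (a b i σ m₀ m₁ l : Euc 3 → ℝ) : Prop where
  frame : IsOrthonormalFrame B s e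
  smooth_a : ContDiffOn ℝ ∞ a s
  smooth_b : ContDiffOn ℝ ∞ b s
  smooth_i : ContDiffOn ℝ ∞ i s
  smooth_σ : ContDiffOn ℝ ∞ σ s
  smooth_m₀ : ContDiffOn ℝ ∞ m₀ s
  smooth_m₁ : ContDiffOn ℝ ∞ m₁ s
  smooth_l : ContDiffOn ℝ ∞ l s
  bracket₀₁ : ∀ y ∈ s, VectorField.lieBracket ℝ (e 0) (e 1) y
    = a y • e 0 y + b y • e 1 y + i y • e 2 y
  bracket₀₂ : ∀ y ∈ s, VectorField.lieBracket ℝ (e 0) (e 2) y = -σ y • e 0 y + m₀ y • e 2 y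
  bracket₁₂ : ∀ y ∈ s, VectorField.lieBracket ℝ (e 1) (e 2) y = -σ y • e 1 y + m₁ y • e 2 y
  fderiv_l : ∀ y ∈ s, fderiv ℝ l y (e 2 y) = σ y

/-- The structure functions of an adapted frame. -/
def adaptedStructure (a b i σ m₀ m₁ : Euc 3 → ℝ) : Fin 3 → Fin 3 → Fin 3 → Euc 3 → ℝ :=
  ![![![0, 0, 0], ![a, b, i], ![-σ, 0, m₀]],
    ![![-a, -b, -i], ![0, 0, 0], ![0, -σ, m₁]],
    ![![σ, 0, -m₀], ![0, σ, -m₁], ![0, 0, 0]]]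

/-- The connection coefficients of an adapted frame. -/
def adaptedConnection (a b i σ m₀ m₁ : Euc 3 → ℝ) : Fin 3 → Fin 3 → Fin 3 → Euc 3 → ℝ :=
  ![![![0, -a, σ], ![a, 0, (1 / 2 : ℝ) • i], ![-σ, (-1 / 2 : ℝ) • i, 0]],
    ![![0, -b, (-1 / 2 : ℝ) • i], ![b, 0, σ], ![(1 / 2 : ℝ) • i, -σ, 0]],
    ![![0, (-1 / 2 : ℝ) • i, -m₀], ![(1 / 2 : ℝ) • i, 0, -m₁], ![m₀, m₁, 0]]]

namespace IsAdaptedFrame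

theorem smooth_structure (h : IsAdaptedFrame B s e a b i σ m₀ m₁ l) (p q r : Fin 3) :
    ContDiffOn ℝ ∞ (adaptedStructure a b i σ m₀ m₁ p q r) s := by
  have h0 : ContDiffOn ℝ ∞ (0 : Euc 3 → ℝ) s := contDiffOn_const
  have h1 : ContDiffOn ℝ ∞ (-a) s := h.smooth_a.neg
  have h2 : ContDiffOn ℝ ∞ (-b) s := h.smooth_b.neg
  have h3 : ContDiffOn ℝ ∞ (-i) s := h.smooth_i.neg
  have h4 : ContDiffOn ℝ ∞ (-σ) s := h.smooth_σ.neg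
  have h5 : ContDiffOn ℝ ∞ (-m₀) s := h.smooth_m₀.neg
  have h6 : ContDiffOn ℝ ∞ (-m₁) s := h.smooth_m₁.neg
  fin_cases p <;> fin_cases q <;> fin_cases r <;>
    simp [adaptedStructure, h0, h1, h2, h3, h4, h5, h6, h.smooth_a, h.smooth_b, h.smooth_i,
      h.smooth_σ, h.smooth_m₀, h.smooth_m₁]

theorem smooth_connection (h : IsAdaptedFrame B s e a b i σ m₀ m₁ l) (p q r : Fin 3) :
    ContDiffOn ℝ ∞ (adaptedConnection a b i σ m₀ m₁ p q r) s := by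
  have h0 : ContDiffOn ℝ ∞ (0 : Euc 3 → ℝ) s := contDiffOn_const
  have h1 : ContDiffOn ℝ ∞ (-a) s := h.smooth_a.neg
  have h2 : ContDiffOn ℝ ∞ (-b) s := h.smooth_b.neg
  have h3 : ContDiffOn ℝ ∞ ((1 / 2 : ℝ) • i) s := h.smooth_i.const_smul (1 / 2 : ℝ)
  have h3' : ContDiffOn ℝ ∞ ((-1 / 2 : ℝ) • i) s := h.smooth_i.const_smul (-1 / 2 : ℝ)
  have h4 : ContDiffOn ℝ ∞ (-σ) s := h.smooth_σ.neg
  have h5 : ContDiffOn ℝ ∞ (-m₀) s := h.smooth_m₀.neg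
  have h6 : ContDiffOn ℝ ∞ (-m₁) s := h.smooth_m₁.neg
  fin_cases p <;> fin_cases q <;> fin_cases r <;> first
    | exact h0 | exact h1 | exact h2 | exact h3 | exact h3' | exact h4 | exact h5 | exact h6
    | exact h.smooth_a | exact h.smooth_b | exact h.smooth_i | exact h.smooth_σ
    | exact h.smooth_m₀ | exact h.smooth_m₁

theorem lieBracket_eq (h : IsAdaptedFrame B s e a b i σ m₀ m₁ l) {y : Euc 3} (hy : y ∈ s)
    (p q : Fin 3) : VectorField.lieBracket ℝ (e p) (e q) y
      = ∑ k, adaptedStructure a b i σ m₀ m₁ p q k y • e k y := by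
  have h1 := h.bracket₀₁ y hy
  have h2 := h.bracket₀₂ y hy
  have h3 := h.bracket₁₂ y hy
  have h1' := VectorField.lieBracket_swap (𝕜 := ℝ) (V := e 1) (W := e 0) (x := y)
  have h2' := VectorField.lieBracket_swap (𝕜 := ℝ) (V := e 2) (W := e 0) (x := y)
  have h3' := VectorField.lieBracket_swap (𝕜 := ℝ) (V := e 2) (W := e 1) (x := y)
  rw [h1] at h1'
  rw [h2] at h2'
  rw [h3] at h3'
  fin_cases p <;> fin_cases q <;>
    simp [adaptedStructure, h1, h2, h3, h1', h2', h3', Fin.sum_univ_three] <;> abel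

theorem covDeriv_eq (hB : IsMetricOn B s) (h : IsAdaptedFrame B s e a b i σ m₀ m₁ l) {y : Euc 3}
    (hy : y ∈ s) (p q : Fin 3) : covDeriv (bilin B) (e p) (e q) y
      = ∑ k, adaptedConnection a b i σ m₀ m₁ p q k y • e k y := by
  rw [h.frame.covDeriv_eq_koszul hB hy (fun p q => h.lieBracket_eq hy p q)]
  refine Finset.sum_congr rfl fun k _ => ?_
  congr 1
  fin_cases p <;> fin_cases q <;> fin_cases k <;>
    simp [adaptedStructure, adaptedConnection, koszul] <;> ring

theorem fderiv_l_commutator (hs : IsOpen s) (hx : x ∈ s)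
    (h : IsAdaptedFrame B s e a b i σ m₀ m₁ l) (p q : Fin 3) :
    fderiv ℝ (fun y => fderiv ℝ l y (e q y)) x (e p x)
      - fderiv ℝ (fun y => fderiv ℝ l y (e p y)) x (e q x)
      = ∑ k, adaptedStructure a b i σ m₀ m₁ p q k x * fderiv ℝ l x (e k x) := by
  rw [← fderiv_lieBracket_apply hs hx h.smooth_l (h.frame.differentiableAt hs hx p)
    (h.frame.differentiableAt hs hx q), h.lieBracket_eq hx, map_sum]
  simp only [map_smul, smul_eq_mul]

/-- The connection table gives ∇_{e₂} e₂ without an e₂ component, so the horizontal projection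
changes nothing. -/
theorem meanCurv_eq (hB : IsMetricOn B s) (h : IsAdaptedFrame B s e a b i σ m₀ m₁ l) {y : Euc 3}
    (hy : y ∈ s) : meanCurv (bilin B) (e 2) y = m₀ y • e 0 y + m₁ y • e 1 y := by
  have h0 := h.frame.orth y hy 0 2
  have h1 := h.frame.orth y hy 1 2
  rw [meanCurv, h.covDeriv_eq hB hy, horProj, verProj, bilin]
  simp [adaptedConnection, Fin.sum_univ_three, h0, h1]

/-- The functions θ(e_q) are constant, so Cartan's formula leaves dθ(e_p, e_q) = −θ([e_p, e_q]). -/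
theorem extDerivFlat_eq (hB : IsMetricOn B s) (h : IsAdaptedFrame B s e a b i σ m₀ m₁ l)
    {y : Euc 3} (hy : y ∈ s) (p q : Fin 3) : extDerivFlat B (e 2) y (e p y) (e q y)
      = - adaptedStructure a b i σ m₀ m₁ p q 2 y := by
  have hc : ∀ q, (fun y => B y (e 2 y) (e q y)) =ᶠ[nhds y] fun _ => if 2 = q then 1 else 0 := by
    intro q
    filter_upwards [hB.isOpen.mem_nhds hy] with z hz using h.frame.orth z hz 2 q
  rw [hB.extDerivFlat_fields hy (h.frame.smooth 2) (h.frame.differentiableAt hB.isOpen hy p)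
    (h.frame.differentiableAt hB.isOpen hy q), (hc p).fderiv_eq, (hc q).fderiv_eq,
    hB.symm y hy, h.lieBracket_eq hy, h.frame.apply_sum hy]
  simp

theorem codiffTwo_eq (hB : IsMetricOn B s) (hx : x ∈ s)
    (h : IsAdaptedFrame B s e a b i σ m₀ m₁ l) (k : Fin 3) :
    codiffTwo (bilin B) (extDerivOne (flat (bilin B) (e 2))) x (e k x)
      = ∑ q, (fderiv ℝ (adaptedStructure a b i σ m₀ m₁ q k 2) x (e q x)
        - ∑ t, adaptedConnection a b i σ m₀ m₁ q q t x * adaptedStructure a b i σ m₀ m₁ t k 2 x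
        - ∑ t, adaptedConnection a b i σ m₀ m₁ q k t x * adaptedStructure a b i σ m₀ m₁ q t 2 x)
      := by
  have hS := differentiableAt_of_smoothOn hB.isOpen (hB.smooth_extDerivFlat (h.frame.smooth 2)) hx
  rw [h.frame.codiffTwo_eq hB hx hS (fun y hy => by
    ext v w
    exact hB.extDerivOne_flat hy (h.frame.smooth 2) v w), ← Finset.sum_neg_distrib]
  refine Finset.sum_congr rfl fun q _ => ?_
  have h1 : (fun y => extDerivFlat B (e 2) y (e q y) (e k y))
      =ᶠ[nhds x] - adaptedStructure a b i σ m₀ m₁ q k 2 := by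
    filter_upwards [hB.isOpen.mem_nhds hx] with z hz using h.extDerivFlat_eq hB hz q k
  rw [hB.covDerivTwo_fields hx hS (e q) (h.frame.differentiableAt hB.isOpen hx q)
    (h.frame.differentiableAt hB.isOpen hx k), h1.fderiv_eq, h.covDeriv_eq hB hx,
    h.covDeriv_eq hB hx, fderiv_neg]
  simp only [map_sum, map_smul, _root_.sum_apply, _root_.smul_apply, _root_.neg_apply, smul_eq_mul,
    h.extDerivFlat_eq hB hx, mul_neg, Finset.sum_neg_distrib]
  ring

theorem isLinearMap_codiffTwo (hB : IsMetricOn B s) (hx : x ∈ s)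
    (h : IsAdaptedFrame B s e a b i σ m₀ m₁ l) :
    IsLinearMap ℝ (codiffTwo (bilin B) (extDerivOne (flat (bilin B) (e 2))) x) := by
  have hS := differentiableAt_of_smoothOn hB.isOpen (hB.smooth_extDerivFlat (h.frame.smooth 2)) hx
  have h1 := h.frame.codiffTwo_eq hB hx hS (fun y hy => by
    ext v w
    exact hB.extDerivOne_flat hy (h.frame.smooth 2) v w)
  simp only [hB.covDerivTwo_eq hx hS] at h1
  constructor <;> intros <;> simp only [h1, map_add, map_smul, smul_eq_mul,
      Fin.sum_univ_three] <;> ring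

/-- Only the pairs (0, 1) and (1, 0) contribute, each with i²; the projection kills e₂. -/
theorem integrabilityNormSq_eq (hB : IsMetricOn B s) (hx : x ∈ s)
    (h : IsAdaptedFrame B s e a b i σ m₀ m₁ l) :
    integrabilityNormSq (bilin B) (e 2) x = 2 * i x ^ 2 := by
  rw [h.frame.integrabilityNormSq_eq hB hx (h.frame.smooth 2)
    (fun y hy => by rw [h.frame.orth y hy]; simp)]
  have hp : ∀ k, horProjMap B (e 2) x (e k x) = if k = 2 then 0 else e k x := by
    intro k
    have := h.frame.orth x hx 2 k
    fin_cases k <;> simp [horProjMap] at this ⊢ <;> simp [this]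
  simp only [hp]
  simp [Fin.sum_univ_three, h.extDerivFlat_eq hB hx, adaptedStructure]
  ring

theorem laplacian_eq (hB : IsMetricOn B s) (hx : x ∈ s)
    (h : IsAdaptedFrame B s e a b i σ m₀ m₁ l) :
    laplacian (bilin B) l x = ∑ q, (fderiv ℝ (fun y => fderiv ℝ l y (e q y)) x (e q x)
      - ∑ t, adaptedConnection a b i σ m₀ m₁ q q t x * fderiv ℝ l x (e t x)) := by
  rw [h.frame.laplacian_eq hB hx h.smooth_l]
  refine Finset.sum_congr rfl fun q _ => ?_
  rw [h.covDeriv_eq hB hx, map_sum]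
  simp only [map_smul, smul_eq_mul]

/-- The Lie derivative of the metric along `∑ g_t e_t`. -/
theorem lieMetric_eq (hB : IsMetricOn B s) (hx : x ∈ s)
    (h : IsAdaptedFrame B s e a b i σ m₀ m₁ l) {g : Fin 3 → Euc 3 → ℝ}
    (hg : ∀ t, DifferentiableAt ℝ (g t) x) (j k : Fin 3) :
    lieMetric (fun y => ∑ t, g t y • e t y) (bilin B) x (e j x) (e k x)
      = fderiv ℝ (g k) x (e j x) + ∑ t, g t x * adaptedConnection a b i σ m₀ m₁ j t k x
        + (fderiv ℝ (g j) x (e k x) + ∑ t, g t x * adaptedConnection a b i σ m₀ m₁ k t j x) := by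
  have key : ∀ j k : Fin 3, B x (covDeriv (bilin B) (fun _ => e j x)
      (fun y => ∑ t, g t y • e t y) x) (e k x)
      = fderiv ℝ (g k) x (e j x) + ∑ t, g t x * adaptedConnection a b i σ m₀ m₁ j t k x := by
    intro j k
    rw [covDeriv_congr_left (V := fun _ => e j x) (V' := e j) rfl, hB.covDeriv_sum_smul hx (e j) hg
      (fun t => h.frame.differentiableAt hB.isOpen hx t), Finset.sum_add_distrib, map_add,
      _root_.add_apply, h.frame.apply_sum hx, map_sum, _root_.sum_apply]
    congr 1
    refine Finset.sum_congr rfl fun t _ => ?_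
    rw [map_smul, _root_.smul_apply, h.covDeriv_eq hB hx, h.frame.apply_sum hx, smul_eq_mul]
  rw [hB.lieMetric_eq hx, key, hB.symm x hx (e j x), key]

theorem ricci_eq (hB : IsMetricOn B s) (hx : x ∈ s)
    (h : IsAdaptedFrame B s e a b i σ m₀ m₁ l) (j k : Fin 3) :
    ricci (bilin B) x (e j x) (e k x)
      = ∑ q, curvatureCoeff e (adaptedConnection a b i σ m₀ m₁) x q j k q := by
  rw [h.frame.ricci_eq hB hx]
  refine Finset.sum_congr rfl fun q _ => ?_
  exact h.frame.riemann_eq_curvatureCoeff hB hx h.smooth_connection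
    (fun y hy => h.covDeriv_eq hB hy) q j k q

end IsAdaptedFrame

end CoordGeom

/-! ### The soliton tensor in an adapted frame. -/

namespace CoordGeom

variable {B : BilinField 3} {s : Set (Euc 3)} {x : Euc 3} {e : Fin 3 → CoordField 3}
  {a b i σ m₀ m₁ l f lam : Euc 3 → ℝ}

namespace IsAdaptedFrame

theorem isBilin_solitonTensor (hB : IsMetricOn B s) (hx : x ∈ s)
    (h : IsAdaptedFrame B s e a b i σ m₀ m₁ fun y => Real.log (lam y)) (K A : ℝ)
    (X : CoordField 3) : IsBilin (solitonTensor (bilin B) K lam (e 2) f X A x) := by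
  have hc := h.isLinearMap_codiffTwo hB hx
  have hl : IsBilin (lieMetric X (bilin B) x) := hB.isBilin_lieMetric hx X
  have hb : ∀ v w, bilin B x v w = B x v w := fun _ _ => rfl
  have hfl : ∀ V v, flat (bilin B) V x v = B x (V x) v := fun _ _ => rfl
  unfold solitonTensor
  simp only [hb, hfl]
  constructor <;> intros <;>
    simp only [map_add, map_smul, _root_.add_apply, _root_.smul_apply, hc.map_add, hc.map_smul,
      hl.add_left, hl.add_right, hl.smul_left, hl.smul_right, smul_eq_mul] <;> ring

-- The central computation. The second Lie derivative is along fU − μ, written in the frame. The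
-- expression for λ²K is chosen so that in λ²K + Δ ln λ + μ(ln λ) all derivatives of ln λ along e₀
-- and e₁ cancel, leaving e₀(b) − e₁(a) − a² − b² + U(σ) − 2σ².
set_option maxHeartbeats 1000000 in
theorem solitonTensor_frame (hB : IsMetricOn B s) (hx : x ∈ s)
    (h : IsAdaptedFrame B s e a b i σ m₀ m₁ fun y => Real.log (lam y)) {K : ℝ} (A : ℝ)
    (hf : ContDiffOn ℝ ∞ f s)
    (hK : lam x ^ 2 * K =
      (fderiv ℝ b x (e 0 x) - fderiv ℝ (fun y => fderiv ℝ (fun y => Real.log (lam y)) y (e 0 y))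
          x (e 0 x)
        - fderiv ℝ (fun y => Real.log (lam y)) x (e 0 x)
          * (b x - fderiv ℝ (fun y => Real.log (lam y)) x (e 0 x)))
      - (fderiv ℝ a x (e 1 x) + fderiv ℝ (fun y => fderiv ℝ (fun y => Real.log (lam y)) y (e 1 y))
          x (e 1 x)
        - fderiv ℝ (fun y => Real.log (lam y)) x (e 1 x)
          * (a x + fderiv ℝ (fun y => Real.log (lam y)) x (e 1 x)))
      - (a x + fderiv ℝ (fun y => Real.log (lam y)) x (e 1 x)) ^ 2
      - (b x - fderiv ℝ (fun y => Real.log (lam y)) x (e 0 x)) ^ 2)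
    (X : CoordField 3) (j k : Fin 3) :
    solitonTensor (bilin B) K lam (e 2) f X A x (e j x) (e k x)
      = ricci (bilin B) x (e j x) (e k x) + (1 / 2) * (lieMetric X (bilin B) x (e j x) (e k x)
        + lieMetric (fun y => ∑ t, (![-m₀, -m₁, f] : Fin 3 → Euc 3 → ℝ) t y • e t y) (bilin B)
          x (e j x) (e k x)) + A * B x (e j x) (e k x) := by
  set l : Euc 3 → ℝ := fun y => Real.log (lam y) with hl
  have hd := fun {g : Euc 3 → ℝ} (hg : ContDiffOn ℝ ∞ g s) =>
    differentiableAt_of_smoothOn hB.isOpen hg hx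
  have hg : ∀ t, DifferentiableAt ℝ ((![-m₀, -m₁, f] : Fin 3 → Euc 3 → ℝ) t) x := by
    intro t
    fin_cases t
    · exact (hd h.smooth_m₀).neg
    · exact (hd h.smooth_m₁).neg
    · exact hd hf
  have hσ : (fun y => fderiv ℝ l y (e 2 y)) =ᶠ[nhds x] σ := by
    filter_upwards [hB.isOpen.mem_nhds hx] with y hy using h.fderiv_l y hy
  -- The Jacobi identity of e₀, e₁, e₂, by components: r = 0 relates U(a) to e₁(σ), r = 1 relates
  -- U(b) to e₀(σ), and r = 2 relates U(i) to e₀(m₁) − e₁(m₀).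
  have hJ := fun r => h.frame.jacobi hB.isOpen hx h.smooth_structure
    (fun y hy => h.lieBracket_eq hy) 0 1 2 r
  have hJ0 := hJ 0
  have hJ1 := hJ 1
  have hJ2 := hJ 2
  have c01 := h.fderiv_l_commutator hB.isOpen hx 0 1
  have c02 := h.fderiv_l_commutator hB.isOpen hx 0 2
  have c12 := h.fderiv_l_commutator hB.isOpen hx 1 2
  have hθ : ∀ k, flat (bilin B) (e 2) x (e k x) = if 2 = k then 1 else 0 := fun k =>
    h.frame.orth x hx 2 k
  have hμ : ∀ k, flat (bilin B) (meanCurv (bilin B) (e 2)) x (e k x)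
      = (![m₀ x, m₁ x, 0] : Fin 3 → ℝ) k := by
    intro k
    have o0 := h.frame.orth x hx 0 k
    have o1 := h.frame.orth x hx 1 k
    rw [flat, h.meanCurv_eq hB hx, bilin]
    simp only [map_add, map_smul, _root_.add_apply, _root_.smul_apply, o0, o1]
    fin_cases k <;> simp
  have hlm : fderiv ℝ l x (meanCurv (bilin B) (e 2) x)
      = m₀ x * fderiv ℝ l x (e 0 x) + m₁ x * fderiv ℝ l x (e 1 x) := by
    rw [h.meanCurv_eq hB hx]; simp
  rw [h.lieMetric_eq hB hx hg, h.ricci_eq hB hx, h.frame.orth x hx]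
  unfold solitonTensor
  simp only [hθ, hμ, h.codiffTwo_eq hB hx, h.integrabilityNormSq_eq hB hx, hσ.fderiv_eq,
    h.laplacian_eq hB hx, hlm, h.fderiv_l x hx, hK, ← hl,
    show ∀ v w, bilin B x v w = B x v w from fun _ _ => rfl, h.frame.orth x hx]
  rw [hσ.fderiv_eq] at c02 c12
  have hi₁ : ∀ v, fderiv ℝ ((1 / 2 : ℝ) • i) x v = (1 / 2) * fderiv ℝ i x v := by
    intro v; rw [fderiv_const_smul (hd h.smooth_i)]; simp
  have hi₂ : ∀ v, fderiv ℝ ((-1 / 2 : ℝ) • i) x v = (-1 / 2) * fderiv ℝ i x v := by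
    intro v; rw [fderiv_const_smul (hd h.smooth_i)]; simp
  simp only [adaptedStructure, Fin.sum_univ_three, Matrix.cons_val, fderiv_neg, fderiv_zero,
    Pi.zero_apply, Pi.neg_apply, _root_.neg_apply, _root_.zero_apply, h.fderiv_l x hx]
    at hJ0 hJ1 hJ2 c01 c02 c12
  -- Each component is now an identity between polynomials in the structure functions and their
  -- frame derivatives. Modulo the relations collected above it is linear, with products treated as
  -- atoms.
  fin_cases j <;> fin_cases k
  all_goals
    simp only [adaptedStructure, adaptedConnection, curvatureCoeff, Fin.sum_univ_three,
      Matrix.cons_val, fderiv_neg, fderiv_zero, Pi.zero_apply, Pi.neg_apply, _root_.neg_apply,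
      _root_.zero_apply, h.fderiv_l x hx, hi₁, hi₂, Pi.smul_apply, smul_eq_mul, Fin.isValue,
      hσ.fderiv_eq, Fin.zero_eta, Fin.mk_one, Fin.reduceFinMk, Fin.reduceEq, if_true, if_false,
      zero_ne_one, one_ne_zero]
    linarith

end IsAdaptedFrame

end CoordGeom

/-! ### Semi-conformal submersions between coordinate domains: horizontal lifts and the dilation. -/

namespace CoordGeom

/-- Gram–Schmidt applied to the two coordinate fields. -/
theorem exists_orthonormalFrame {H : BilinField 2} {t : Set (Euc 2)} (hH : IsMetricOn H t) :
    ∃ ε : Fin 2 → CoordField 2, IsOrthonormalFrame H t ε := by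
  have smooth_const : ∀ v w : Euc 2, ContDiffOn ℝ ∞ (fun y => H y v w) t := fun v w =>
    (hH.smooth.clm_apply contDiffOn_const).clm_apply contDiffOn_const
  have h0 : (basisVec 0 : Euc 2) ≠ 0 := by
    intro h
    have := congrArg (fun u : Euc 2 => u 0) h
    simp [basisVec] at this
  have norm_field : ∀ V : CoordField 2, ContDiffOn ℝ ∞ V t → (∀ y ∈ t, V y ≠ 0) →
      ContDiffOn ℝ ∞ (fun y => (Real.sqrt (H y (V y) (V y)))⁻¹ • V y) t := by
    intro V hV hne
    have h1 : ContDiffOn ℝ ∞ (fun y => H y (V y) (V y)) t :=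
      (hH.smooth.clm_apply hV).clm_apply hV
    refine ContDiffOn.smul (ContDiffOn.inv (h1.sqrt fun y hy => (hH.pos y hy _ (hne y hy)).ne')
      fun y hy => ?_) hV
    exact (Real.sqrt_pos.2 (hH.pos y hy _ (hne y hy))).ne'
  have norm_one : ∀ V : CoordField 2, ∀ y ∈ t, V y ≠ 0 →
      H y ((Real.sqrt (H y (V y) (V y)))⁻¹ • V y) ((Real.sqrt (H y (V y) (V y)))⁻¹ • V y) = 1 := by
    intro V y hy hne
    have hp := hH.pos y hy _ hne
    simp only [map_smul, _root_.smul_apply, smul_eq_mul]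
    rw [← mul_assoc, ← mul_inv, Real.mul_self_sqrt hp.le, inv_mul_cancel₀ hp.ne']
  let ε₀ : CoordField 2 := fun y => (Real.sqrt (H y (basisVec 0) (basisVec 0)))⁻¹ • basisVec 0
  have sε₀ : ContDiffOn ℝ ∞ ε₀ t := norm_field (fun _ => basisVec 0) contDiffOn_const fun _ _ => h0
  let V : CoordField 2 := fun y => basisVec 1 - H y (basisVec 1) (ε₀ y) • ε₀ y
  have sV : ContDiffOn ℝ ∞ V t := contDiffOn_const.sub
    (((hH.smooth.clm_apply contDiffOn_const).clm_apply sε₀).smul sε₀)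
  -- The field ε₀ is a multiple of the first coordinate vector, so the second coordinate of V is 1.
  have hV : ∀ y, V y ≠ 0 := by
    intro y h
    have := congrArg (fun u : Euc 2 => u 1) h
    simp [V, ε₀, basisVec] at this
  have o00 : ∀ y ∈ t, H y (ε₀ y) (ε₀ y) = 1 := fun y hy =>
    norm_one (fun _ => basisVec 0) y hy h0
  let ε₁ : CoordField 2 := fun y => (Real.sqrt (H y (V y) (V y)))⁻¹ • V y
  have o10 : ∀ y ∈ t, H y (ε₁ y) (ε₀ y) = 0 := by
    intro y hy
    simp [ε₁, V, o00 y hy]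
  refine ⟨![ε₀, ε₁], ?_, ?_⟩
  · intro i
    fin_cases i
    · exact sε₀
    · exact norm_field V sV fun y _ => hV y
  · intro y hy i j
    fin_cases i <;> fin_cases j
    · simpa using o00 y hy
    · simpa [hH.symm y hy (ε₀ y)] using o10 y hy
    · simpa using o10 y hy
    · exact norm_one V y hy (hV y)

/-- The Lie bracket of related vector fields. -/
theorem fderiv_lieBracket_of_related {m n : ℕ} {F : Euc m → Euc n} {s : Set (Euc m)}
    {t : Set (Euc n)} {x : Euc m} (hs : IsOpen s) (ht : IsOpen t) (hF : ContDiffOn ℝ ∞ F s)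
    (hst : Set.MapsTo F s t) (hx : x ∈ s) {V W : CoordField m} {V' W' : CoordField n}
    (hV : ContDiffOn ℝ ∞ V s) (hW : ContDiffOn ℝ ∞ W s) (hV' : ContDiffOn ℝ ∞ V' t)
    (hW' : ContDiffOn ℝ ∞ W' t) (hVV : ∀ y ∈ s, fderiv ℝ F y (V y) = V' (F y))
    (hWW : ∀ y ∈ s, fderiv ℝ F y (W y) = W' (F y)) :
    fderiv ℝ F x (VectorField.lieBracket ℝ V W x) = VectorField.lieBracket ℝ V' W' (F x) := by
  have dF := differentiableAt_of_smoothOn hs hF hx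
  have dDF := (differentiableAt_of_smoothOn hs
    (hF.fderiv_of_isOpen hs (m := ∞) (by simp)) hx).hasFDerivAt
  -- Differentiating the relation DF(W) = W' ∘ F. Taking the difference of two such formulas removes
  -- the symmetric second derivative of F.
  have key : ∀ {W : CoordField m} {W' : CoordField n}, ContDiffOn ℝ ∞ W s → ContDiffOn ℝ ∞ W' t →
      (∀ y ∈ s, fderiv ℝ F y (W y) = W' (F y)) → ∀ z,
      fderiv ℝ (fderiv ℝ F) x z (W x) + fderiv ℝ F x (fderiv ℝ W x z)
        = fderiv ℝ W' (F x) (fderiv ℝ F x z) := by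
    intro W W' hW hW' hWW z
    have h1 := dDF.clm_apply (differentiableAt_of_smoothOn hs hW hx).hasFDerivAt
    have h2 := (differentiableAt_of_smoothOn ht hW' (hst hx)).hasFDerivAt.comp x dF.hasFDerivAt
    have h3 : (fun y => fderiv ℝ F y (W y)) =ᶠ[nhds x] W' ∘ F := by
      filter_upwards [hs.mem_nhds hx] with y hy using hWW y hy
    have h4 := h1.fderiv.symm.trans (h3.fderiv_eq.trans h2.fderiv)
    have h5 := congrArg (fun L => L z) h4
    simpa [add_comm] using h5
  have k1 := key hW hW' hWW (V x)
  have k2 := key hV hV' hVV (W x)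
  rw [VectorField.lieBracket, VectorField.lieBracket, map_sub, ← hVV x hx, ← hWW x hx, ← k1, ← k2,
    fderiv_fderiv_comm hs hF hx (V x)]
  abel

theorem lieBracket_smul_smul {n : ℕ} {x : Euc n} {c d : Euc n → ℝ} {V W : CoordField n}
    (hc : DifferentiableAt ℝ c x) (hd : DifferentiableAt ℝ d x) (hV : DifferentiableAt ℝ V x)
    (hW : DifferentiableAt ℝ W x) :
    VectorField.lieBracket ℝ (fun y => c y • V y) (fun y => d y • W y) x
      = (c x * d x) • VectorField.lieBracket ℝ V W x + (c x * fderiv ℝ d x (V x)) • W x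
        - (d x * fderiv ℝ c x (W x)) • V x := by
  simp only [VectorField.lieBracket, fderiv_fun_smul hc hV, fderiv_fun_smul hd hW,
    _root_.add_apply, _root_.smul_apply, ContinuousLinearMap.smulRight_apply, map_smul]
  module

/-- A semi-conformal submersion `F` of dilation `lam` between coordinate domains, whose fibres are
spanned by the unit field `U`. -/
structure IsSemiConformalOn (B : BilinField 3) (s : Set (Euc 3)) (H : BilinField 2)
    (t : Set (Euc 2)) (F : Euc 3 → Euc 2) (lam : Euc 3 → ℝ) (U : CoordField 3) : Prop where
  source : IsMetricOn B s
  target : IsMetricOn H t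
  smooth : ContDiffOn ℝ ∞ F s
  mapsTo : Set.MapsTo F s t
  smooth_vertical : ContDiffOn ℝ ∞ U s
  unit : ∀ y ∈ s, B y (U y) (U y) = 1
  vertical : ∀ y ∈ s, fderiv ℝ F y (U y) = 0
  pos : ∀ y ∈ s, 0 < lam y
  conformal : ∀ y ∈ s, ∀ v w, B y (U y) v = 0 → B y (U y) w = 0 →
    H (F y) (fderiv ℝ F y v) (fderiv ℝ F y w) = lam y ^ 2 * B y v w

namespace IsSemiConformalOn

variable {B : BilinField 3} {s : Set (Euc 3)} {H : BilinField 2} {t : Set (Euc 2)}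
  {F : Euc 3 → Euc 2} {lam : Euc 3 → ℝ} {U : CoordField 3} {x : Euc 3}

/-- Conformality gives 0 = λ²|v|² for a horizontal v killed by the differential. -/
theorem eq_zero (h : IsSemiConformalOn B s H t F lam U) (hx : x ∈ s) {v : Euc 3}
    (h1 : fderiv ℝ F x v = 0) (h2 : B x (U x) v = 0) : v = 0 := by
  by_contra hne
  have h3 := h.conformal x hx v v h2 h2
  rw [h1, map_zero] at h3
  exact (mul_pos (pow_pos (h.pos x hx) 2) (h.source.pos x hx v hne)).ne h3

theorem eq_smul (h : IsSemiConformalOn B s H t F lam U) (hx : x ∈ s) {v : Euc 3}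
    (h1 : fderiv ℝ F x v = 0) : v = B x (U x) v • U x := by
  rw [← sub_eq_zero]
  refine h.eq_zero hx ?_ ?_
  · rw [map_sub, map_smul, h.vertical x hx, h1]; simp
  · rw [map_sub, map_smul, h.unit x hx]; simp

/-- The horizontal lift of a vector. -/
def lift (B : BilinField 3) (F : Euc 3 → Euc 2) (U : CoordField 3) (y : Euc 3) (w : Euc 2) :
    Euc 3 :=
  ((fderiv ℝ F y).prod (B y (U y))).inverse (w, (0 : ℝ))

/-- The map v ↦ (dF v, θ(v)) is injective by `eq_zero` and 3 = 2 + 1. The lift of w is its inverse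
at (w, 0), hence smooth in the base point. -/
theorem isInvertible (h : IsSemiConformalOn B s H t F lam U) (hx : x ∈ s) :
    ((fderiv ℝ F x).prod (B x (U x))).IsInvertible := by
  have hinj : Function.Injective ((fderiv ℝ F x).prod (B x (U x))) := by
    rw [injective_iff_map_eq_zero]
    intro v hv
    have h1 := congrArg Prod.fst hv
    have h2 := congrArg Prod.snd hv
    exact h.eq_zero hx h1 h2
  have hfr : Module.finrank ℝ (Euc 3) = Module.finrank ℝ (Euc 2 × ℝ) := by simp
  let e := LinearEquiv.ofInjectiveOfFinrankEq
    ((fderiv ℝ F x).prod (B x (U x)) : Euc 3 →ₗ[ℝ] Euc 2 × ℝ) hinj hfr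
  exact ⟨e.toContinuousLinearEquiv, by ext v <;> rfl⟩

theorem apply_lift (h : IsSemiConformalOn B s H t F lam U) (hx : x ∈ s) (w : Euc 2) :
    fderiv ℝ F x (lift B F U x w) = w ∧ B x (U x) (lift B F U x w) = 0 := by
  obtain ⟨e, he⟩ := h.isInvertible hx
  have h1 : ((fderiv ℝ F x).prod (B x (U x))) (lift B F U x w) = (w, 0) := by
    rw [lift, ← he, ContinuousLinearMap.inverse_equiv]
    simp
  exact ⟨congrArg Prod.fst h1, congrArg Prod.snd h1⟩

theorem smooth_lift (h : IsSemiConformalOn B s H t F lam U) {w : Euc 3 → Euc 2}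
    (hw : ContDiffOn ℝ ∞ w s) : ContDiffOn ℝ ∞ (fun y => lift B F U y (w y)) s := by
  have h1 : ContDiffOn ℝ ∞ (fun y => (fderiv ℝ F y).prod (B y (U y))) s :=
    contDiffOn_clm_apply.2 fun v =>
      ((h.smooth.fderiv_of_isOpen h.source.isOpen (by simp)).clm_apply contDiffOn_const).prodMk
        ((h.source.smooth.clm_apply h.smooth_vertical).clm_apply contDiffOn_const)
  have h2 : ContDiffOn ℝ ∞ (fun y => ((fderiv ℝ F y).prod (B y (U y))).inverse) s := by
    intro y hy
    obtain ⟨e, he⟩ := h.isInvertible hy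
    have h3 : ContDiffAt ℝ ∞ ContinuousLinearMap.inverse ((fderiv ℝ F y).prod (B y (U y))) := by
      rw [← he]; exact contDiffAt_map_inverse e
    exact h3.comp_contDiffWithinAt y (h1 y hy)
  exact h2.clm_apply (hw.prodMk contDiffOn_const)

/-- The dilation is only assumed positive. It is smooth because λ⁻² is the squared length of the
horizontal lift of a unit field. -/
theorem smooth_dilation (h : IsSemiConformalOn B s H t F lam U) : ContDiffOn ℝ ∞ lam s := by
  obtain ⟨ε, hε⟩ := exists_orthonormalFrame h.target
  set V : CoordField 3 := fun y => lift B F U y (ε 0 (F y)) with hVdef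
  have hV : ContDiffOn ℝ ∞ V s := h.smooth_lift ((hε.smooth 0).comp h.smooth h.mapsTo)
  have h1 : ContDiffOn ℝ ∞ (fun y => B y (V y) (V y)) s :=
    (h.source.smooth.clm_apply hV).clm_apply hV
  have h2 : ∀ y ∈ s, lam y ^ 2 * B y (V y) (V y) = 1 := by
    intro y hy
    obtain ⟨h3, h4⟩ := h.apply_lift hy (ε 0 (F y))
    rw [← h.conformal y hy _ _ h4 h4, h3, hε.orth _ (h.mapsTo hy)]
    simp
  have h5 : ∀ y ∈ s, 0 < B y (V y) (V y) := by
    intro y hy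
    have := h2 y hy
    have hp := pow_pos (h.pos y hy) 2
    by_contra hn
    nlinarith [mul_nonneg hp.le (sub_nonneg.2 (not_lt.1 hn))]
  have h6 : ContDiffOn ℝ ∞ (fun y => (Real.sqrt (B y (V y) (V y)))⁻¹) s :=
    ContDiffOn.inv (h1.sqrt fun y hy => (h5 y hy).ne') fun y hy => (Real.sqrt_pos.2 (h5 y hy)).ne'
  refine h6.congr fun y hy => ?_
  rw [← Real.sqrt_inv, ← eq_inv_of_mul_eq_one_left (h2 y hy), Real.sqrt_sq (h.pos y hy).le]

end IsSemiConformalOn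

end CoordGeom

/-! ### Existence of adapted frames, and the tensor identity in coordinates. -/

namespace CoordGeom
namespace IsSemiConformalOn

variable {B : BilinField 3} {s : Set (Euc 3)} {H : BilinField 2} {t : Set (Euc 2)}
  {F : Euc 3 → Euc 2} {lam : Euc 3 → ℝ} {U : CoordField 3} {x : Euc 3}

/-- The lifts E_j are related to ε_j and U to 0, so [E_j, U] and [E₀, E₁] minus the lift of [ε₀, ε₁]
are vertical. Rescaling the lifts by λ contributes the terms in d ln λ. -/
theorem exists_adaptedFrame (h : IsSemiConformalOn B s H t F lam U) :
    ∃ (e : Fin 3 → CoordField 3) (a b i σ m₀ m₁ : Euc 3 → ℝ),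
      IsAdaptedFrame B s e a b i σ m₀ m₁ (fun y => Real.log (lam y)) ∧ e 2 = U ∧
      ∀ x ∈ s, lam x ^ 2 * gaussCurvature (bilin H) (F x) =
      (fderiv ℝ b x (e 0 x) - fderiv ℝ (fun y => fderiv ℝ (fun y => Real.log (lam y)) y (e 0 y))
          x (e 0 x)
        - fderiv ℝ (fun y => Real.log (lam y)) x (e 0 x)
          * (b x - fderiv ℝ (fun y => Real.log (lam y)) x (e 0 x)))
      - (fderiv ℝ a x (e 1 x) + fderiv ℝ (fun y => fderiv ℝ (fun y => Real.log (lam y)) y (e 1 y))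
          x (e 1 x)
        - fderiv ℝ (fun y => Real.log (lam y)) x (e 1 x)
          * (a x + fderiv ℝ (fun y => Real.log (lam y)) x (e 1 x)))
      - (a x + fderiv ℝ (fun y => Real.log (lam y)) x (e 1 x)) ^ 2
      - (b x - fderiv ℝ (fun y => Real.log (lam y)) x (e 0 x)) ^ 2 := by
  have hs := h.source.isOpen
  have ht := h.target.isOpen
  obtain ⟨ε, hε⟩ := exists_orthonormalFrame h.target
  have hlam := h.smooth_dilation
  have hl : ContDiffOn ℝ ∞ (fun y => Real.log (lam y)) s := hlam.log fun y hy => (h.pos y hy).ne'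
  set l : Euc 3 → ℝ := fun y => Real.log (lam y)
  have hdl : ∀ y ∈ s, ∀ v, fderiv ℝ lam y v = lam y * fderiv ℝ l y v := by
    intro y hy v
    have hne := (h.pos y hy).ne'
    have h1 := (differentiableAt_of_smoothOn hs hlam hy).hasFDerivAt.log hne
    rw [h1.fderiv]
    simp [hne]
  have hDl : ContDiffOn ℝ ∞ (fderiv ℝ l) s := hl.fderiv_of_isOpen hs (by simp)
  let E : Fin 2 → CoordField 3 := fun j y => lift B F U y (ε j (F y))
  have hE : ∀ j, ContDiffOn ℝ ∞ (E j) s := fun j =>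
    h.smooth_lift ((hε.smooth j).comp h.smooth h.mapsTo)
  have hFE : ∀ y ∈ s, ∀ j, fderiv ℝ F y (E j y) = ε j (F y) := fun y hy j =>
    (h.apply_lift hy _).1
  have hUE : ∀ y ∈ s, ∀ j, B y (U y) (E j y) = 0 := fun y hy j => (h.apply_lift hy _).2
  have hEE : ∀ y ∈ s, ∀ j k, lam y ^ 2 * B y (E j y) (E k y) = if j = k then 1 else 0 := by
    intro y hy j k
    rw [← h.conformal y hy _ _ (hUE y hy j) (hUE y hy k), hFE y hy, hFE y hy,
      hε.orth _ (h.mapsTo hy)]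
  have hbr : ∀ {V W : CoordField 3}, ContDiffOn ℝ ∞ V s → ContDiffOn ℝ ∞ W s →
      ContDiffOn ℝ ∞ (VectorField.lieBracket ℝ V W) s := by
    intro V W hV hW
    exact ((hW.fderiv_of_isOpen hs (by simp)).clm_apply hV).sub
      ((hV.fderiv_of_isOpen hs (by simp)).clm_apply hW)
  have hbrε : ContDiffOn ℝ ∞ (VectorField.lieBracket ℝ (ε 0) (ε 1)) t :=
    (((hε.smooth 1).fderiv_of_isOpen ht (by simp)).clm_apply (hε.smooth 0)).sub
      (((hε.smooth 0).fderiv_of_isOpen ht (by simp)).clm_apply (hε.smooth 1))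
  let k : Fin 2 → Euc 2 → ℝ := fun j z => H z (VectorField.lieBracket ℝ (ε 0) (ε 1) z) (ε j z)
  have hk : ∀ j, ContDiffOn ℝ ∞ (k j) t := fun j =>
    (h.target.smooth.clm_apply hbrε).clm_apply (hε.smooth j)
  have hkε : ∀ z ∈ t, VectorField.lieBracket ℝ (ε 0) (ε 1) z = k 0 z • ε 0 z + k 1 z • ε 1 z := by
    intro z hz
    rw [← Fin.sum_univ_two (f := fun j => k j z • ε j z), hε.sum_smul hz]
  let κ : Fin 2 → Euc 3 → ℝ := fun j y => lam y * k j (F y)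
  have hkF : ∀ j, ContDiffOn ℝ ∞ (fun y => k j (F y)) s := fun j => (hk j).comp h.smooth h.mapsTo
  have hκ : ∀ j, ContDiffOn ℝ ∞ (κ j) s := fun j => hlam.mul (hkF j)
  -- brackets of the horizontal lifts
  let ι : Euc 3 → ℝ := fun y => B y (U y) (VectorField.lieBracket ℝ (E 0) (E 1) y)
  let m : Fin 2 → Euc 3 → ℝ := fun j y => B y (U y) (VectorField.lieBracket ℝ (E j) U y)
  have hι : ContDiffOn ℝ ∞ ι s :=
    (h.source.smooth.clm_apply h.smooth_vertical).clm_apply (hbr (hE 0) (hE 1))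
  have hm : ∀ j, ContDiffOn ℝ ∞ (m j) s := fun j =>
    (h.source.smooth.clm_apply h.smooth_vertical).clm_apply (hbr (hE j) h.smooth_vertical)
  have hEU : ∀ y ∈ s, ∀ j, VectorField.lieBracket ℝ (E j) U y = m j y • U y := by
    intro y hy j
    refine h.eq_smul hy ?_
    rw [fderiv_lieBracket_of_related hs ht h.smooth h.mapsTo hy (hE j) h.smooth_vertical
      (hε.smooth j) (W' := 0) contDiffOn_const (fun z hz => hFE z hz j) h.vertical]
    simp
  have hE01 : ∀ y ∈ s, VectorField.lieBracket ℝ (E 0) (E 1) y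
      = k 0 (F y) • E 0 y + k 1 (F y) • E 1 y + ι y • U y := by
    intro y hy
    have h1 := h.eq_smul hy (v := VectorField.lieBracket ℝ (E 0) (E 1) y
      - (k 0 (F y) • E 0 y + k 1 (F y) • E 1 y)) (by
        rw [map_sub, map_add, map_smul, map_smul, hFE y hy, hFE y hy,
          ← hkε _ (h.mapsTo hy),
          fderiv_lieBracket_of_related hs ht h.smooth h.mapsTo hy (hE 0) (hE 1)
          (hε.smooth 0) (hε.smooth 1) (fun z hz => hFE z hz 0) (fun z hz => hFE z hz 1), sub_self])
    rw [map_sub, map_add, map_smul, map_smul, hUE y hy, hUE y hy] at h1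
    rw [sub_eq_iff_eq_add.1 h1]
    simp only [smul_zero, add_zero, sub_zero]
    rw [add_comm]
  have dd := fun {y : Euc 3} (hy : y ∈ s) {G : Type} [NormedAddCommGroup G] [NormedSpace ℝ G]
    {g : Euc 3 → G} (hg : ContDiffOn ℝ ∞ g s) => differentiableAt_of_smoothOn hs hg hy
  let e : Fin 3 → CoordField 3 := ![fun y => lam y • E 0 y, fun y => lam y • E 1 y, U]
  have hs0 : ContDiffOn ℝ ∞ (fun y => fderiv ℝ l y (lam y • E 0 y)) s :=
    hDl.clm_apply (hlam.smul (hE 0))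
  have hs1 : ContDiffOn ℝ ∞ (fun y => fderiv ℝ l y (lam y • E 1 y)) s :=
    hDl.clm_apply (hlam.smul (hE 1))
  have hframe : IsOrthonormalFrame B s e := by
    refine ⟨fun j => ?_, fun y hy p q => ?_⟩
    · fin_cases j
      · exact hlam.smul (hE 0)
      · exact hlam.smul (hE 1)
      · exact h.smooth_vertical
    · have h00 := hEE y hy 0 0
      have h01 := hEE y hy 0 1
      have h10 := hEE y hy 1 0
      have h11 := hEE y hy 1 1
      have hEU' : ∀ j, B y (E j y) (U y) = 0 := fun j => by
        rw [h.source.symm y hy, hUE y hy]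
      fin_cases p <;> fin_cases q <;>
        simp only [e, Fin.isValue, Fin.zero_eta, Fin.mk_one, Fin.reduceFinMk, Matrix.cons_val,
          map_smul, _root_.smul_apply, smul_eq_mul, hUE y hy, hEU', h.unit y hy, mul_zero,
          Fin.reduceEq, if_true, if_false, zero_ne_one, one_ne_zero] at h00 h01 h10 h11 ⊢ <;>
        first | rfl | linarith
  -- With κ_j = λ k_j ∘ F, the bracket of λE₀ and λE₁ gives a = κ₀ − e₁(ln λ) and b = κ₁ + e₀(ln λ).
  -- The curvature formula to be proved is that of the surface with κ₀ = a + e₁(ln λ) and κ₁ = b −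
  -- e₀(ln λ) substituted.
  refine ⟨e, fun y => κ 0 y - fderiv ℝ l y (lam y • E 1 y),
    fun y => κ 1 y + fderiv ℝ l y (lam y • E 0 y), fun y => lam y ^ 2 * ι y,
    fun y => fderiv ℝ l y (U y), fun y => lam y * m 0 y, fun y => lam y * m 1 y,
    ⟨hframe, (hκ 0).sub hs1, (hκ 1).add hs0, (hlam.pow 2).mul hι,
      hDl.clm_apply h.smooth_vertical, hlam.mul (hm 0), hlam.mul (hm 1), hl, ?_, ?_, ?_,
      fun y hy => rfl⟩, rfl, ?_⟩
  · intro y hy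
    have h1 := lieBracket_smul_smul (dd hy hlam) (dd hy hlam) (dd hy (hE 0)) (dd hy (hE 1))
    simp only [e, Matrix.cons_val]
    rw [h1, hE01 y hy, hdl y hy, hdl y hy]
    simp only [map_smul, smul_eq_mul, κ]
    module
  · intro y hy
    have h1 := lieBracket_smul_smul (d := fun _ => 1) (dd hy hlam) (by fun_prop) (dd hy (hE 0))
      (dd hy h.smooth_vertical)
    simp only [one_smul] at h1
    simp only [e, Matrix.cons_val]
    rw [h1, hEU y hy, hdl y hy]
    simp
    module
  · intro y hy
    have h1 := lieBracket_smul_smul (d := fun _ => 1) (dd hy hlam) (by fun_prop) (dd hy (hE 1))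
      (dd hy h.smooth_vertical)
    simp only [one_smul] at h1
    simp only [e, Matrix.cons_val]
    rw [h1, hEU y hy, hdl y hy]
    simp
    module
  · intro y hy
    -- Chain rule: the derivative of k_j ∘ F along λE_{j'} is λ times that of k_j along ε_{j'}, and
    -- differentiating the factor λ gives the term in d ln λ.
    have hdκ : ∀ j j', fderiv ℝ (κ j) y (lam y • E j' y)
        = lam y ^ 2 * fderiv ℝ (k j) (F y) (ε j' (F y))
          + fderiv ℝ l y (lam y • E j' y) * κ j y := by
      intro j j'
      have h2 := (differentiableAt_of_smoothOn ht (hk j) (h.mapsTo hy)).hasFDerivAt.comp y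
        (dd hy h.smooth).hasFDerivAt
      have h3 := ((dd hy hlam).hasFDerivAt.mul h2).fderiv
      have h4 : fderiv ℝ (κ j) y (lam y • E j' y) = _ := congrArg (fun L => L (lam y • E j' y)) h3
      rw [h4]
      simp only [_root_.add_apply, _root_.smul_apply, ContinuousLinearMap.comp_apply,
        hFE y hy, hdl y hy, map_smul, smul_eq_mul, Function.comp_apply, κ]
      ring
    have hK := hε.gaussCurvature_eq h.target (h.mapsTo hy) (hk 0) (hk 1) hkε
    simp only [e, Matrix.cons_val]
    rw [fderiv_fun_sub (dd hy (hκ 0)) (dd hy hs1), fderiv_fun_add (dd hy (hκ 1)) (dd hy hs0)]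
    simp only [_root_.add_apply, _root_.sub_apply, hdκ, hK, κ]
    ring

/-- The Ricci tensor of the total space of a semi-conformal submersion onto a surface, in terms of
the soliton tensor. -/
theorem solitonTensor_eq (h : IsSemiConformalOn B s H t F lam U) (hx : x ∈ s) {f : Euc 3 → ℝ}
    (hf : ContDiffOn ℝ ∞ f s) {X E : CoordField 3} (hX : ContDiffOn ℝ ∞ X s)
    (hE : ∀ y ∈ s, E y = X y + f y • U y - meanCurv (bilin B) U y) (A : ℝ) (v w : Euc 3) :
    solitonTensor (bilin B) (gaussCurvature (bilin H) (F x)) lam U f X A x v w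
      = ricci (bilin B) x v w + (1 / 2) * lieMetric E (bilin B) x v w + A * B x v w := by
  obtain ⟨e, a, b, i, σ, m₀, m₁, he, rfl, hK⟩ := h.exists_adaptedFrame
  have hs := h.source.isOpen
  -- Y is fU − μ, so that E = X + Y near x and the Lie derivative splits.
  set Y : CoordField 3 := fun y => ∑ t, (![-m₀, -m₁, f] : Fin 3 → Euc 3 → ℝ) t y • e t y with hY
  have hgd : ∀ t, DifferentiableAt ℝ ((![-m₀, -m₁, f] : Fin 3 → Euc 3 → ℝ) t) x := by
    intro t
    fin_cases t
    · exact (differentiableAt_of_smoothOn hs he.smooth_m₀ hx).neg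
    · exact (differentiableAt_of_smoothOn hs he.smooth_m₁ hx).neg
    · exact differentiableAt_of_smoothOn hs hf hx
  have hYd : DifferentiableAt ℝ Y x :=
    DifferentiableAt.fun_sum fun t _ => (hgd t).smul (he.frame.differentiableAt hs hx t)
  have hEY : E =ᶠ[nhds x] fun y => X y + Y y := by
    filter_upwards [hs.mem_nhds hx] with y hy
    rw [hE y hy, he.meanCurv_eq h.source hy, hY]
    simp [Fin.sum_univ_three]
    abel
  have hlie : ∀ v w, lieMetric E (bilin B) x v w
      = lieMetric X (bilin B) x v w + lieMetric Y (bilin B) x v w := by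
    intro v w
    rw [← lieMetric_add (isBilin_clm (B x)) (differentiableAt_of_smoothOn hs hX hx) hYd]
    rw [lieMetric, lieMetric, hEY.fderiv_eq, hEY.eq_of_nhds]
  simp only [hlie]
  refine he.frame.bilin_ext hx (R := fun v w => ricci (bilin B) x v w + (1 / 2) *
    (lieMetric X (bilin B) x v w + lieMetric Y (bilin B) x v w) + A * B x v w) (he.isBilin_solitonTensor h.source hx _ A X) ?_ ?_ v w
  · exact ((he.frame.isBilin_ricci h.source hx).add
      (((h.source.isBilin_lieMetric hx X).add (h.source.isBilin_lieMetric hx Y)).const_mul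
        (1 / 2))).add ((isBilin_clm (B x)).const_mul A)
  · exact fun j k => he.solitonTensor_frame h.source hx A hf (hK x hx) X j k

end IsSemiConformalOn

end CoordGeom

open CoordGeom

/-! ### Metrics, fields and maps in the preferred charts. -/

section Chart

variable {n : ℕ} {M : Type*} [TopologicalSpace M] [ChartedSpace (EuclideanSpace ℝ (Fin n)) M]
  [IsManifold (𝓡 n) ∞ M]

/-- The domain of the preferred chart at `p`, as a subset of the coordinate space. -/
def chartDomain (p : M) : Set (Euc n) := (extChartAt (𝓡 n) p).target

/-- The derivative of the parametrisation `chartInv p`. -/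
def chartDeriv (p : M) (x : Euc n) : Euc n →L[ℝ] Euc n :=
  mfderiv 𝓘(ℝ, EuclideanSpace ℝ (Fin n)) (𝓡 n) (chartInv p) x

/-- The scalar product at a point, as a bilinear form on the model space. -/
def innerForm (g : SmoothMetric n M) (q : M) : Euc n →L[ℝ] Euc n →L[ℝ] ℝ := g.inner q

/-- The coordinate expression of a metric, as a field of continuous bilinear forms. -/
def metricForm (g : SmoothMetric n M) (p : M) : BilinField n := fun x =>
  (innerForm g (chartInv p x)).bilinearComp (chartDeriv p x) (chartDeriv p x)

theorem bilin_metricForm (g : SmoothMetric n M) (p : M) :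
    bilin (metricForm g p) = metricInChart g p := rfl

theorem metricForm_apply (g : SmoothMetric n M) (p : M) (x v w : Euc n) :
    metricForm g p x v w = g.inner (chartInv p x) (chartDeriv p x v) (chartDeriv p x w) := rfl

omit [IsManifold (𝓡 n) ∞ M] in
theorem isOpen_chartDomain (p : M) : IsOpen (chartDomain (n := n) p) :=
  isOpen_extChartAt_target p

omit [IsManifold (𝓡 n) ∞ M] in
theorem chartPt_mem (p : M) : chartPt (n := n) p ∈ chartDomain p := mem_extChartAt_target p

omit [IsManifold (𝓡 n) ∞ M] in
theorem chartInv_chartPt (p : M) : chartInv p (chartPt (n := n) p) = p := extChartAt_to_inv p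

theorem contMDiffAt_chartInv (p : M) {x : Euc n} (hx : x ∈ chartDomain p) :
    ContMDiffAt 𝓘(ℝ, EuclideanSpace ℝ (Fin n)) (𝓡 n) ∞ (chartInv p) x :=
  (contMDiffOn_extChartAt_symm p).contMDiffAt ((isOpen_chartDomain p).mem_nhds hx)

theorem contMDiffAt_extChart (p : M) {q : M} (hq : q ∈ (extChartAt (𝓡 n) p).source) :
    ContMDiffAt (𝓡 n) 𝓘(ℝ, EuclideanSpace ℝ (Fin n)) ∞ (extChartAt (𝓡 n) p) q :=
  contMDiffAt_extChartAt' (by simpa using hq)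

omit [IsManifold (𝓡 n) ∞ M] in
theorem chartInv_mem (p : M) {x : Euc n} (hx : x ∈ chartDomain p) :
    chartInv p x ∈ (extChartAt (𝓡 n) p).source := (extChartAt (𝓡 n) p).map_target hx

theorem isInvertible_mfderiv_chartInv (p : M) {x : Euc n} (hx : x ∈ chartDomain p) :
    (mfderiv 𝓘(ℝ, EuclideanSpace ℝ (Fin n)) (𝓡 n) (chartInv p) x).IsInvertible := by
  have := isInvertible_mfderivWithin_extChartAt_symm (I := 𝓡 n) (x := p) hx
  rw [ModelWithCorners.range_eq_univ, mfderivWithin_univ] at this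
  exact this

/-- Reading the chart derivative as a linear equivalence of the model space turns the pullback of
fields into its plain inverse. -/
theorem exists_chartDeriv_equiv (p : M) {x : Euc n} (hx : x ∈ chartDomain p) :
    ∃ e : Euc n ≃L[ℝ] Euc n, (∀ v, chartDeriv p x v = e v) ∧
      ∀ V : (q : M) → TangentSpace (𝓡 n) q, fieldInChart V p x = e.symm (V (chartInv p x)) := by
  obtain ⟨e, he⟩ := isInvertible_mfderiv_chartInv p hx
  refine ⟨e, fun v => (congrArg (fun L => L v) he).symm, fun V => ?_⟩
  rw [fieldInChart, VectorField.mpullback_apply, ← he, ContinuousLinearMap.inverse_equiv]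
  rfl

theorem chartDeriv_injective (p : M) {x : Euc n} (hx : x ∈ chartDomain p) :
    Function.Injective (chartDeriv p x) := by
  obtain ⟨e, he, -⟩ := exists_chartDeriv_equiv p hx
  intro v w h
  rw [he, he] at h
  exact e.injective h

theorem chartDeriv_surjective (p : M) {x : Euc n} (hx : x ∈ chartDomain p) :
    Function.Surjective (chartDeriv p x) := by
  obtain ⟨e, he, -⟩ := exists_chartDeriv_equiv p hx
  exact fun w => ⟨e.symm w, by rw [he, e.apply_symm_apply]⟩

theorem chartDeriv_fieldInChart (V : (q : M) → TangentSpace (𝓡 n) q) (p : M) {x : Euc n}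
    (hx : x ∈ chartDomain p) : chartDeriv p x (fieldInChart V p x) = V (chartInv p x) := by
  obtain ⟨e, he, hV⟩ := exists_chartDeriv_equiv p hx
  rw [he, hV]
  exact e.apply_symm_apply _

theorem metricForm_fieldInChart (g : SmoothMetric n M) (V W : (q : M) → TangentSpace (𝓡 n) q)
    (p : M) {x : Euc n} (hx : x ∈ chartDomain p) :
    metricForm g p x (fieldInChart V p x) (fieldInChart W p x)
      = g.inner (chartInv p x) (V (chartInv p x)) (W (chartInv p x)) := by
  rw [metricForm_apply, chartDeriv_fieldInChart V p hx, chartDeriv_fieldInChart W p hx]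

/-- The vector field on the chart source with a given coordinate expression. -/
def pushField (p : M) (Z : CoordField n) : (q : M) → TangentSpace (𝓡 n) q := fun q =>
  chartDeriv p (extChartAt (𝓡 n) p q) (Z (extChartAt (𝓡 n) p q))

/-- Pushing forward by the parametrisation is pulling back by the chart, so smoothness of pullbacks
of fields applies. The `id` only retypes Z x as a tangent vector. -/
theorem pushField_eq_mpullback (p : M) (Z : CoordField n) {q : M}
    (hq : q ∈ (extChartAt (𝓡 n) p).source) : pushField p Z q =
      VectorField.mpullback (𝓡 n) 𝓘(ℝ, EuclideanSpace ℝ (Fin n)) (extChartAt (𝓡 n) p)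
        (fun x => (id (Z x) : TangentSpace 𝓘(ℝ, EuclideanSpace ℝ (Fin n)) x)) q := by
  have h1 := isInvertible_mfderiv_extChartAt (I := 𝓡 n) hq
  have h2 := mfderiv_extChartAt_comp_mfderivWithin_extChartAt_symm (I := 𝓡 n) (x := p)
    ((extChartAt (𝓡 n) p).map_source hq)
  rw [(extChartAt (𝓡 n) p).left_inv hq, ModelWithCorners.range_eq_univ, mfderivWithin_univ] at h2
  have h3 : mfderiv (𝓡 n) 𝓘(ℝ, EuclideanSpace ℝ (Fin n)) (extChartAt (𝓡 n) p) q (pushField p Z q)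
      = Z (extChartAt (𝓡 n) p q) := congrArg (fun L => L (Z (extChartAt (𝓡 n) p q))) h2
  exact (h1.inverse_apply_eq.2 h3.symm).symm

theorem fieldInChart_pushField (p : M) (Z : CoordField n) {x : Euc n} (hx : x ∈ chartDomain p) :
    fieldInChart (pushField p Z) p x = Z x := by
  apply chartDeriv_injective p hx
  rw [chartDeriv_fieldInChart _ p hx, pushField]
  have : extChartAt (𝓡 n) p (chartInv p x) = x := (extChartAt (𝓡 n) p).right_inv hx
  rw [this]

theorem pushField_fieldInChart (p : M) (V : (q : M) → TangentSpace (𝓡 n) q) {q : M}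
    (hq : q ∈ (extChartAt (𝓡 n) p).source) : pushField p (fieldInChart V p) q = V q := by
  rw [pushField, chartDeriv_fieldInChart V p ((extChartAt (𝓡 n) p).map_source hq)]
  have : chartInv p (extChartAt (𝓡 n) p q) = q := (extChartAt (𝓡 n) p).left_inv hq
  rw [this]

theorem smoothFieldOn_pushField (p : M) {Z : CoordField n} {t : Set (Euc n)}
    (hZ : ContDiffOn ℝ ∞ Z t) :
    SmoothFieldOn (pushField p Z) ((extChartAt (𝓡 n) p).source ∩ extChartAt (𝓡 n) p ⁻¹' t) := by
  intro q hq
  have h1 : ContMDiffWithinAt 𝓘(ℝ, EuclideanSpace ℝ (Fin n))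
      𝓘(ℝ, EuclideanSpace ℝ (Fin n)).tangent ∞
      (fun x => (⟨x, Z x⟩ : TangentBundle 𝓘(ℝ, EuclideanSpace ℝ (Fin n)) (Euc n))) t
      (extChartAt (𝓡 n) p q) :=
    contMDiffWithinAt_vectorSpace_iff_contDiffWithinAt.2 (hZ _ hq.2)
  have h2 := (ContMDiffWithinAt.mpullback_vectorField_preimage h1 (contMDiffAt_extChart p hq.1)
    (isInvertible_mfderiv_extChartAt hq.1) (by simp)).mono
    (Set.inter_subset_right (s := (extChartAt (𝓡 n) p).source))
  refine h2.congr (fun q' hq' => ?_) ?_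
  · rw [pushField_eq_mpullback p Z hq'.1]; rfl
  · rw [pushField_eq_mpullback p Z hq.1]; rfl

theorem contDiffOn_fieldInChart (p : M) {V : (q : M) → TangentSpace (𝓡 n) q} {W : Set M}
    (hV : SmoothFieldOn V W) :
    ContDiffOn ℝ ∞ (fieldInChart V p) (chartDomain p ∩ chartInv p ⁻¹' W) := by
  intro x hx
  refine contMDiffWithinAt_vectorSpace_iff_contDiffWithinAt.1 ?_
  exact (ContMDiffWithinAt.mpullback_vectorField_preimage (hV _ hx.2) (contMDiffAt_chartInv p hx.1)
    (isInvertible_mfderiv_chartInv p hx.1) (by simp)).mono Set.inter_subset_right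

theorem SmoothFieldOn.contMDiffOn_inner (g : SmoothMetric n M)
    {V W : (q : M) → TangentSpace (𝓡 n) q} {s : Set M} (hV : SmoothFieldOn V s)
    (hW : SmoothFieldOn W s) :
    ContMDiffOn (𝓡 n) 𝓘(ℝ, ℝ) ∞ (fun q => g.inner q (V q) (W q)) s := by
  intro q hq
  have : ContMDiffWithinAt (𝓡 n) ((𝓡 n).prod 𝓘(ℝ)) ∞
      (fun m ↦ Bundle.TotalSpace.mk' ℝ (E := Bundle.Trivial M ℝ) m (g.inner m (V m) (W m))) s q := by
    apply ContMDiffWithinAt.clm_bundle_apply₂ (F₁ := EuclideanSpace ℝ (Fin n))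
      (F₂ := EuclideanSpace ℝ (Fin n))
    · exact g.contMDiff.contMDiffAt.contMDiffWithinAt
    · exact hV q hq
    · exact hW q hq
  simp only [Bundle.contMDiffWithinAt_totalSpace] at this
  exact this.2

theorem contDiffOn_comp_chartInv (p : M) {F : Type*} [NormedAddCommGroup F] [NormedSpace ℝ F]
    {f : M → F} {W : Set M} (hf : ContMDiffOn (𝓡 n) 𝓘(ℝ, F) ∞ f W) :
    ContDiffOn ℝ ∞ (fun x : Euc n => f (chartInv p x)) (chartDomain p ∩ chartInv p ⁻¹' W) := by
  rw [← contMDiffOn_iff_contDiffOn]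
  exact hf.comp (fun x hx => (contMDiffAt_chartInv p hx.1).contMDiffWithinAt) fun x hx => hx.2

/-- Smoothness is tested on constant vectors v, w. Their pushforwards are smooth fields on the chart
source, and g of two smooth fields is smooth. -/
theorem smooth_metricForm (g : SmoothMetric n M) (p : M) :
    ContDiffOn ℝ ∞ (metricForm g p) (chartDomain p) := by
  refine contDiffOn_clm_apply.2 fun v => contDiffOn_clm_apply.2 fun w => ?_
  have h1 : ∀ v : Euc n, SmoothFieldOn (pushField p fun _ => v) (extChartAt (𝓡 n) p).source := by
    intro v
    have := smoothFieldOn_pushField p (Z := fun _ => v) (t := Set.univ) contDiffOn_const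
    simpa using this
  have h2 := contDiffOn_comp_chartInv p ((h1 v).contMDiffOn_inner g (h1 w))
  refine (h2.mono fun x hx => ⟨hx, chartInv_mem p hx⟩).congr fun x hx => ?_
  rw [← metricForm_fieldInChart g _ _ p hx, fieldInChart_pushField p _ hx,
    fieldInChart_pushField p _ hx]

theorem innerForm_pos (g : SmoothMetric n M) (q : M) (v : Euc n) (hv : v ≠ 0) :
    0 < innerForm g q v v := g.pos q v hv

theorem innerForm_symm (g : SmoothMetric n M) (q : M) (v w : Euc n) :
    innerForm g q v w = innerForm g q w v := g.symm q v w

theorem isMetricOn_metricForm (g : SmoothMetric n M) (p : M) :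
    IsMetricOn (metricForm g p) (chartDomain p) := by
  refine ⟨isOpen_chartDomain p, smooth_metricForm g p, fun x _ v w => ?_, fun x hx v hv => ?_⟩
  · exact innerForm_symm g _ _ _
  · refine innerForm_pos g _ _ fun h => hv ?_
    exact chartDeriv_injective p hx (h.trans (map_zero (chartDeriv p x)).symm)

omit [IsManifold (𝓡 n) ∞ M] in
theorem isOpen_chartDomain_inter (p : M) {W : Set M} (hW : IsOpen W) :
    IsOpen (chartDomain (n := n) p ∩ chartInv (n := n) p ⁻¹' W) :=
  (continuousOn_extChartAt_symm p).isOpen_inter_preimage (isOpen_chartDomain p) hW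

/-- In coordinates, a smooth map intertwines the derivatives of the parametrisations. -/
theorem chartDeriv_comp {m : ℕ} {N : Type*} [TopologicalSpace N]
    [ChartedSpace (EuclideanSpace ℝ (Fin m)) N] [IsManifold (𝓡 m) ∞ N] {φ : M → N}
    (hφ : ContMDiff (𝓡 n) (𝓡 m) ∞ φ) (p : M) (r : N) {x : Euc n} (hx : x ∈ chartDomain p)
    (hr : φ (chartInv p x) ∈ (extChartAt (𝓡 m) r).source) (v : Euc n) :
    chartDeriv r (extChartAt (𝓡 m) r (φ (chartInv p x)))
      (fderiv ℝ (fun y => extChartAt (𝓡 m) r (φ (chartInv p y))) x v)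
      = mfderiv (𝓡 n) (𝓡 m) φ (chartInv p x) (chartDeriv p x v) := by
  set F : Euc n → Euc m := fun y => extChartAt (𝓡 m) r (φ (chartInv p y)) with hF
  have hI : MDifferentiableAt 𝓘(ℝ, EuclideanSpace ℝ (Fin n)) (𝓡 n) (chartInv p) x :=
    (contMDiffAt_chartInv p hx).mdifferentiableAt (by simp)
  have hφ' : MDifferentiableAt (𝓡 n) (𝓡 m) φ (chartInv p x) :=
    (hφ.contMDiffAt).mdifferentiableAt (by simp)
  have hcomp : MDifferentiableAt 𝓘(ℝ, EuclideanSpace ℝ (Fin n)) (𝓡 m)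
      (fun y => φ (chartInv p y)) x := hφ'.comp x hI
  have hE : MDifferentiableAt (𝓡 m) 𝓘(ℝ, EuclideanSpace ℝ (Fin m)) (extChartAt (𝓡 m) r)
      (φ (chartInv p x)) := (contMDiffAt_extChart r hr).mdifferentiableAt (by simp)
  have hFd : MDifferentiableAt 𝓘(ℝ, EuclideanSpace ℝ (Fin n)) 𝓘(ℝ, EuclideanSpace ℝ (Fin m)) F x :=
    hE.comp x hcomp
  have hJ : MDifferentiableAt 𝓘(ℝ, EuclideanSpace ℝ (Fin m)) (𝓡 m) (chartInv r) (F x) :=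
    (contMDiffAt_chartInv r ((extChartAt (𝓡 m) r).map_source hr)).mdifferentiableAt (by simp)
  -- The two composites agree only where φ stays in the chart at r, a neighbourhood of x, which
  -- suffices for their derivatives.
  have heq : (chartInv r ∘ F) =ᶠ[nhds x] φ ∘ chartInv p := by
    have : ∀ᶠ y in nhds x, φ (chartInv p y) ∈ (extChartAt (𝓡 m) r).source :=
      hcomp.continuousAt.preimage_mem_nhds ((isOpen_extChartAt_source r).mem_nhds hr)
    filter_upwards [this] with y hy using (extChartAt (𝓡 m) r).left_inv hy
  have h1 := hJ.hasMFDerivAt.comp x hFd.hasMFDerivAt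
  have h2 := (hφ'.hasMFDerivAt.comp x hI.hasMFDerivAt).congr_of_eventuallyEq heq
  have h3 := congrArg (fun L => L v) (hasMFDerivAt_unique h1 h2)
  rw [mfderiv_eq_fderiv] at h3
  exact h3

end Chart

/-! ### Invariance of the mean curvature field, and local unit vertical fields. -/

namespace CoordGeom

variable {n : ℕ} {B : BilinField n} {s : Set (Euc n)} {x : Euc n} {U V : CoordField n}

theorem IsMetricOn.covDeriv_self_apply_self (hB : IsMetricOn B s) (hx : x ∈ s)
    (hU : ContDiffOn ℝ ∞ U s) (h1 : ∀ y ∈ s, B y (U y) (U y) = 1) (Z : CoordField n) :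
    B x (covDeriv (bilin B) Z U x) (U x) = 0 := by
  have hd := differentiableAt_of_smoothOn hB.isOpen hU hx
  have h2 := hB.fderiv_apply hx hd hd Z
  have h3 : (fun y => B y (U y) (U y)) =ᶠ[nhds x] fun _ => 1 := by
    filter_upwards [hB.isOpen.mem_nhds hx] with y hy using h1 y hy
  rw [h3.fderiv_eq, hB.symm x hx (U x)] at h2
  simp at h2
  linarith

/-- ∇_U U is already orthogonal to U because |U| = 1. -/
theorem IsMetricOn.meanCurv_eq_covDeriv (hB : IsMetricOn B s) (hx : x ∈ s)
    (hU : ContDiffOn ℝ ∞ U s) (h1 : ∀ y ∈ s, B y (U y) (U y) = 1) :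
    meanCurv (bilin B) U x = covDeriv (bilin B) U U x := by
  have h2 := hB.covDeriv_self_apply_self hx hU h1 U
  rw [meanCurv, horProj, verProj, bilin]
  rw [show B x (covDeriv (bilin B) U U x) (U x) = 0 from h2]
  simp

/-- The mean curvature form of the trajectories of a unit field is the contraction of the exterior
derivative of its dual form. -/
theorem IsMetricOn.meanCurv_apply (hB : IsMetricOn B s) (hx : x ∈ s)
    (hU : ContDiffOn ℝ ∞ U s) (h1 : ∀ y ∈ s, B y (U y) (U y) = 1) (v : Euc n) :
    B x (meanCurv (bilin B) U x) v = extDerivFlat B U x (U x) v := by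
  have hd := differentiableAt_of_smoothOn hB.isOpen hU hx
  have hc : DifferentiableAt ℝ (fun _ : Euc n => v) x := differentiableAt_const v
  have h3 : (fun y => B y (U y) (U y)) =ᶠ[nhds x] fun _ => 1 := by
    filter_upwards [hB.isOpen.mem_nhds hx] with y hy using h1 y hy
  have h4 := hB.extDerivFlat_fields hx (V := U) (W := fun _ => v) hU hd hc
  rw [h3.fderiv_eq, hB.fderiv_apply hx hd hc U, hB.lieBracket_eq hx, map_sub,
    hB.symm x hx (U x) (covDeriv (bilin B) (fun _ => v) U x),
    hB.covDeriv_self_apply_self hx hU h1] at h4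
  rw [h4, hB.meanCurv_eq_covDeriv hx hU h1]
  simp

theorem IsMetricOn.smooth_meanCurv (hB : IsMetricOn B s) (hU : ContDiffOn ℝ ∞ U s)
    (h1 : ∀ y ∈ s, B y (U y) (U y) = 1) : ContDiffOn ℝ ∞ (meanCurv (bilin B) U) s :=
  (hB.smooth_covDeriv hU hU).congr fun _ hx => hB.meanCurv_eq_covDeriv hx hU h1

theorem IsMetricOn.meanCurv_apply_self (hB : IsMetricOn B s) (hx : x ∈ s)
    (hU : ContDiffOn ℝ ∞ U s) (h1 : ∀ y ∈ s, B y (U y) (U y) = 1) :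
    B x (meanCurv (bilin B) U x) (U x) = 0 := by
  rw [hB.meanCurv_eq_covDeriv hx hU h1, hB.covDeriv_self_apply_self hx hU h1]

/-- The mean curvature field depends only on the line field spanned by the unit field. -/
theorem IsMetricOn.meanCurv_congr (hB : IsMetricOn B s) (hx : x ∈ s)
    (hU : ContDiffOn ℝ ∞ U s) (hV : ContDiffOn ℝ ∞ V s) (hU1 : ∀ y ∈ s, B y (U y) (U y) = 1)
    (hV1 : ∀ y ∈ s, B y (V y) (V y) = 1) (hVU : ∀ y ∈ s, ∃ c : ℝ, V y = c • U y) :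
    meanCurv (bilin B) V x = meanCurv (bilin B) U x := by
  let c : Euc n → ℝ := fun y => B y (V y) (U y)
  have hc : ContDiffOn ℝ ∞ c s := (hB.smooth.clm_apply hV).clm_apply hU
  have hVc : ∀ y ∈ s, V y = c y • U y := by
    intro y hy
    obtain ⟨t, ht⟩ := hVU y hy
    simp [c, ht, hU1 y hy]
  have hc2 : ∀ y ∈ s, c y * c y = 1 := by
    intro y hy
    have := hV1 y hy
    rw [hVc y hy] at this
    simpa [hU1 y hy] using this
  have hcd := differentiableAt_of_smoothOn hB.isOpen hc hx
  -- From c² = 1 one gets 2c dc = 0 with c ≠ 0. Hence dθ_V = c dθ_U at x, and the contraction with V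
  -- = cU brings in c² = 1.
  have hdc : fderiv ℝ c x = 0 := by
    have h2 : (fun y => c y * c y) =ᶠ[nhds x] fun _ => 1 := by
      filter_upwards [hB.isOpen.mem_nhds hx] with y hy using hc2 y hy
    have h3 := h2.fderiv_eq (𝕜 := ℝ)
    have h5 : c x ≠ 0 := left_ne_zero_of_mul_eq_one (hc2 x hx)
    rw [fderiv_fun_mul hcd hcd, fderiv_const_apply, ← two_smul ℝ, smul_eq_zero, smul_eq_zero] at h3
    simpa [h5] using h3
  refine hB.eq_of_forall hx fun v => ?_
  rw [hB.meanCurv_apply hx hU hU1, hB.meanCurv_apply hx hV hV1]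
  have hflat : (fun y => B y (V y)) =ᶠ[nhds x] fun y => c y • B y (U y) := by
    filter_upwards [hB.isOpen.mem_nhds hx] with y hy
    rw [hVc y hy, map_smul]
  have h7 : extDerivFlat B V x = c x • extDerivFlat B U x := by
    ext v w
    rw [extDerivFlat_apply, hflat.fderiv_eq, fderiv_fun_smul hcd
      (differentiableAt_of_smoothOn hB.isOpen (hB.smooth_flat hU) hx), hdc]
    simp [extDerivFlat_apply]
    ring
  rw [h7, hVc x hx]
  simp only [_root_.smul_apply, map_smul, smul_eq_mul, ← mul_assoc, hc2 x hx, one_mul]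

/-- Local isometries preserve mean curvature fields. -/
theorem IsMetricOn.fderiv_meanCurv {B' : BilinField n} {s' : Set (Euc n)} {F : Euc n → Euc n}
    {U' : CoordField n} (hB : IsMetricOn B s) (hB' : IsMetricOn B' s') (hx : x ∈ s)
    (hF : ContDiffOn ℝ ∞ F s) (hst : Set.MapsTo F s s') (hU : ContDiffOn ℝ ∞ U s)
    (hU' : ContDiffOn ℝ ∞ U' s') (hU1 : ∀ y ∈ s, B y (U y) (U y) = 1)
    (hU1' : ∀ y ∈ s', B' y (U' y) (U' y) = 1)
    (hBB : ∀ y ∈ s, ∀ v w, B y v w = B' (F y) (fderiv ℝ F y v) (fderiv ℝ F y w))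
    (hUU : ∀ y ∈ s, fderiv ℝ F y (U y) = U' (F y)) (hsurj : Function.Surjective (fderiv ℝ F x)) :
    fderiv ℝ F x (meanCurv (bilin B) U x) = meanCurv (bilin B') U' (F x) := by
  have hF' := hF.fderiv_of_isOpen hB.isOpen (m := ∞) (by simp)
  have hdF := (differentiableAt_of_smoothOn hB.isOpen hF hx).hasFDerivAt
  have hdF' := (differentiableAt_of_smoothOn hB.isOpen hF' hx).hasFDerivAt
  have hdθ := (differentiableAt_of_smoothOn hB'.isOpen (hB'.smooth_flat hU')
    (hst hx)).hasFDerivAt.comp x hdF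
  have hflat : (fun y => B y (U y)) =ᶠ[nhds x] fun y => (B' (F y) (U' (F y))).comp (fderiv ℝ F y) := by
    filter_upwards [hB.isOpen.mem_nhds hx] with y hy
    ext v
    rw [hBB y hy, hUU y hy]
    rfl
  have h1 := hdθ.clm_comp hdF'
  have h2 : ∀ v w, fderiv ℝ (fun y => B y (U y)) x v w
      = B' (F x) (U' (F x)) (fderiv ℝ (fderiv ℝ F) x v w)
        + fderiv ℝ (fun y => B' y (U' y)) (F x) (fderiv ℝ F x v) (fderiv ℝ F x w) := by
    intro v w
    have h3 := congrArg (fun L => L v w) (hflat.fderiv_eq.trans h1.fderiv)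
    simpa using h3
  -- The exterior derivative commutes with pullback: the second derivative of F is symmetric and
  -- drops out.
  have hd : ∀ v w, extDerivFlat B U x v w
      = extDerivFlat B' U' (F x) (fderiv ℝ F x v) (fderiv ℝ F x w) := by
    intro v w
    rw [extDerivFlat_apply, extDerivFlat_apply, h2, h2, fderiv_fderiv_comm hB.isOpen hF hx v w]
    ring
  refine hB'.eq_of_forall (hst hx) fun z => ?_
  obtain ⟨w, rfl⟩ := hsurj z
  rw [← hBB x hx, hB.meanCurv_apply hx hU hU1, hd, hUU x hx, hB'.meanCurv_apply (hst hx) hU' hU1']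

/-- Near a point where the differential of a map to the plane is onto, there is a unit field
tangent to its fibres. -/
theorem exists_unit_vertical {B : BilinField 3} {s : Set (Euc 3)} {F : Euc 3 → Euc 2} {x : Euc 3}
    (hB : IsMetricOn B s) (hF : ContDiffOn ℝ ∞ F s) (hx : x ∈ s)
    (hsurj : Function.Surjective (fderiv ℝ F x)) :
    ∃ (t : Set (Euc 3)) (U : CoordField 3), IsOpen t ∧ x ∈ t ∧ t ⊆ s ∧ ContDiffOn ℝ ∞ U t ∧
      (∀ y ∈ t, B y (U y) (U y) = 1) ∧ ∀ y ∈ t, fderiv ℝ F y (U y) = 0 := by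
  have hker : Module.finrank ℝ (fderiv ℝ F x : Euc 3 →ₗ[ℝ] Euc 2).ker = 1 := by
    have h1 := LinearMap.finrank_range_add_finrank_ker (fderiv ℝ F x : Euc 3 →ₗ[ℝ] Euc 2)
    rw [LinearMap.range_eq_top.2 hsurj, finrank_top] at h1
    simp at h1
    omega
  obtain ⟨⟨u, hu⟩, hu0, hspan⟩ := finrank_eq_one_iff'.1 hker
  have hu0' : u ≠ 0 := fun h => hu0 (Subtype.ext h)
  -- Here u spans the kernel at x, and B x u is frozen at that point. L is invertible at x, hence on
  -- a neighbourhood, where Z = L⁻¹(0, 1) is a nonvanishing kernel field, normalised at the end.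
  let L : Euc 3 → Euc 3 →L[ℝ] Euc 2 × ℝ := fun y => (fderiv ℝ F y).prod (B x u)
  have hL : ContDiffOn ℝ ∞ L s := contDiffOn_clm_apply.2 fun v =>
    ((hF.fderiv_of_isOpen hB.isOpen (by simp)).clm_apply contDiffOn_const).prodMk contDiffOn_const
  have hinj : Function.Injective (L x) := by
    rw [injective_iff_map_eq_zero]
    intro v hv
    have h1 : fderiv ℝ F x v = 0 := congrArg Prod.fst hv
    have h2 : B x u v = 0 := congrArg Prod.snd hv
    obtain ⟨c, hc⟩ := hspan ⟨v, h1⟩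
    have hc' : c • u = v := congrArg Subtype.val hc
    rw [← hc', map_smul, smul_eq_mul] at h2
    rcases mul_eq_zero.1 h2 with h3 | h3
    · rw [← hc', h3, zero_smul]
    · exact absurd h3 (hB.pos x hx u hu0').ne'
  have hLx : L x ∈ Set.range ((↑) : (Euc 3 ≃L[ℝ] Euc 2 × ℝ) → Euc 3 →L[ℝ] Euc 2 × ℝ) :=
    ⟨(LinearEquiv.ofInjectiveOfFinrankEq (L x : Euc 3 →ₗ[ℝ] Euc 2 × ℝ) hinj
      (by simp)).toContinuousLinearEquiv, by ext v <;> rfl⟩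
  let t := s ∩ L ⁻¹' Set.range ((↑) : (Euc 3 ≃L[ℝ] Euc 2 × ℝ) → Euc 3 →L[ℝ] Euc 2 × ℝ)
  have ht : IsOpen t := hL.continuousOn.isOpen_inter_preimage hB.isOpen
    ContinuousLinearEquiv.isOpen
  let Z : CoordField 3 := fun y => (L y).inverse (0, 1)
  have hZ : ContDiffOn ℝ ∞ Z t := by
    intro y hy
    obtain ⟨e, he⟩ := hy.2
    have h3 : ContDiffAt ℝ ∞ ContinuousLinearMap.inverse (L y) := by
      rw [← he]; exact contDiffAt_map_inverse e
    exact (h3.comp_contDiffWithinAt y ((hL y hy.1).mono Set.inter_subset_left)).clm_apply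
      contDiffWithinAt_const
  have hLZ : ∀ y ∈ t, L y (Z y) = (0, 1) := by
    intro y hy
    obtain ⟨e, he⟩ := hy.2
    simp only [Z]
    rw [← he, ContinuousLinearMap.inverse_equiv]
    simp
  have hZ0 : ∀ y ∈ t, fderiv ℝ F y (Z y) = 0 := fun y hy => congrArg Prod.fst (hLZ y hy)
  have hZpos : ∀ y ∈ t, 0 < B y (Z y) (Z y) := by
    intro y hy
    refine hB.pos y hy.1 _ fun h => ?_
    have := hLZ y hy
    rw [h, map_zero] at this
    simpa using congrArg Prod.snd this
  have hBZ : ContDiffOn ℝ ∞ (fun y => B y (Z y) (Z y)) t :=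
    ((hB.smooth.mono Set.inter_subset_left).clm_apply hZ).clm_apply hZ
  refine ⟨t, fun y => (Real.sqrt (B y (Z y) (Z y)))⁻¹ • Z y, ht, ⟨hx, hLx⟩,
    Set.inter_subset_left, ?_, fun y hy => ?_, fun y hy => ?_⟩
  · exact ((hBZ.sqrt fun y hy => (hZpos y hy).ne').inv
      fun y hy => (Real.sqrt_pos.2 (hZpos y hy)).ne').smul hZ
  · have hp := hZpos y hy
    simp only [map_smul, _root_.smul_apply, smul_eq_mul]
    rw [← mul_assoc, ← mul_inv, Real.mul_self_sqrt hp.le, inv_mul_cancel₀ hp.ne']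
  · rw [map_smul, hZ0 y hy, smul_zero]

end CoordGeom

/-! ### Smoothness of vector fields on the manifold. -/

section SmoothField

variable {n : ℕ} {M : Type*} [TopologicalSpace M] [ChartedSpace (EuclideanSpace ℝ (Fin n)) M]
  [IsManifold (𝓡 n) ∞ M]

/-- A field whose coordinate expressions are smooth near each chart centre is smooth. -/
theorem smoothFieldOn_univ_of_fieldInChart {V : (q : M) → TangentSpace (𝓡 n) q}
    (hV : ∀ p : M, ∃ t, IsOpen t ∧ chartPt p ∈ t ∧ ContDiffOn ℝ ∞ (fieldInChart V p) t) :
    SmoothFieldOn V Set.univ := by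
  intro p _
  obtain ⟨t, ht, hpt, hVt⟩ := hV p
  have hmem : p ∈ (extChartAt (𝓡 n) p).source ∩ extChartAt (𝓡 n) p ⁻¹' t :=
    ⟨mem_extChartAt_source p, hpt⟩
  have h1 := (smoothFieldOn_pushField p hVt).contMDiffAt
    ((isOpen_extChartAt_preimage' p ht).mem_nhds hmem)
  refine (h1.congr_of_eventuallyEq ?_).contMDiffWithinAt
  filter_upwards [(isOpen_extChartAt_source (I := 𝓡 n) p).mem_nhds (mem_extChartAt_source p)]
    with q hq
  rw [pushField_fieldInChart p V hq]

theorem SmoothFieldOn.add {V W : (q : M) → TangentSpace (𝓡 n) q} {s : Set M}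
    (hV : SmoothFieldOn V s) (hW : SmoothFieldOn W s) : SmoothFieldOn (fun q => V q + W q) s :=
  ContMDiffOn.add_section hV hW

theorem SmoothFieldOn.sub {V W : (q : M) → TangentSpace (𝓡 n) q} {s : Set M}
    (hV : SmoothFieldOn V s) (hW : SmoothFieldOn W s) : SmoothFieldOn (fun q => V q - W q) s :=
  ContMDiffOn.sub_section hV hW

theorem SmoothFieldOn.smul {V : (q : M) → TangentSpace (𝓡 n) q} {f : M → ℝ} {s : Set M}
    (hf : ContMDiffOn (𝓡 n) 𝓘(ℝ, ℝ) ∞ f s) (hV : SmoothFieldOn V s) :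
    SmoothFieldOn (fun q => f q • V q) s :=
  ContMDiffOn.smul_section hf hV

end SmoothField

/-! ### Semi-conformal submersions of manifolds, read in charts. -/

section SemiConformalGeometry

variable {M N : Type*}
  [TopologicalSpace M] [ChartedSpace (EuclideanSpace ℝ (Fin 3)) M] [IsManifold (𝓡 3) ∞ M]
  [TopologicalSpace N] [ChartedSpace (EuclideanSpace ℝ (Fin 2)) N] [IsManifold (𝓡 2) ∞ N]
  {g : SmoothMetric 3 M} {h : SmoothMetric 2 N} {φ : M → N} {lam : M → ℝ}

/-- The differential of a map at a point, as a linear map between the model spaces. -/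
def diffMap (φ : M → N) (q : M) : Euc 3 →L[ℝ] Euc 2 := mfderiv (𝓡 3) (𝓡 2) φ q

/-- The expression of `φ` in the preferred charts at `p` and `φ p`. -/
def localRep (φ : M → N) (p : M) (x : Euc 3) : Euc 2 :=
  extChartAt (𝓡 2) (φ p) (φ (chartInv p x))

namespace IsSemiConformalSubmersion

theorem diffMap_surjective (hφ : IsSemiConformalSubmersion g h φ lam) (q : M) :
    Function.Surjective (diffMap φ q) := hφ.submersive q

/-- A vertical vector is a multiple of a given unit vertical vector. -/
theorem eq_smul_of_vertical (hφ : IsSemiConformalSubmersion g h φ lam) {q : M} {u v : Euc 3}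
    (hu : diffMap φ q u = 0) (hu1 : innerForm g q u u = 1) (hv : diffMap φ q v = 0) :
    v = innerForm g q v u • u := by
  have hker : Module.finrank ℝ (diffMap φ q : Euc 3 →ₗ[ℝ] Euc 2).ker = 1 := by
    have h1 := LinearMap.finrank_range_add_finrank_ker (diffMap φ q : Euc 3 →ₗ[ℝ] Euc 2)
    rw [LinearMap.range_eq_top.2 (hφ.diffMap_surjective q), finrank_top] at h1
    simp at h1
    omega
  have hu0 : u ≠ 0 := by
    rintro rfl
    simp at hu1
  have hne : (⟨u, hu⟩ : (diffMap φ q : Euc 3 →ₗ[ℝ] Euc 2).ker) ≠ 0 := fun h0 =>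
    hu0 (congrArg Subtype.val h0)
  obtain ⟨c, hc⟩ := (finrank_eq_one_iff_of_nonzero' _ hne).1 hker ⟨v, hv⟩
  have hc' : c • u = v := congrArg Subtype.val hc
  rw [← hc']
  simp [hu1]

theorem chartDeriv_localRep (hφ : IsSemiConformalSubmersion g h φ lam) (p : M) {x : Euc 3}
    (hx : x ∈ chartDomain p) (hr : φ (chartInv p x) ∈ (extChartAt (𝓡 2) (φ p)).source)
    (v : Euc 3) : chartDeriv (φ p) (localRep φ p x) (fderiv ℝ (localRep φ p) x v)
      = diffMap φ (chartInv p x) (chartDeriv p x v) :=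
  chartDeriv_comp hφ.contMDiff p (φ p) hx hr v

omit [IsManifold (𝓡 3) ∞ M] [IsManifold (𝓡 2) ∞ N] in
theorem chartInv_localRep (p : M) {x : Euc 3}
    (hr : φ (chartInv p x) ∈ (extChartAt (𝓡 2) (φ p)).source) :
    chartInv (φ p) (localRep φ p x) = φ (chartInv p x) := (extChartAt (𝓡 2) (φ p)).left_inv hr

theorem isOpen_preimage_source (hφ : IsSemiConformalSubmersion g h φ lam) (p : M) :
    IsOpen (φ ⁻¹' (extChartAt (𝓡 2) (φ p)).source) :=
  (isOpen_extChartAt_source (φ p)).preimage hφ.contMDiff.continuous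

theorem smooth_localRep (hφ : IsSemiConformalSubmersion g h φ lam) (p : M) :
    ContDiffOn ℝ ∞ (localRep φ p)
      (chartDomain p ∩ chartInv p ⁻¹' (φ ⁻¹' (extChartAt (𝓡 2) (φ p)).source)) := by
  refine contDiffOn_comp_chartInv p (f := fun q => extChartAt (𝓡 2) (φ p) (φ q)) ?_
  intro q hq
  exact ((contMDiffAt_extChart (φ p) hq).comp q hφ.contMDiff.contMDiffAt).contMDiffWithinAt

/-- In charts, a semi-conformal submersion with a unit vertical field is one in the sense of
coordinate geometry. -/
theorem isSemiConformalOn (hφ : IsSemiConformalSubmersion g h φ lam)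
    {U : (q : M) → TangentSpace (𝓡 3) q} {W : Set M} (hW : IsOpen W)
    (hU : IsUnitVerticalOn g φ U W) (p : M) :
    IsSemiConformalOn (metricForm g p)
      (chartDomain p ∩ chartInv p ⁻¹' (W ∩ φ ⁻¹' (extChartAt (𝓡 2) (φ p)).source))
      (metricForm h (φ p)) (chartDomain (φ p)) (localRep φ p) (fun x => lam (chartInv p x))
      (fieldInChart U p) := by
  set s := chartDomain p ∩ chartInv (n := 3) p ⁻¹' (W ∩ φ ⁻¹' (extChartAt (𝓡 2) (φ p)).source) with hs
  have hso : IsOpen s := isOpen_chartDomain_inter p (hW.inter (hφ.isOpen_preimage_source p))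
  have hdU : ∀ y ∈ s, diffMap φ (chartInv p y) (chartDeriv p y (fieldInChart U p y)) = 0 := by
    intro y hy
    rw [chartDeriv_fieldInChart U p hy.1]
    exact hU.vertical _ hy.2.1
  have hunit : ∀ y ∈ s, metricForm g p y (fieldInChart U p y) (fieldInChart U p y) = 1 := by
    intro y hy
    rw [metricForm_fieldInChart g U U p hy.1]
    exact hU.unit _ hy.2.1
  refine ⟨(isMetricOn_metricForm g p).mono hso Set.inter_subset_left,
    isMetricOn_metricForm h (φ p), (hφ.smooth_localRep p).mono fun y hy => ⟨hy.1, hy.2.2⟩,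
    fun y hy => (extChartAt (𝓡 2) (φ p)).map_source hy.2.2,
    (contDiffOn_fieldInChart p hU.smooth).mono fun y hy => ⟨hy.1, hy.2.1⟩, hunit, ?_,
    fun y _ => hφ.dilation_pos _, ?_⟩
  · intro y hy
    apply chartDeriv_injective (φ p) ((extChartAt (𝓡 2) (φ p)).map_source hy.2.2)
    have := hφ.chartDeriv_localRep p hy.1 hy.2.2 (fieldInChart U p y)
    rw [hdU y hy] at this
    rw [map_zero]
    exact this
  · intro y hy v w hv hw
    -- Orthogonality to U is orthogonality to the whole kernel, which is the line spanned by U.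
    have hhor : ∀ v, metricForm g p y (fieldInChart U p y) v = 0 →
        ∀ u : Euc 3, diffMap φ (chartInv p y) u = 0 →
          innerForm g (chartInv p y) (chartDeriv p y v) u = 0 := by
      intro v hv u hu
      rw [hφ.eq_smul_of_vertical (hdU y hy) (hunit y hy) hu, map_smul, smul_eq_mul]
      refine mul_eq_zero_of_right _ ?_
      rw [innerForm_symm]
      exact hv
    have h1 := hφ.conformal (chartInv p y) (chartDeriv p y v) (chartDeriv p y w) (hhor v hv)
      (hhor w hw)
    have h2 : innerForm h (φ (chartInv p y)) (diffMap φ (chartInv p y) (chartDeriv p y v))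
      (diffMap φ (chartInv p y) (chartDeriv p y w))
      = lam (chartInv p y) ^ 2 * metricForm g p y v w := h1
    rw [← h2, ← hφ.chartDeriv_localRep p hy.1 hy.2.2, ← hφ.chartDeriv_localRep p hy.1 hy.2.2,
      ← chartInv_localRep p hy.2.2]
    rfl

/-- A unit vertical field exists near each point. -/
theorem exists_isUnitVerticalOn (hφ : IsSemiConformalSubmersion g h φ lam) (p : M) :
    ∃ (W : Set M) (U : (q : M) → TangentSpace (𝓡 3) q), IsOpen W ∧ p ∈ W ∧
      IsUnitVerticalOn g φ U W := by
  have hpt : chartPt (n := 3) p ∈ chartDomain p ∩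
      chartInv (n := 3) p ⁻¹' (φ ⁻¹' (extChartAt (𝓡 2) (φ p)).source) := by
    refine ⟨chartPt_mem p, ?_⟩
    rw [Set.mem_preimage, chartInv_chartPt]
    exact mem_extChartAt_source (φ p)
  have hsurj : Function.Surjective (fderiv ℝ (localRep φ p) (chartPt p)) := by
    intro w
    obtain ⟨u, hu⟩ := hφ.diffMap_surjective (chartInv p (chartPt (n := 3) p))
      (chartDeriv (φ p) (localRep φ p (chartPt (n := 3) p)) w)
    obtain ⟨v, rfl⟩ := chartDeriv_surjective p hpt.1 u
    refine ⟨v, ?_⟩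
    apply chartDeriv_injective (φ p) ((extChartAt (𝓡 2) (φ p)).map_source hpt.2)
    exact (hφ.chartDeriv_localRep p hpt.1 hpt.2 v).trans hu
  obtain ⟨t, Z, ht, hxt, hts, hZ, hZ1, hZ0⟩ := exists_unit_vertical
    ((isMetricOn_metricForm g p).mono (isOpen_chartDomain_inter p (hφ.isOpen_preimage_source p))
      Set.inter_subset_left) (hφ.smooth_localRep p) hpt hsurj
  refine ⟨(extChartAt (𝓡 3) p).source ∩ extChartAt (𝓡 3) p ⁻¹' t, pushField p Z,
    isOpen_extChartAt_preimage' p ht, ⟨mem_extChartAt_source p, hxt⟩,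
    smoothFieldOn_pushField p hZ, ?_, ?_⟩
  · intro q hq
    have h1 := hφ.chartDeriv_localRep p (hts hq.2).1 (hts hq.2).2 (Z (extChartAt (𝓡 3) p q))
    rw [hZ0 _ hq.2, map_zero] at h1
    have h2 : chartInv p (extChartAt (𝓡 3) p q) = q := (extChartAt (𝓡 3) p).left_inv hq.1
    rw [h2] at h1
    exact h1.symm
  · intro q hq
    have h1 := hZ1 _ hq.2
    rw [metricForm_apply] at h1
    have h2 : chartInv p (extChartAt (𝓡 3) p q) = q := (extChartAt (𝓡 3) p).left_inv hq.1
    rw [h2] at h1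
    exact h1

end IsSemiConformalSubmersion

end SemiConformalGeometry

/-! ### The global mean curvature field of the fibres. -/

section MeanCurvature

variable {M N : Type*}
  [TopologicalSpace M] [ChartedSpace (EuclideanSpace ℝ (Fin 3)) M] [IsManifold (𝓡 3) ∞ M]
  [TopologicalSpace N] [ChartedSpace (EuclideanSpace ℝ (Fin 2)) N] [IsManifold (𝓡 2) ∞ N]
  {g : SmoothMetric 3 M} {h : SmoothMetric 2 N} {φ : M → N} {lam : M → ℝ}

/-- `μ` is the mean curvature field of the fibres of `φ`. -/
def IsMeanCurvField (g : SmoothMetric 3 M) (φ : M → N) (μ : (q : M) → TangentSpace (𝓡 3) q) :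
    Prop :=
  ∀ (p : M) (U : (q : M) → TangentSpace (𝓡 3) q) (W : Set M), IsOpen W →
    IsUnitVerticalOn g φ U W → ∀ x ∈ chartDomain p ∩ chartInv (n := 3) p ⁻¹' W,
      fieldInChart μ p x = meanCurv (bilin (metricForm g p)) (fieldInChart U p) x

omit [IsManifold (𝓡 2) ∞ N] in
theorem IsUnitVerticalOn.metricForm_self {U : (q : M) → TangentSpace (𝓡 3) q} {W : Set M}
    (hU : IsUnitVerticalOn g φ U W) (p : M) {x : Euc 3}
    (hx : x ∈ chartDomain p ∩ chartInv (n := 3) p ⁻¹' W) :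
    metricForm g p x (fieldInChart U p x) (fieldInChart U p x) = 1 := by
  rw [metricForm_fieldInChart g U U p hx.1]
  exact hU.unit _ hx.2

omit [IsManifold (𝓡 2) ∞ N] in
theorem IsUnitVerticalOn.mono {U : (q : M) → TangentSpace (𝓡 3) q} {W W' : Set M}
    (hU : IsUnitVerticalOn g φ U W) (h : W' ⊆ W) : IsUnitVerticalOn g φ U W' :=
  ⟨ContMDiffOn.mono hU.smooth h, fun q hq => hU.vertical q (h hq), fun q hq => hU.unit q (h hq)⟩

omit [IsManifold (𝓡 2) ∞ N] in
/-- The mean curvature computed in two charts gives the same tangent vector. -/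
theorem IsUnitVerticalOn.chartDeriv_meanCurv {U : (q : M) → TangentSpace (𝓡 3) q} {W : Set M}
    (hW : IsOpen W) (hU : IsUnitVerticalOn g φ U W) (p r : M) {x : Euc 3}
    (hx : x ∈ chartDomain p ∩ chartInv (n := 3) p ⁻¹' W)
    (hr : chartInv p x ∈ (extChartAt (𝓡 3) r).source) :
    chartDeriv r (extChartAt (𝓡 3) r (chartInv p x)) (meanCurv (bilin (metricForm g r))
        (fieldInChart U r) (extChartAt (𝓡 3) r (chartInv p x)))
      = chartDeriv p x (meanCurv (bilin (metricForm g p)) (fieldInChart U p) x) := by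
  set F : Euc 3 → Euc 3 := fun y => extChartAt (𝓡 3) r (chartInv p y) with hF
  set s := chartDomain p ∩ chartInv (n := 3) p ⁻¹' (W ∩ (extChartAt (𝓡 3) r).source) with hs
  have hso : IsOpen s := isOpen_chartDomain_inter p (hW.inter (isOpen_extChartAt_source r))
  have hso' := isOpen_chartDomain_inter (n := 3) r hW
  have hxs : x ∈ s := ⟨hx.1, hx.2, hr⟩
  have hsub : s ⊆ chartDomain p ∩ chartInv (n := 3) p ⁻¹' W := fun y hy => ⟨hy.1, hy.2.1⟩
  -- F is the transition map; this is `chartDeriv_comp` for the identity of M.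
  have hD : ∀ y ∈ s, ∀ v, chartDeriv r (F y) (fderiv ℝ F y v) = chartDeriv p y v := by
    intro y hy v
    have h1 := chartDeriv_comp (φ := fun q : M => q) contMDiff_id p r hy.1 hy.2.2 v
    rw [show mfderiv (𝓡 3) (𝓡 3) (fun q : M => q) (chartInv p y)
      = ContinuousLinearMap.id ℝ _ from mfderiv_id] at h1
    exact h1
  have hinv : ∀ y ∈ s, chartInv r (F y) = chartInv p y := fun y hy =>
    (extChartAt (𝓡 3) r).left_inv hy.2.2
  have hFmem : ∀ y ∈ s, F y ∈ chartDomain r := fun y hy => (extChartAt (𝓡 3) r).map_source hy.2.2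
  have hst : Set.MapsTo F s (chartDomain r ∩ chartInv (n := 3) r ⁻¹' W) := by
    intro y hy
    refine ⟨hFmem y hy, ?_⟩
    rw [Set.mem_preimage, hinv y hy]
    exact hy.2.1
  have hFs : ContDiffOn ℝ ∞ F s := by
    refine (contDiffOn_comp_chartInv p (f := extChartAt (𝓡 3) r)
      (W := (extChartAt (𝓡 3) r).source) ?_).mono fun y hy => ⟨hy.1, hy.2.2⟩
    exact fun q hq => (contMDiffAt_extChart r hq).contMDiffWithinAt
  have hsurj : Function.Surjective (fderiv ℝ F x) := by
    intro w
    obtain ⟨v, hv⟩ := chartDeriv_surjective p hx.1 (chartDeriv r (F x) w)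
    exact ⟨v, chartDeriv_injective r (hFmem x hxs) ((hD x hxs v).trans hv)⟩
  have key := IsMetricOn.fderiv_meanCurv
    ((isMetricOn_metricForm g p).mono hso Set.inter_subset_left)
    ((isMetricOn_metricForm g r).mono hso' Set.inter_subset_left) hxs hFs hst
    ((contDiffOn_fieldInChart p hU.smooth).mono hsub) (contDiffOn_fieldInChart r hU.smooth)
    (fun y hy => hU.metricForm_self p (hsub hy)) (fun y hy => hU.metricForm_self r hy)
    (fun y hy v w => ?_) (fun y hy => ?_) hsurj
  · rw [← hD x hxs, key]
  · change innerForm g (chartInv p y) (chartDeriv p y v) (chartDeriv p y w)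
      = innerForm g (chartInv r (F y)) (chartDeriv r (F y) _) (chartDeriv r (F y) _)
    rw [hD y hy, hD y hy, hinv y hy]
  · apply chartDeriv_injective r (hFmem y hy)
    rw [hD y hy, chartDeriv_fieldInChart U p hy.1, chartDeriv_fieldInChart U r (hFmem y hy),
      hinv y hy]

namespace IsSemiConformalSubmersion

/-- Two unit vertical fields are proportional in a chart. -/
theorem fieldInChart_eq_smul (hφ : IsSemiConformalSubmersion g h φ lam)
    {U V : (q : M) → TangentSpace (𝓡 3) q} {W : Set M} (hU : IsUnitVerticalOn g φ U W)
    (hV : IsVerticalOn φ V W) (p : M) {x : Euc 3}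
    (hx : x ∈ chartDomain p ∩ chartInv (n := 3) p ⁻¹' W) :
    ∃ c : ℝ, fieldInChart V p x = c • fieldInChart U p x := by
  refine ⟨innerForm g (chartInv p x) (V (chartInv p x)) (U (chartInv p x)), ?_⟩
  apply chartDeriv_injective p hx.1
  rw [map_smul, chartDeriv_fieldInChart U p hx.1, chartDeriv_fieldInChart V p hx.1]
  exact hφ.eq_smul_of_vertical (hU.vertical _ hx.2) (hU.unit _ hx.2) (hV _ hx.2)

/-- At q use the chart at q and some unit vertical field chosen near q. Independence of the field is
`meanCurv_congr` and independence of the chart is `chartDeriv_meanCurv`. -/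
theorem exists_isMeanCurvField (hφ : IsSemiConformalSubmersion g h φ lam) :
    ∃ μ : (q : M) → TangentSpace (𝓡 3) q, IsMeanCurvField g φ μ := by
  choose W' U' hW' hqW' hU' using hφ.exists_isUnitVerticalOn
  refine ⟨fun q => chartDeriv q (chartPt q)
    (meanCurv (bilin (metricForm g q)) (fieldInChart (U' q) q) (chartPt q)), ?_⟩
  intro p U W hW hU x hx
  apply chartDeriv_injective p hx.1
  refine (chartDeriv_fieldInChart _ p hx.1).trans ?_
  set q := chartInv p x with hq
  have hx' : x ∈ chartDomain p ∩ chartInv (n := 3) p ⁻¹' (W ∩ W' q) := ⟨hx.1, hx.2, hqW' q⟩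
  have hWW := hW.inter (hW' q)
  have hU1 := hU.mono (W' := W ∩ W' q) Set.inter_subset_left
  have hU2 := (hU' q).mono (W' := W ∩ W' q) Set.inter_subset_right
  have h1 := IsMetricOn.meanCurv_congr ((isMetricOn_metricForm g p).mono
    (isOpen_chartDomain_inter p hWW) Set.inter_subset_left) hx'
    (contDiffOn_fieldInChart p hU1.smooth) (contDiffOn_fieldInChart p hU2.smooth)
    (fun y hy => hU1.metricForm_self p hy) (fun y hy => hU2.metricForm_self p hy)
    (fun y hy => hφ.fieldInChart_eq_smul hU1 hU2.vertical p hy)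
  rw [← h1]
  exact (hU2.chartDeriv_meanCurv hWW p q hx' (mem_extChartAt_source q))

end IsSemiConformalSubmersion

namespace IsMeanCurvField

variable {μ : (q : M) → TangentSpace (𝓡 3) q}

theorem smooth (hμ : IsMeanCurvField g φ μ) (hφ : IsSemiConformalSubmersion g h φ lam) :
    SmoothFieldOn μ Set.univ := by
  refine smoothFieldOn_univ_of_fieldInChart fun p => ?_
  obtain ⟨W, U, hW, hpW, hU⟩ := hφ.exists_isUnitVerticalOn p
  refine ⟨chartDomain p ∩ chartInv (n := 3) p ⁻¹' W, isOpen_chartDomain_inter p hW,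
    ⟨chartPt_mem p, by rwa [Set.mem_preimage, chartInv_chartPt]⟩, ?_⟩
  exact (((isMetricOn_metricForm g p).mono (isOpen_chartDomain_inter p hW)
    Set.inter_subset_left).smooth_meanCurv (contDiffOn_fieldInChart p hU.smooth)
    fun y hy => hU.metricForm_self p hy).congr fun x hx => hμ p U W hW hU x hx

omit [IsManifold (𝓡 2) ∞ N] in
theorem inner_eq_zero (hμ : IsMeanCurvField g φ μ) {U : (q : M) → TangentSpace (𝓡 3) q} {W : Set M}
    (hW : IsOpen W) (hU : IsUnitVerticalOn g φ U W) {p : M} (hp : p ∈ W) :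
    innerForm g p (μ p) (U p) = 0 := by
  have hx : chartPt p ∈ chartDomain p ∩ chartInv (n := 3) p ⁻¹' W :=
    ⟨chartPt_mem p, by rwa [Set.mem_preimage, chartInv_chartPt]⟩
  have h1 := IsMetricOn.meanCurv_apply_self ((isMetricOn_metricForm g p).mono
    (isOpen_chartDomain_inter p hW) Set.inter_subset_left) hx
    (contDiffOn_fieldInChart p hU.smooth) fun y hy => hU.metricForm_self p hy
  rw [← hμ p U W hW hU _ hx, metricForm_fieldInChart g μ U p hx.1, chartInv_chartPt] at h1
  exact h1

end IsMeanCurvField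

end MeanCurvature

/-! ### Linear algebra of projections onto a line. -/

section BilinearForm

variable {n : ℕ} {L : Euc n →L[ℝ] Euc n →L[ℝ] ℝ}

/-- Unit vectors of one line differ by c with c² = 1, and c enters the projection twice. -/
theorem proj_eq_of_eq_smul {u u' : Euc n} (hu : L u u = 1) (hu' : L u' u' = 1)
    (h : u' = L u' u • u) (e : Euc n) : L e u' • u' = L e u • u := by
  generalize L u' u = c at h
  subst h
  have hc : c * c = 1 := by simpa [hu] using hu'
  rw [map_smul, smul_smul, smul_eq_mul, mul_right_comm, hc, one_mul]

theorem smul_apply_of_unit {u : Euc n} (hu : L u u = 1) (c : ℝ) : L (c • u) u = c := by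
  simp [hu]

/-- Used to see that E − V + μ is horizontal when V is the vertical part of E. -/
theorem sub_add_apply_of_unit {e v u m : Euc n} (hu : L u u = 1) (hv : v = L e u • u)
    (hm : L m u = 0) : L (e - v + m) u = 0 := by
  rw [map_add, map_sub, _root_.add_apply, _root_.sub_apply, hm, hv, smul_apply_of_unit hu]
  ring

end BilinearForm

/-! ### From the equation to Ricci solitons and back. -/

section Soliton

variable {M N : Type*}
  [TopologicalSpace M] [ChartedSpace (EuclideanSpace ℝ (Fin 3)) M] [IsManifold (𝓡 3) ∞ M]
  [TopologicalSpace N] [ChartedSpace (EuclideanSpace ℝ (Fin 2)) N] [IsManifold (𝓡 2) ∞ N]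
  {g : SmoothMetric 3 M} {h : SmoothMetric 2 N} {φ : M → N} {lam : M → ℝ}
  {μ : (q : M) → TangentSpace (𝓡 3) q}

namespace IsSemiConformalSubmersion

/-- The equation for the data `(U, f, X, A)` is the Ricci soliton equation of the field
`E = X + f U - μ`. -/
theorem solitonEqAt_iff (hφ : IsSemiConformalSubmersion g h φ lam) (hμ : IsMeanCurvField g φ μ)
    {U X E : (q : M) → TangentSpace (𝓡 3) q} {f : M → ℝ} {W : Set M} (hW : IsOpen W)
    (hU : IsUnitVerticalOn g φ U W) (hf : ContMDiffOn (𝓡 3) 𝓘(ℝ, ℝ) ∞ f W)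
    (hX : SmoothFieldOn X W) (hE : ∀ q ∈ W, E q = X q + f q • U q - μ q) {p : M} (hp : p ∈ W)
    (A : ℝ) :
    SolitonEqAt g h φ lam U f X A p ↔ ∀ v w : EuclideanSpace ℝ (Fin 3),
      -2 * ricci (metricInChart g p) (chartPt p) v w
        = lieMetric (fieldInChart E p) (metricInChart g p) (chartPt p) v w
          + 2 * A * metricInChart g p (chartPt p) v w := by
  set s := chartDomain p ∩ chartInv (n := 3) p ⁻¹'
    (W ∩ φ ⁻¹' (extChartAt (𝓡 2) (φ p)).source) with hs
  have hx : chartPt p ∈ s := by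
    refine ⟨chartPt_mem p, ?_⟩
    rw [Set.mem_preimage, chartInv_chartPt]
    exact ⟨hp, mem_extChartAt_source (φ p)⟩
  have hsW : s ⊆ chartDomain p ∩ chartInv (n := 3) p ⁻¹' W := fun y hy => ⟨hy.1, hy.2.1⟩
  have hEs : ∀ y ∈ s, fieldInChart E p y = fieldInChart X p y
      + f (chartInv p y) • fieldInChart U p y
      - meanCurv (bilin (metricForm g p)) (fieldInChart U p) y := by
    intro y hy
    apply chartDeriv_injective p hy.1
    rw [← hμ p U W hW hU y (hsW hy), map_sub, map_add, map_smul]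
    have hy1 := hy.1
    rw [chartDeriv_fieldInChart E p hy1, chartDeriv_fieldInChart X p hy1,
      chartDeriv_fieldInChart U p hy1, chartDeriv_fieldInChart μ p hy1]
    exact hE _ hy.2.1
  have key := (hφ.isSemiConformalOn hW hU p).solitonTensor_eq hx
    ((contDiffOn_comp_chartInv p hf).mono hsW) ((contDiffOn_fieldInChart p hX).mono hsW) hEs A
  have hF : localRep φ p (chartPt p) = chartPt (φ p) := by
    rw [localRep, chartInv_chartPt]
    rfl
  rw [hF] at key
  refine forall_congr' fun v => forall_congr' fun w => ?_
  have k := key v w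
  rw [bilin_metricForm, bilin_metricForm] at k
  rw [surfaceCurvature, k]
  have hm : metricForm g p (chartPt p) v w = metricInChart g p (chartPt p) v w := rfl
  rw [hm]
  -- The equation says Ric + ½ ℒ_E g + A g = 0; multiplying by −2 and rearranging gives the soliton
  -- equation.
  constructor <;> intro h0 <;> linarith

/-- The vertical part of a smooth vector field is smooth. -/
theorem exists_verticalPart (hφ : IsSemiConformalSubmersion g h φ lam)
    {E : (q : M) → TangentSpace (𝓡 3) q} (hE : SmoothFieldOn E Set.univ) :
    ∃ V : (q : M) → TangentSpace (𝓡 3) q, SmoothFieldOn V Set.univ ∧ IsVerticalOn φ V Set.univ ∧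
      ∀ (W : Set M) (U : (q : M) → TangentSpace (𝓡 3) q), IsUnitVerticalOn g φ U W → ∀ q ∈ W,
        V q = g.inner q (E q) (U q) • U q := by
  choose W' U' hW' hqW' hU' using hφ.exists_isUnitVerticalOn
  -- The unit field is chosen separately at each q, so V is smooth only because near a fixed q it
  -- can be computed with the single field U' q.
  let V : (q : M) → TangentSpace (𝓡 3) q := fun q => g.inner q (E q) (U' q q) • U' q q
  have hV : ∀ (W : Set M) (U : (q : M) → TangentSpace (𝓡 3) q), IsUnitVerticalOn g φ U W →
      ∀ q ∈ W, V q = g.inner q (E q) (U q) • U q := by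
    intro W U hU q hq
    have h1 := hφ.eq_smul_of_vertical (hU.vertical q hq) (hU.unit q hq)
      ((hU' q).vertical q (hqW' q))
    exact proj_eq_of_eq_smul (hU.unit q hq) ((hU' q).unit q (hqW' q)) h1 (E q)
  refine ⟨V, ?_, fun q _ => ?_, hV⟩
  · intro q _
    have h1 : SmoothFieldOn (fun r => g.inner r (E r) (U' q r) • U' q r) (W' q) :=
      SmoothFieldOn.smul (SmoothFieldOn.contMDiffOn_inner g
        (ContMDiffOn.mono hE (Set.subset_univ _)) (hU' q).smooth) (hU' q).smooth
    refine (((h1 q (hqW' q)).contMDiffAt ((hW' q).mem_nhds (hqW' q))).congr_of_eventuallyEq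
      ?_).contMDiffWithinAt
    filter_upwards [(hW' q).mem_nhds (hqW' q)] with r hr
    rw [hV (W' q) (U' q) (hU' q) r hr]
  · change diffMap φ q (V q) = 0
    have h1 : diffMap φ q (U' q q) = 0 := (hU' q).vertical q (hqW' q)
    exact (map_smul (diffMap φ q) _ _).trans (by rw [h1, smul_zero])

/-- A local unit vertical field spans each kernel, so it suffices to test against it. -/
theorem isHorizontal_of_inner_eq_zero (hφ : IsSemiConformalSubmersion g h φ lam)
    {X : (q : M) → TangentSpace (𝓡 3) q}
    (hX : ∀ (W : Set M) (U : (q : M) → TangentSpace (𝓡 3) q), IsOpen W →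
      IsUnitVerticalOn g φ U W → ∀ q ∈ W, innerForm g q (X q) (U q) = 0) :
    IsHorizontal g φ X := by
  intro q u hu
  obtain ⟨W, U, hW, hq, hU⟩ := hφ.exists_isUnitVerticalOn q
  have h1 := hφ.eq_smul_of_vertical (hU.vertical q hq) (hU.unit q hq) hu
  exact (congrArg (innerForm g q (X q)) h1).trans
    ((map_smul (innerForm g q (X q)) _ _).trans (mul_eq_zero_of_right _ (hX W U hW hU q hq)))

/-- A Ricci soliton field determines a solution of the equation for every local unit vertical
field. -/
theorem exists_solitonEqAt (hφ : IsSemiConformalSubmersion g h φ lam) (hg : IsRicciSoliton g) :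
    ∃ (V X : (p : M) → TangentSpace (𝓡 3) p) (A : ℝ),
      SmoothFieldOn V Set.univ ∧ IsVerticalOn φ V Set.univ ∧
      SmoothFieldOn X Set.univ ∧ IsHorizontal g φ X ∧
      ∀ (W : Set M) (U : (p : M) → TangentSpace (𝓡 3) p), IsOpen W → IsUnitVerticalOn g φ U W →
        ∀ p ∈ W, SolitonEqAt g h φ lam U (fun q => g.inner q (V q) (U q)) X A p := by
  obtain ⟨E, A, hE, hsol⟩ := hg
  obtain ⟨μ, hμ⟩ := hφ.exists_isMeanCurvField
  obtain ⟨V, hV, hVv, hVU⟩ := hφ.exists_verticalPart hE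
  -- X is found by solving E = X + V − μ.
  have hX : SmoothFieldOn (fun q => E q - V q + μ q) Set.univ := (hE.sub hV).add (hμ.smooth hφ)
  refine ⟨V, fun q => E q - V q + μ q, A, hV, hVv, hX, ?_, ?_⟩
  · refine hφ.isHorizontal_of_inner_eq_zero fun W U hW hU q hq => ?_
    exact sub_add_apply_of_unit (hU.unit q hq) (hVU W U hU q hq) (hμ.inner_eq_zero hW hU hq)
  · intro W U hW hU p hp
    refine (hφ.solitonEqAt_iff hμ hW hU (E := E)
      (SmoothFieldOn.contMDiffOn_inner g (ContMDiffOn.mono hV (Set.subset_univ W)) hU.smooth)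
      (ContMDiffOn.mono hX (Set.subset_univ W)) (fun q hq => ?_) hp A).2 (hsol p)
    have h1 : V q = innerForm g q (V q) (U q) • U q :=
      hφ.eq_smul_of_vertical (hU.vertical q hq) (hU.unit q hq) (hVv q trivial)
    change E q = E q - V q + μ q + innerForm g q (V q) (U q) • U q - μ q
    rw [← h1]
    abel

/-- A solution of the equation on local unit vertical fields determines a Ricci soliton field. -/
theorem isRicciSoliton_of_solitonEqAt (hφ : IsSemiConformalSubmersion g h φ lam)
    {V X : (p : M) → TangentSpace (𝓡 3) p} (A : ℝ) (hV : SmoothFieldOn V Set.univ)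
    (hVv : IsVerticalOn φ V Set.univ) (hX : SmoothFieldOn X Set.univ)
    (heq : ∀ p : M, ∃ (W : Set M) (U : (p : M) → TangentSpace (𝓡 3) p), IsOpen W ∧ p ∈ W ∧
      IsUnitVerticalOn g φ U W ∧ SolitonEqAt g h φ lam U (fun q => g.inner q (V q) (U q)) X A p) :
    IsRicciSoliton g := by
  obtain ⟨μ, hμ⟩ := hφ.exists_isMeanCurvField
  refine ⟨fun q => X q + V q - μ q, A, (hX.add hV).sub (hμ.smooth hφ), fun p => ?_⟩
  obtain ⟨W, U, hW, hp, hU, hsol⟩ := heq p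
  refine (hφ.solitonEqAt_iff hμ hW hU
    (SmoothFieldOn.contMDiffOn_inner g (ContMDiffOn.mono hV (Set.subset_univ W)) hU.smooth)
    (ContMDiffOn.mono hX (Set.subset_univ W)) (fun q hq => ?_) hp A).1 hsol
  have h1 : V q = innerForm g q (V q) (U q) • U q :=
    hφ.eq_smul_of_vertical (hU.vertical q hq) (hU.unit q hq) (hVv q trivial)
  change X q + V q - μ q = X q + innerForm g q (V q) (U q) • U q - μ q
  rw [← h1]

end IsSemiConformalSubmersion

end Soliton

end

/-! ### The two equivalences. -/

theorem mainTheorem5 {M N : Type*}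
    [TopologicalSpace M] [ChartedSpace (EuclideanSpace ℝ (Fin 3)) M] [IsManifold (𝓡 3) ∞ M]
    [TopologicalSpace N] [ChartedSpace (EuclideanSpace ℝ (Fin 2)) N] [IsManifold (𝓡 2) ∞ N]
    (g : SmoothMetric 3 M) (h : SmoothMetric 2 N) (φ : M → N) (lam : M → ℝ)
    (hφ : IsSemiConformalSubmersion g h φ lam) :
    (∀ U : (p : M) → TangentSpace (𝓡 3) p, IsUnitVerticalOn g φ U Set.univ →
      (IsRicciSoliton g ↔
        ∃ (f : M → ℝ) (X : (p : M) → TangentSpace (𝓡 3) p) (A : ℝ),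
          ContMDiff (𝓡 3) 𝓘(ℝ, ℝ) ∞ f ∧ SmoothFieldOn X Set.univ ∧ IsHorizontal g φ X ∧
          ∀ p : M, SolitonEqAt g h φ lam U f X A p)) ∧
    (IsRicciSoliton g ↔
      ∃ (V : (p : M) → TangentSpace (𝓡 3) p) (X : (p : M) → TangentSpace (𝓡 3) p) (A : ℝ),
        SmoothFieldOn V Set.univ ∧ IsVerticalOn φ V Set.univ ∧
        SmoothFieldOn X Set.univ ∧ IsHorizontal g φ X ∧
        ∀ (W : Set M) (U : (p : M) → TangentSpace (𝓡 3) p), IsOpen W → IsUnitVerticalOn g φ U W →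
          ∀ p ∈ W, SolitonEqAt g h φ lam U (fun q => g.inner q (V q) (U q)) X A p) := by
  refine ⟨fun U hU => ⟨fun hg => ?_, ?_⟩, hφ.exists_solitonEqAt, ?_⟩
  · obtain ⟨V, X, A, hV, -, hX, hXh, heq⟩ := hφ.exists_solitonEqAt hg
    exact ⟨fun q => g.inner q (V q) (U q), X, A,
      contMDiffOn_univ.1 (hV.contMDiffOn_inner g hU.smooth), hX, hXh,
      fun p => heq Set.univ U isOpen_univ hU p trivial⟩
  · rintro ⟨f, X, A, hf, hX, -, heq⟩
    -- A global f corresponds to the vertical field V = fU, from which it is recovered as g(V, U).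
    -- The converse in part 1 thus becomes that of part 2, with the same U used at every point.
    have hfU : (fun q => g.inner q (f q • U q) (U q)) = f := by
      funext q
      exact smul_apply_of_unit (L := innerForm g q) (hU.unit q trivial) (f q)
    refine hφ.isRicciSoliton_of_solitonEqAt A (SmoothFieldOn.smul hf.contMDiffOn hU.smooth)
      (fun q _ => ?_) hX fun p => ⟨Set.univ, U, isOpen_univ, trivial, hU, ?_⟩
    · have h1 : diffMap φ q (U q) = 0 := hU.vertical q trivial
      exact (map_smul (diffMap φ q) (f q) (U q)).trans ((congrArg (f q • ·) h1).trans (smul_zero _))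
    · rw [hfU]
      exact heq p
  · rintro ⟨V, X, A, hV, hVv, hX, -, heq⟩
    refine hφ.isRicciSoliton_of_solitonEqAt A hV hVv hX fun p => ?_
    obtain ⟨W, U, hW, hp, hU⟩ := hφ.exists_isUnitVerticalOn p
    exact ⟨W, U, hW, hp, hU, heq W U hW hU p hp⟩
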